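/- Let $1<p<\infty$ and $p'=p/(p-1)$. For $f\in L^1_{\rm loc}(\mathbb R^n)$ let $$(\mathcal M_nf)(x)=\sup_{B\ni x}\frac1{|B|}\int_B|f(y)|\,dy,\qquad (\mathcal N_nf)(x)=\sup_{a_i<x_i<b_i\ (1\le i\le n)}\ \prod_{i=1}^n\frac1{b_i-a_i}\int_{\prod_i[a_i,b_i]}|f(y)|\,dy,$$ where the first supremum is over all closed balls $B$ (of positive radius) that contain $x$. For $T=\mathcal M_n$ or $\mathcal N_n$ let $\|T\|_{p}$ be the operator norm on $L^p(\mathbb R^n)$, i.e. the least $C\in[0,\infty]$ with $\|Tf\|_{L^p}\le C\|f\|_{L^p}$ for all $f\in L^p(\mathbb R^n)$. Say that a sequence $(a_n)$ grows exponentially if there are $b>1$, $c>0$ and $B,C\in\mathbb R$ with $c\,b^n\le a_n\le C\,B^n$ for all large $n$. Let $\omega_k=|S^k|$ be the surface measure of the unit sphere of $\mathbb R^{k+1}$, let $B(\cdot,\cdot)$ be Euler's Beta function, and for $n\ge2$ put $$E_n=2^{n-1}p'\,\frac{\omega_{n-2}}{\omega_{n-1}}\,B\Big(\frac n{2p'}+\frac12,\frac{n-1}2\Big),\qquad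 h_{\varepsilon,N}(x)=|x|^{-n/p}\chi_{[\varepsilon,N]}(|x|)\quad(x\in\mathbb R^n).$$ Then: 1. $\|\mathcal M_n\|_{p}$ grows exponentially as $n\to\infty$. 2. For every $n\ge2$: $0<\|h_{\varepsilon,N}\|_{L^p}<\infty$ for all $0<\varepsilon<N$; the limit of $\|\mathcal M_nh_{\varepsilon,N}\|_{L^p}/\|h_{\varepsilon,N}\|_{L^p}$ as $\varepsilon\to0^+$ and $N\to\infty$ exists and is at least $E_n$; consequently $\|\mathcal M_n\|_{p}\ge E_n$. Moreover $$E_n=2^np'\,\frac{\omega_{n-2}}{\omega_{n-1}}\int_0^1s^{n/p'}(1-s^2)^{(n-3)/2}\,ds .$$ 3. As $n\to\infty$, $E_n$ is asymptotic to $$p'\sqrt{\frac{1+1/p'}2}\ \left\{\frac{4\,(1/p')^{1/p'}}{(1/p'+1)^{1/p'+1}}\right\}^{n/2}$$ (the quotient tends to $1$), and the number in braces is greater than $1$. 4. The equation $(p-1)x^p-p\,x^{p-1}-1=0$ has exactly one positive solution $c_p$, and $\frac p{p-1}<c_p<\frac{2p}{p-1}$. For every $n\ge1$, $\big(\frac p{p-1}\big)^n<\|\mathcal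 N_n\|_{p}<\big(\frac{2p}{p-1}\big)^n$; in particular $\|\mathcal N_n\|_{p}$ grows exponentially as $n\to\infty$. -/

import Mathlib

open MeasureTheory Filter Topology Asymptotics
open scoped ENNReal

noncomputable section

namespace UncenteredMaximal

/-- The uncentered Hardy–Littlewood maximal function over balls on `ℝⁿ`: the supremum, over all
closed balls of positive radius that contain `x`, of the average of `|f|`. -/
def ballMaximal (n : ℕ) (f : EuclideanSpace ℝ (Fin n) → ℝ) (x : EuclideanSpace ℝ (Fin n)) :
    ℝ≥0∞ :=
  ⨆ (z : EuclideanSpace ℝ (Fin n)) (r : ℝ) (_ : 0 < r) (_ : x ∈ Metric.closedBall z r),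
    (volume (Metric.closedBall z r))⁻¹ * ∫⁻ y in Metric.closedBall z r, ‖f y‖ₑ

/-- The strong maximal function on `ℝⁿ`: the supremum, over all boxes `∏ [aᵢ, bᵢ]` with
`aᵢ < xᵢ < bᵢ`, of the average of `|f|`. Only the Lebesgue measure of `ℝⁿ` matters here, so its
points are plain functions `Fin n → ℝ`, and `Set.Icc a b` is the box. -/
def strongMaximal (n : ℕ) (f : (Fin n → ℝ) → ℝ) (x : Fin n → ℝ) : ℝ≥0∞ :=
  ⨆ (a : Fin n → ℝ) (b : Fin n → ℝ) (_ : ∀ i, a i < x i) (_ : ∀ i, x i < b i),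
    (∏ i, ENNReal.ofReal (b i - a i))⁻¹ * ∫⁻ y in Set.Icc a b, ‖f y‖ₑ

/-- The operator norm on `Lᵖ` of a (not necessarily linear) operator `T` with values in
nonnegative extended functions: the least `C` with `‖T f‖_p ≤ C ‖f‖_p` for all `f ∈ Lᵖ`. -/
def opNorm {X : Type*} [MeasureSpace X] (p : ℝ) (T : (X → ℝ) → X → ℝ≥0∞) : ℝ≥0∞ :=
  sInf {C : ℝ≥0∞ | ∀ f : X → ℝ, MemLp f (ENNReal.ofReal p) volume →
    eLpNorm (T f) (ENNReal.ofReal p) volume ≤ C * eLpNorm f (ENNReal.ofReal p) volume}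

/-- Exponential growth of a sequence: for large `n` it lies between `c bⁿ` and `C Bⁿ`,
where `c > 0` and `b > 1`. -/
def GrowsExponentially (a : ℕ → ℝ≥0∞) : Prop :=
  ∃ b c B C : ℝ, 1 < b ∧ 0 < c ∧
    ∀ᶠ n : ℕ in atTop, ENNReal.ofReal (c * b ^ n) ≤ a n ∧ a n ≤ ENNReal.ofReal (C * B ^ n)

/-- The test function `|x|^{-n/p} χ_{[ε, N]}(|x|)` on `ℝⁿ`. -/
def testFun (n : ℕ) (p ε N : ℝ) (x : EuclideanSpace ℝ (Fin n)) : ℝ :=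
  ‖x‖ ^ (-((n : ℝ) / p)) * (Set.Icc ε N).indicator 1 ‖x‖

/-- `ω_k`, the surface measure of the unit sphere `S^k` of `ℝ^{k+1}`. -/
def sphereArea (k : ℕ) : ℝ :=
  (volume : Measure (EuclideanSpace ℝ (Fin (k + 1)))).toSphere.real Set.univ

/-- The conjugate exponent `p' = p / (p - 1)`. -/
def conj (p : ℝ) : ℝ := p / (p - 1)

/-- The explicit lower bound
`2^{n-1} p' (ω_{n-2} / ω_{n-1}) B(n / (2 p') + 1/2, (n - 1) / 2)`, meant for `n ≥ 2`. -/
def betaBound (p : ℝ) (n : ℕ) : ℝ :=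
  2 ^ (n - 1) * conj p * (sphereArea (n - 2) / sphereArea (n - 1)) *
    ProbabilityTheory.beta ((n : ℝ) / (2 * conj p) + 1 / 2) (((n : ℝ) - 1) / 2)

/-- The number `4 (1/p')^{1/p'} / (1/p' + 1)^{1/p' + 1}`. -/
def growthBase (p : ℝ) : ℝ :=
  4 * (1 / conj p) ^ (1 / conj p) / (1 / conj p + 1) ^ (1 / conj p + 1)

end UncenteredMaximal

end

open MeasureTheory Filter Topology Asymptotics
open scoped ENNReal

noncomputable section

namespace UncenteredMaximal

/-! ### Real-variable facts: the equation of the sharp constant, the growth rate, Stirling's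
formula. -/

section RealAnalysis

/-! Upper bounds. Each operator is dominated pointwise by a supremum of averages over a countable
family: balls with centres in a dense sequence and rational radii, or boxes with rational sides. For
balls, and for intervals of the line, finite subfamilies exhaust this supremum and have maximal
functions `h` with `A = ∫ h ^ p` finite. A covering inequality for such subfamilies is a weak type
inequality localized to level sets. Integrated against `t ^ (p - 2)` and combined with Hölder's
inequality it relates `A` to `A ^ (1 - 1 / p)` and `F = ∫ f ^ p`
(`lintegral_familyMax_rpow_le_of_covering`), and finiteness of `A` allows division. For balls,
Vitali's covering lemma yields the bound `p' 5 ^ n`. On the line, intervals can be thinned to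
overlap at most twice (`exists_subfamily_overlap_le_two`). This gives `(p - 1)(A + F) ≤ p (F ^ (1 /
p) A ^ (1 - 1 / p) + F)`, so `x = (A / F) ^ (1 / p)` satisfies `(p - 1) x ^ p ≤ p x ^ (p - 1) + 1`,
that is `x ≤ c_p < 2 p'`. An average over a box is an iterated average over intervals, so the strong
maximal operator has norm at most `c_p ^ n`.

Lower bound for balls. The function `|x| ^ (-n / p)` is radial and homogeneous, hence its maximal
function is `L |x| ^ (-n / p)`, where `L` is the value at a unit vector. It just fails to be in
`Lᵖ`: the `p`-th power of the norm of its truncation is `ω_{n-1} log (N / ε)`. The truncation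
disturbs the maximal function only near and beyond the two edges, at bounded cost in the integral,
so the ratio of norms tends to `L` (`tendsto_ratio_testFun`). The ball with diameter from the origin
to the unit vector gives an average equal to `E_n` (`average_closedBall_half_axis`), so `L ≥ E_n`,
and Stirling's formula shows that `E_n` grows exponentially.

Lower bound for boxes. For `f(x) = |x| ^ (α - 1)` on `[-1, 1]`, averaging from `-x / 2` to slightly
past `x` multiplies `f(x)` by nearly `(1 + 2 ^ (-α)) / (3 α / 2)`. At `α = 1 / p'` this exceeds `p'`
because `2 ^ (-1 / p') > 1 / 2`; a slightly larger `α` puts `f` in `Lᵖ`. Tensor products of `f` then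
give more than `p' ^ n`. -/

theorem conj_pos {p : ℝ} (hp : 1 < p) : 0 < conj p :=
  div_pos (by linarith) (by linarith)

theorem one_lt_conj {p : ℝ} (hp : 1 < p) : 1 < conj p := by
  rw [conj, lt_div_iff₀ (by linarith)]; linarith

theorem one_div_conj {p : ℝ} (hp : 1 < p) : 1 / conj p = 1 - 1 / p := by
  have : p ≠ 0 := by linarith
  have : p - 1 ≠ 0 := by linarith
  rw [conj]; field_simp

/-- The function `(p - 1) x ^ p - p x ^ (p - 1) - 1`, factored. -/
theorem sharpPoly_eq {p x : ℝ} (hx : 0 < x) :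
    (p - 1) * x ^ p - p * x ^ (p - 1) - 1 = x ^ (p - 1) * ((p - 1) * x - p) - 1 := by
  have : x ^ p = x ^ (p - 1) * x := by
    conv_rhs => rw [← Real.rpow_one x, ← Real.rpow_mul hx.le, ← Real.rpow_add hx]
    simp
  rw [this]; ring

/-- In the factored form a nonnegative value forces the linear factor `(p - 1) x - p` to be
positive. Hence every positive root lies in the region where monotonicity holds. -/
theorem lt_of_sharpPoly_nonneg {p x : ℝ} (hp : 1 < p) (hx : 0 < x)
    (h : 0 ≤ (p - 1) * x ^ p - p * x ^ (p - 1) - 1) : p / (p - 1) < x := by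
  rw [sharpPoly_eq hx] at h
  by_contra! hle
  rw [le_div_iff₀ (by linarith)] at hle
  have := mul_nonneg (Real.rpow_nonneg hx.le (p - 1)) (by linarith : 0 ≤ p - (p - 1) * x)
  nlinarith

/-- Past `p / (p - 1)` both factors of the factored form are positive and strictly increasing. -/
theorem sharpPoly_lt {p x y : ℝ} (hp : 1 < p) (hx : p / (p - 1) < x) (hxy : x < y) :
    (p - 1) * x ^ p - p * x ^ (p - 1) - 1 < (p - 1) * y ^ p - p * y ^ (p - 1) - 1 := by
  have hp' : 0 < p / (p - 1) := div_pos (by linarith) (by linarith)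
  have hx0 : 0 < x := hp'.trans hx
  rw [sharpPoly_eq hx0, sharpPoly_eq (hx0.trans hxy)]
  rw [div_lt_iff₀ (by linarith)] at hx
  have h1 : x ^ (p - 1) < y ^ (p - 1) := Real.rpow_lt_rpow hx0.le hxy (by linarith)
  have h2 : (p - 1) * x - p < (p - 1) * y - p := by nlinarith
  have h3 := mul_lt_mul'' h1 h2 (Real.rpow_nonneg hx0.le _) (by linarith)
  linarith

/-- The positive root of `(p - 1) x ^ p - p x ^ (p - 1) - 1` and its location; the polynomial is
negative to the left of the root and positive to the right. -/
theorem exists_sharpConstant {p : ℝ} (hp : 1 < p) :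
    ∃ c : ℝ, (0 < c ∧ (p - 1) * c ^ p - p * c ^ (p - 1) - 1 = 0) ∧
      (∀ x : ℝ, 0 < x → (p - 1) * x ^ p - p * x ^ (p - 1) - 1 = 0 → x = c) ∧
      p / (p - 1) < c ∧ c < 2 * p / (p - 1) ∧
      ∀ x : ℝ, 0 < x → (p - 1) * x ^ p ≤ p * x ^ (p - 1) + 1 → x ≤ c := by
  have hp1 : 0 < p - 1 := by linarith
  have hp' : 0 < p / (p - 1) := div_pos (by linarith) hp1
  have hlt : p / (p - 1) < 2 * p / (p - 1) := by
    apply div_lt_div_of_pos_right _ hp1; linarith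
  have hcont : ContinuousOn (fun x : ℝ => (p - 1) * x ^ p - p * x ^ (p - 1) - 1)
      (Set.Icc (p / (p - 1)) (2 * p / (p - 1))) := by
    intro x hx
    have : x ≠ 0 := (hp'.trans_le hx.1).ne'
    have h1 : ContinuousAt (fun x : ℝ => x ^ p) x := Real.continuousAt_rpow_const _ _ (Or.inl this)
    have h2 : ContinuousAt (fun x : ℝ => x ^ (p - 1)) x :=
      Real.continuousAt_rpow_const _ _ (Or.inl this)
    exact (((h1.const_mul _).sub (h2.const_mul _)).sub continuousAt_const).continuousWithinAt
  -- At `x = 2p / (p - 1)` the linear factor equals `p` and `x ^ (p - 1) ≥ 1`, so the value is at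
  -- least `p - 1`.
  have hright : 0 < (p - 1) * (2 * p / (p - 1)) ^ p - p * (2 * p / (p - 1)) ^ (p - 1) - 1 := by
    rw [sharpPoly_eq (hp'.trans hlt)]
    have h1 : (1 : ℝ) ≤ (2 * p / (p - 1)) ^ (p - 1) :=
      Real.one_le_rpow (by rw [le_div_iff₀ hp1]; linarith) hp1.le
    have h2 : (p - 1) * (2 * p / (p - 1)) - p = p := by field_simp; ring
    rw [h2]; nlinarith
  have hleft : (p - 1) * (p / (p - 1)) ^ p - p * (p / (p - 1)) ^ (p - 1) - 1 < 0 := by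
    rw [sharpPoly_eq hp']
    have h2 : (p - 1) * (p / (p - 1)) - p = 0 := by field_simp; ring
    rw [h2]; norm_num
  obtain ⟨c, hc, hc0⟩ := intermediate_value_Icc hlt.le hcont ⟨hleft.le, hright.le⟩
  have hc0 : (p - 1) * c ^ p - p * c ^ (p - 1) - 1 = 0 := hc0
  have hcpos : 0 < c := hp'.trans_le hc.1
  have hcgt := lt_of_sharpPoly_nonneg hp hcpos hc0.ge
  refine ⟨c, ⟨hcpos, hc0⟩, fun x hx h => ?_, hcgt, ?_, fun x hx h => ?_⟩
  · have hxgt := lt_of_sharpPoly_nonneg hp hx h.ge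
    rcases lt_trichotomy x c with hlt | heq | hgt
    · have := sharpPoly_lt hp hxgt hlt; linarith
    · exact heq
    · have := sharpPoly_lt hp hcgt hgt; linarith
  · refine lt_of_le_of_ne hc.2 fun h => ?_
    rw [← h] at hright; linarith
  · by_contra! hlt
    have := sharpPoly_lt hp hcgt hlt; linarith

/-- With `q = 1 / p' < 1` the claim is `q log q - (q + 1) log (q + 1) > -log 4`. The left side is
strictly decreasing in `q` and equals `-2 log 2` at `q = 1`. -/
theorem one_lt_growthBase {p : ℝ} (hp : 1 < p) : 1 < growthBase p := by
  have hq0 : 0 < 1 / conj p := one_div_pos.2 (conj_pos hp)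
  have hq1 : 1 / conj p < 1 := by
    rw [div_lt_one (conj_pos hp)]; exact one_lt_conj hp
  rw [growthBase]
  generalize 1 / conj p = q at hq0 hq1
  have h1 : 0 < (q + 1) ^ (q + 1) := Real.rpow_pos_of_pos (by linarith) _
  have h2 : 0 < q ^ q := Real.rpow_pos_of_pos hq0 _
  rw [lt_div_iff₀ h1, one_mul, ← Real.log_lt_log_iff h1 (by positivity),
    Real.log_mul (by norm_num) h2.ne', Real.log_rpow (by linarith), Real.log_rpow hq0]
  have hanti : StrictAntiOn (fun x : ℝ => x * Real.log x - (x + 1) * Real.log (x + 1))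
      (Set.Ici q) := by
    refine strictAntiOn_of_deriv_neg (convex_Ici q) ?_ ?_
    · apply Continuous.continuousOn
      have := Real.continuous_mul_log
      exact this.sub (this.comp (continuous_add_const 1))
    · intro x hx
      rw [interior_Ici] at hx
      have hx0 : 0 < x := hq0.trans hx
      have h3 := (Real.hasDerivAt_mul_log hx0.ne').sub
        ((Real.hasDerivAt_mul_log (by linarith : x + 1 ≠ 0)).comp_add_const x 1)
      have h4 : deriv (fun x : ℝ => x * Real.log x - (x + 1) * Real.log (x + 1)) x =
          Real.log x + 1 - (Real.log (x + 1) + 1) := h3.deriv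
      rw [h4]
      have := Real.log_lt_log hx0 (by linarith : x < x + 1)
      linarith
  have h5 := hanti (Set.mem_Ici.2 le_rfl) (Set.mem_Ici.2 hq1.le) hq1
  have h6 : Real.log 4 = 2 * Real.log 2 := by
    rw [show (4 : ℝ) = 2 ^ 2 by norm_num, Real.log_pow]; norm_num
  norm_num at h5
  linarith

/-- **Stirling's formula** for the real Gamma function, in logarithmic form. -/
theorem tendsto_log_Gamma_sub_stirling :
    Tendsto (fun x : ℝ => Real.log (Real.Gamma x) - ((x - 1 / 2) * Real.log x - x)) atTop
      (𝓝 (Real.log (2 * Real.pi) / 2)) := by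
  set D : ℝ → ℝ := fun x => Real.log (Real.Gamma x) - ((x - 1 / 2) * Real.log x - x) with hD
  have hnat : Tendsto (fun n : ℕ => D n) atTop (𝓝 (Real.log (2 * Real.pi) / 2)) := by
    have h := Stirling.tendsto_stirlingSeq_sqrt_pi
    have h2 := (Real.continuousAt_log (Real.sqrt_pos.2 Real.pi_pos).ne').tendsto.comp h
    have h3 : Real.log (2 * Real.pi) / 2 = Real.log (√Real.pi) + Real.log 2 / 2 := by
      rw [Real.log_sqrt Real.pi_pos.le, Real.log_mul (by norm_num) Real.pi_pos.ne']; ring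
    rw [h3]
    refine (h2.add_const (Real.log 2 / 2)).congr' ?_
    filter_upwards [eventually_ge_atTop 1] with n hn
    have hn0 : (0 : ℝ) < n := by exact_mod_cast hn
    have hG : Real.log (n.factorial : ℝ) = Real.log (Real.Gamma n) + Real.log n := by
      rw [← Real.Gamma_nat_eq_factorial, Real.Gamma_add_one hn0.ne',
        Real.log_mul hn0.ne' (Real.Gamma_pos_of_pos hn0).ne', add_comm]
    simp only [Function.comp, Stirling.log_stirlingSeq_formula, hD, hG]
    rw [Real.log_mul (by norm_num) hn0.ne', Real.log_div hn0.ne' (Real.exp_pos 1).ne',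
      Real.log_exp]
    ring
  have hfloor : Tendsto (fun x : ℝ => ⌊x⌋₊) atTop atTop := tendsto_nat_floor_atTop
  have hmain := hnat.comp hfloor
  have hzero : Tendsto (fun x : ℝ => 2 / ((⌊x⌋₊ : ℝ) - 1)) atTop (𝓝 0) := by
    have : Tendsto (fun n : ℕ => 2 / ((n : ℝ) - 1)) atTop (𝓝 0) :=
      tendsto_const_nhds.div_atTop
        (tendsto_atTop_add_const_right _ _ tendsto_natCast_atTop_atTop)
    exact this.comp hfloor
  -- Stirling's formula for factorials settles the integers. For `x = n + t` with `0 ≤ t < 1`,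
  -- log-convexity of the Gamma function confines `log Γ(n + t) - log Γ(n)` between `t log (n - 1)`
  -- and `t log n`, and elementary bounds on the logarithm leave an error of at most `2 / (n - 1)`.
  have hdiff : Tendsto (fun x : ℝ => D x - D ⌊x⌋₊) atTop (𝓝 0) := by
    refine squeeze_zero_norm' ?_ hzero
    filter_upwards [eventually_ge_atTop 2] with x hx
    have hx0 : 0 ≤ x := by linarith
    have hn2 : 2 ≤ ⌊x⌋₊ := Nat.le_floor (by exact_mod_cast hx)
    have hlow := Nat.floor_le hx0
    have hup := Nat.lt_floor_add_one x
    generalize ⌊x⌋₊ = n at hn2 hlow hup ⊢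
    have hn2' : (2 : ℝ) ≤ n := by exact_mod_cast hn2
    obtain ⟨t, rfl⟩ : ∃ t : ℝ, x = n + t := ⟨x - n, by ring⟩
    have ht0 : 0 ≤ t := by linarith
    have ht1 : t < 1 := by linarith
    have hfeq : ∀ {y : ℝ}, 0 < y →
        (Real.log ∘ Real.Gamma) (y + 1) = (Real.log ∘ Real.Gamma) y + Real.log y := by
      intro y hy
      simp only [Function.comp, Real.Gamma_add_one hy.ne',
        Real.log_mul hy.ne' (Real.Gamma_pos_of_pos hy).ne', add_comm]
    have hG : Real.log (Real.Gamma n) + t * Real.log (n - 1) ≤ Real.log (Real.Gamma (n + t)) ∧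
        Real.log (Real.Gamma (n + t)) ≤ Real.log (Real.Gamma n) + t * Real.log n := by
      rcases ht0.eq_or_lt with rfl | ht
      · simp
      · exact ⟨Real.BohrMollerup.f_add_nat_ge Real.convexOn_log_Gamma hfeq hn2 ht,
          Real.BohrMollerup.f_add_nat_le Real.convexOn_log_Gamma hfeq (by omega) ht ht1.le⟩
    have hn0 : (0 : ℝ) < n := by linarith
    have hnt : (0 : ℝ) < n + t := by linarith
    have hlog1 : Real.log (n + t) - Real.log n ≤ t / n := by
      rw [← Real.log_div hnt.ne' hn0.ne']
      have := Real.log_le_sub_one_of_pos (div_pos hnt hn0)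
      have h : (n + t) / n - 1 = t / n := by field_simp; ring
      linarith
    have hlog2 : t / (n + t) ≤ Real.log (n + t) - Real.log n := by
      have h0 := Real.log_le_sub_one_of_pos (div_pos hn0 hnt)
      rw [Real.log_div hn0.ne' hnt.ne'] at h0
      have h : (n : ℝ) / (n + t) - 1 = -(t / (n + t)) := by field_simp; ring
      linarith
    have hlog3 : Real.log n - Real.log (n - 1) ≤ 1 / (n - 1) := by
      have hn1 : (0 : ℝ) < n - 1 := by linarith
      have h0 := Real.log_le_sub_one_of_pos (div_pos hn0 hn1)
      rw [Real.log_div hn0.ne' hn1.ne'] at h0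
      have h : (n : ℝ) / (n - 1) - 1 = 1 / (n - 1) := by field_simp; ring
      linarith
    have hlog4 : 0 ≤ Real.log n - Real.log (n - 1) :=
      sub_nonneg.2 (Real.log_le_log (by linarith) (by linarith))
    have hS : D (n + t) - D n = (Real.log (Real.Gamma (n + t)) - Real.log (Real.Gamma n) -
        t * Real.log n) - ((n + t - 1 / 2) * (Real.log (n + t) - Real.log n) - t) := by
      simp only [hD]; ring
    have hinv : 1 / (n : ℝ) ≤ 1 / (n - 1) :=
      one_div_le_one_div_of_le (by linarith) (by linarith)
    have hA : (n + t - 1 / 2) * (Real.log (n + t) - Real.log n) - t ≤ 1 / n := by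
      have h1 : (n + t - 1 / 2) * (Real.log (n + t) - Real.log n) ≤ (n + t - 1 / 2) * (t / n) :=
        mul_le_mul_of_nonneg_left hlog1 (by linarith)
      have h2 : (n + t - 1 / 2) * (t / n) - t = t * (t - 1 / 2) * (1 / n) := by field_simp; ring
      have h3 : t * (t - 1 / 2) * (1 / n) ≤ 1 * (1 / n) := by
        apply mul_le_mul_of_nonneg_right _ (by positivity); nlinarith
      linarith
    have hB : -(1 / n) ≤ (n + t - 1 / 2) * (Real.log (n + t) - Real.log n) - t := by
      have h1 : (n + t - 1 / 2) * (t / (n + t)) ≤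
          (n + t - 1 / 2) * (Real.log (n + t) - Real.log n) :=
        mul_le_mul_of_nonneg_left hlog2 (by linarith)
      have h2 : (n + t - 1 / 2) * (t / (n + t)) - t = -(t / 2 * (1 / (n + t))) := by
        field_simp; ring
      have h3 : t / 2 * (1 / (n + t)) ≤ 1 * (1 / n) := by
        apply mul_le_mul (by linarith) (one_div_le_one_div_of_le hn0 (by linarith))
          (by positivity) (by norm_num)
      linarith
    have hC : t * (Real.log n - Real.log (n - 1)) ≤ 1 / (n - 1) := by nlinarith
    have hsum : 2 / ((n : ℝ) - 1) = 1 / (n - 1) + 1 / (n - 1) := by ring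
    rw [hS, Real.norm_eq_abs, abs_le, hsum]
    constructor <;> nlinarith [hG.1, hG.2]
  simpa using hdiff.add hmain

/-! ### The explicit bound `E_n`: Gamma quotient, asymptotics, and integral form. -/

theorem sphereArea_eq (k : ℕ) :
    sphereArea k = 2 * Real.pi ^ (((k : ℝ) + 1) / 2) / Real.Gamma (((k : ℝ) + 1) / 2) := by
  have hk : (0 : ℝ) < ((k : ℝ) + 1) / 2 := by positivity
  have hG := Real.Gamma_pos_of_pos hk
  rw [sphereArea, Measure.toSphere_real_apply_univ, finrank_euclideanSpace_fin, measureReal_def,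
    EuclideanSpace.volume_ball, Fintype.card_fin]
  push_cast
  rw [Real.Gamma_add_one hk.ne']
  have : √Real.pi ^ (k + 1) = Real.pi ^ (((k : ℝ) + 1) / 2) := by
    rw [Real.sqrt_eq_rpow, ← Real.rpow_natCast, ← Real.rpow_mul Real.pi_pos.le]
    congr 1; push_cast; ring
  rw [this, ENNReal.ofReal_one, one_pow, one_mul, ENNReal.toReal_ofReal (by positivity)]
  field_simp

theorem sphereArea_div {n : ℕ} (hn : 2 ≤ n) :
    sphereArea (n - 2) / sphereArea (n - 1) =
      Real.Gamma ((n : ℝ) / 2) / (√Real.pi * Real.Gamma (((n : ℝ) - 1) / 2)) := by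
  obtain ⟨m, rfl⟩ := Nat.exists_eq_add_of_le' hn
  have h1 : 0 < Real.Gamma (((m : ℝ) + 1) / 2) := Real.Gamma_pos_of_pos (by positivity)
  have h2 : 0 < Real.Gamma (((m : ℝ) + 2) / 2) := Real.Gamma_pos_of_pos (by positivity)
  have h3 : Real.pi ^ (((m : ℝ) + 2) / 2) = Real.pi ^ (((m : ℝ) + 1) / 2) * √Real.pi := by
    rw [Real.sqrt_eq_rpow, ← Real.rpow_add Real.pi_pos]; congr 1; ring
  have h4 : 0 < Real.pi ^ (((m : ℝ) + 1) / 2) := Real.rpow_pos_of_pos Real.pi_pos _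
  rw [show m + 2 - 2 = m by omega, show m + 2 - 1 = m + 1 by omega, sphereArea_eq, sphereArea_eq]
  push_cast
  rw [show (m : ℝ) + 1 + 1 = m + 2 by ring, show (m : ℝ) + 2 - 1 = m + 1 by ring, h3]
  field_simp

/-- The factor `Γ((n - 1) / 2)` of the sphere ratio cancels one in the Beta function. Both the
Stirling asymptotics and the half-ball average are compared with this form. -/
theorem betaBound_eq_Gamma {p : ℝ} (hp : 1 < p) {n : ℕ} (hn : 2 ≤ n) :
    betaBound p n = 2 ^ (n - 1) * conj p * (Real.Gamma ((n : ℝ) / 2) *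
      Real.Gamma ((n : ℝ) / (2 * conj p) + 1 / 2) /
        (√Real.pi * Real.Gamma ((n : ℝ) / 2 * (1 / conj p + 1)))) := by
  have hn' : (2 : ℝ) ≤ n := by exact_mod_cast hn
  have h1 : 0 < Real.Gamma (((n : ℝ) - 1) / 2) := Real.Gamma_pos_of_pos (by linarith)
  have hc := conj_pos hp
  rw [betaBound, sphereArea_div hn, ProbabilityTheory.beta]
  have : (n : ℝ) / (2 * conj p) + 1 / 2 + ((n : ℝ) - 1) / 2 = (n : ℝ) / 2 * (1 / conj p + 1) := by
    field_simp; ring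
  rw [this]
  have h2 : 0 < Real.Gamma ((n : ℝ) / 2 * (1 / conj p + 1)) :=
    Real.Gamma_pos_of_pos (by positivity)
  field_simp

/-- Stirling's formula is applied to the three Gamma factors at `m`, `m q + 1 / 2` and `m (q + 1)`,
where `m = n / 2` and `q = 1 / p'`. The logarithm of the quotient then tends to zero, and
exponentiation gives the equivalence. -/
theorem betaBound_isEquivalent {p : ℝ} (hp : 1 < p) :
    betaBound p ~[atTop] fun n : ℕ =>
      conj p * √((1 + 1 / conj p) / 2) * growthBase p ^ ((n : ℝ) / 2) := by
  have hc := conj_pos hp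
  have hq : 0 < 1 / conj p := one_div_pos.2 hc
  have hgb : 0 < growthBase p := by linarith [one_lt_growthBase hp]
  have htpos : ∀ n : ℕ, 0 < conj p * √((1 + 1 / conj p) / 2) * growthBase p ^ ((n : ℝ) / 2) := by
    intro n; positivity
  rw [isEquivalent_iff_tendsto_one (Eventually.of_forall fun n => (htpos n).ne')]
  have hlog : Tendsto (fun n : ℕ => Real.log (betaBound p n) -
      Real.log (conj p * √((1 + 1 / conj p) / 2) * growthBase p ^ ((n : ℝ) / 2))) atTop (𝓝 0) := by
    have hSt := tendsto_log_Gamma_sub_stirling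
    have ht1 : Tendsto (fun n : ℕ => (n : ℝ) / 2) atTop atTop :=
      tendsto_natCast_atTop_atTop.atTop_div_const (by norm_num)
    have ht2 : Tendsto (fun n : ℕ => (n : ℝ) / 2 * (1 / conj p)) atTop atTop :=
      ht1.atTop_mul_const hq
    have ht3 : Tendsto (fun n : ℕ => (n : ℝ) / 2 * (1 / conj p) + 1 / 2) atTop atTop :=
      tendsto_atTop_add_const_right _ _ ht2
    have ht4 : Tendsto (fun n : ℕ => (n : ℝ) / 2 * (1 / conj p + 1)) atTop atTop :=
      ht1.atTop_mul_const (by linarith)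
    -- The shift by `1 / 2` in the second Gamma argument contributes `m q log (1 + 1 / (2 m q)) → 1
    -- / 2`, which offsets the extra `-1 / 2` from the linear term of Stirling's formula.
    have hm := (Real.tendsto_mul_log_one_add_div_atTop (1 / 2)).comp ht2
    have hsum := (((hSt.comp ht1).add (hSt.comp ht3)).sub (hSt.comp ht4)).add hm
    have hsum' := hsum.sub_const (Real.log (2 * Real.pi) / 2 + 1 / 2)
    have hz : Real.log (2 * Real.pi) / 2 + Real.log (2 * Real.pi) / 2 - Real.log (2 * Real.pi) / 2
      + 1 / 2 - (Real.log (2 * Real.pi) / 2 + 1 / 2) = 0 := by ring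
    rw [hz] at hsum'
    refine hsum'.congr' ?_
    filter_upwards [eventually_ge_atTop 2] with n hn
    have hn0 : (0 : ℝ) < n := by exact_mod_cast (by omega : 0 < n)
    have hm0 : (0 : ℝ) < n / 2 := by positivity
    rw [betaBound_eq_Gamma hp hn]
    have h2 : (2 : ℝ) ^ (n - 1) = (2 : ℝ) ^ (2 * ((n : ℝ) / 2) - 1) := by
      rw [← Real.rpow_natCast]; congr 1
      rw [Nat.cast_sub (by omega)]; push_cast; ring
    have h3 : (n : ℝ) / (2 * conj p) = n / 2 * (1 / conj p) := by field_simp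
    rw [h2, h3]
    have hlp := Real.log_sqrt Real.pi_pos.le
    have hlg : Real.log (growthBase p) = 2 * Real.log 2 + 1 / conj p * Real.log (1 / conj p) -
        (1 / conj p + 1) * Real.log (1 / conj p + 1) := by
      have h4 : Real.log 4 = 2 * Real.log 2 := by
        rw [show (4 : ℝ) = 2 ^ 2 by norm_num, Real.log_pow]; norm_num
      rw [growthBase, Real.log_div (by positivity) (by positivity),
        Real.log_mul (by norm_num) (by positivity), Real.log_rpow hq, Real.log_rpow (by linarith),
        h4]
    simp only [Function.comp]
    generalize 1 / conj p = q at *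
    generalize (n : ℝ) / 2 = m at *
    have hG1 := Real.Gamma_pos_of_pos hm0
    have hG2 : 0 < Real.Gamma (m * q + 1 / 2) := Real.Gamma_pos_of_pos (by positivity)
    have hG3 : 0 < Real.Gamma (m * (q + 1)) := Real.Gamma_pos_of_pos (by positivity)
    have hA : Real.log (m * q + 1 / 2) = Real.log m + Real.log q +
        Real.log (1 + 1 / 2 / (m * q)) := by
      rw [← Real.log_mul hm0.ne' hq.ne', ← Real.log_mul (by positivity) (by positivity)]
      congr 1; field_simp
    have hB : Real.log (m * (q + 1)) = Real.log m + Real.log (q + 1) :=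
      Real.log_mul hm0.ne' (by positivity)
    have hC : Real.log ((1 + q) / 2) = Real.log (q + 1) - Real.log 2 := by
      rw [Real.log_div (by positivity) (by norm_num), add_comm]
    have hR1 : Real.log (2 ^ (2 * m - 1) * conj p * (Real.Gamma m * Real.Gamma (m * q + 1 / 2) /
        (√Real.pi * Real.Gamma (m * (q + 1))))) = (2 * m - 1) * Real.log 2 + Real.log (conj p) +
        (Real.log (Real.Gamma m) + Real.log (Real.Gamma (m * q + 1 / 2)) -
          (Real.log Real.pi / 2 + Real.log (Real.Gamma (m * (q + 1))))) := by
      rw [Real.log_mul (by positivity) (by positivity), Real.log_mul (by positivity) hc.ne',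
        Real.log_div (by positivity) (by positivity), Real.log_mul hG1.ne' hG2.ne',
        Real.log_mul (by positivity) hG3.ne', Real.log_rpow (by norm_num), hlp]
    have hR2 : Real.log (conj p * √((1 + q) / 2) * growthBase p ^ m) = Real.log (conj p) +
        Real.log ((1 + q) / 2) / 2 + m * Real.log (growthBase p) := by
      rw [Real.log_mul (by positivity) (by positivity), Real.log_mul hc.ne' (by positivity),
        Real.log_rpow hgb, Real.log_sqrt (by positivity)]
    rw [hR1, hR2, hlg, hA, hB, hC, Real.log_mul (by norm_num) Real.pi_pos.ne']
    ring
  have hexp := (Real.continuous_exp.tendsto 0).comp hlog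
  rw [Real.exp_zero] at hexp
  refine hexp.congr' ?_
  filter_upwards [eventually_ge_atTop 2] with n hn
  have hn0 : (0 : ℝ) < n := by exact_mod_cast (by omega : 0 < n)
  have hbpos : 0 < betaBound p n := by
    rw [betaBound_eq_Gamma hp hn]
    have hG1 : 0 < Real.Gamma ((n : ℝ) / 2) := Real.Gamma_pos_of_pos (by positivity)
    have hG2 : 0 < Real.Gamma ((n : ℝ) / (2 * conj p) + 1 / 2) :=
      Real.Gamma_pos_of_pos (by positivity)
    have hG3 : 0 < Real.Gamma ((n : ℝ) / 2 * (1 / conj p + 1)) :=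
      Real.Gamma_pos_of_pos (by positivity)
    positivity
  simp only [Function.comp, Pi.div_apply]
  rw [Real.exp_sub, Real.exp_log hbpos, Real.exp_log (htpos n)]

/-- The Beta function as an integral of real powers. -/
theorem beta_eq_integral {a b : ℝ} (ha : 0 < a) (hb : 0 < b) :
    ProbabilityTheory.beta a b = ∫ x in (0 : ℝ)..1, x ^ (a - 1) * (1 - x) ^ (b - 1) := by
  rw [ProbabilityTheory.beta_eq_betaIntegralReal a b ha hb, Complex.betaIntegral]
  have : ∀ x ∈ Set.uIcc (0 : ℝ) 1, ((x : ℂ) ^ ((a : ℂ) - 1) * (1 - (x : ℂ)) ^ ((b : ℂ) - 1)) =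
      ((x ^ (a - 1) * (1 - x) ^ (b - 1) : ℝ) : ℂ) := by
    intro x hx
    rw [Set.uIcc_of_le zero_le_one] at hx
    rw [Complex.ofReal_mul, Complex.ofReal_cpow hx.1, Complex.ofReal_cpow (by linarith [hx.2])]
    push_cast; rfl
  rw [intervalIntegral.integral_congr this, intervalIntegral.integral_ofReal, Complex.ofReal_re]

/-- This is the substitution `x = s ^ 2`. The integrands are extended by zero because the change of
variables is performed on the half-line. -/
theorem beta_eq_two_mul_integral {a b : ℝ} (ha : 0 < a) (hb : 0 < b) :
    ProbabilityTheory.beta a b =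
      2 * ∫ s in (0 : ℝ)..1, s ^ (2 * a - 1) * (1 - s ^ 2) ^ (b - 1) := by
  rw [beta_eq_integral ha hb]
  have key := integral_comp_rpow_Ioi
    (fun x : ℝ => (Set.Ioc (0 : ℝ) 1).indicator (fun x => x ^ (a - 1) * (1 - x) ^ (b - 1)) x)
    (two_ne_zero : (2 : ℝ) ≠ 0)
  have hsub : Set.Ioc (0 : ℝ) 1 ⊆ Set.Ioi 0 := fun x hx => hx.1
  rw [setIntegral_indicator measurableSet_Ioc, Set.inter_eq_right.2 hsub,
    ← intervalIntegral.integral_of_le zero_le_one] at key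
  rw [← key, ← intervalIntegral.integral_const_mul, intervalIntegral.integral_of_le zero_le_one]
  conv_rhs => rw [← Set.inter_eq_right.2 hsub, ← setIntegral_indicator measurableSet_Ioc]
  refine setIntegral_congr_fun measurableSet_Ioi fun x hx => ?_
  have hx : 0 < x := hx
  have hx2 : x ^ (2 : ℝ) = x ^ 2 := by norm_cast
  by_cases h1 : x ≤ 1
  · have hm : x ^ (2 : ℝ) ∈ Set.Ioc (0 : ℝ) 1 := by
      rw [hx2]; exact ⟨by positivity, pow_le_one₀ hx.le h1⟩
    have hm' : x ∈ Set.Ioc (0 : ℝ) 1 := ⟨hx, h1⟩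
    have h3 : x ^ (2 * a - 1) = x * (x ^ 2) ^ (a - 1) := by
      rw [← hx2, ← Real.rpow_mul hx.le]
      nth_rewrite 2 [← Real.rpow_one x]
      rw [← Real.rpow_add hx]; congr 1; ring
    have h4 : x ^ ((2 : ℝ) - 1) = x := by norm_num
    simp only [Set.indicator_of_mem hm, Set.indicator_of_mem hm', smul_eq_mul]
    rw [hx2, h3, h4, abs_of_pos (by norm_num : (0 : ℝ) < 2)]; ring
  · have hm : x ^ (2 : ℝ) ∉ Set.Ioc (0 : ℝ) 1 := by
      rw [hx2]; intro h; have := h.2; nlinarith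
    have hm' : x ∉ Set.Ioc (0 : ℝ) 1 := fun h => h1 h.2
    simp only [Set.indicator_of_notMem hm, Set.indicator_of_notMem hm', smul_zero]

theorem betaBound_eq_integral {p : ℝ} (hp : 1 < p) {n : ℕ} (hn : 2 ≤ n) :
    betaBound p n = 2 ^ n * conj p * (sphereArea (n - 2) / sphereArea (n - 1)) *
      ∫ s in (0 : ℝ)..1, s ^ ((n : ℝ) / conj p) * (1 - s ^ 2) ^ (((n : ℝ) - 3) / 2) := by
  have hn' : (2 : ℝ) ≤ n := by exact_mod_cast hn
  have hc := conj_pos hp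
  rw [betaBound, beta_eq_two_mul_integral (by positivity) (by linarith)]
  have h1 : 2 * ((n : ℝ) / (2 * conj p) + 1 / 2) - 1 = n / conj p := by field_simp; ring
  have h2 : ((n : ℝ) - 1) / 2 - 1 = (n - 3) / 2 := by ring
  have h3 : (2 : ℝ) ^ n = 2 ^ (n - 1) * 2 := by rw [← pow_succ]; congr 1; omega
  rw [h1, h2, h3]; ring

end RealAnalysis

/-! ### From covering inequalities to `Lᵖ` bounds for maximal functions over families of sets. -/

section MaximalInequality

variable {α : Type*} [MeasurableSpace α] {μ : Measure α}

/-- The layer cake formula for extended values; it is used both for `μ` and for the measure with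
density `f`. -/
theorem lintegral_rpow_eq_lintegral_meas {h : α → ℝ≥0∞} (hm : Measurable h)
    (hfin : ∀ᵐ x ∂μ, h x ≠ ∞) {r : ℝ} (hr : 0 < r) :
    ∫⁻ x, h x ^ r ∂μ = ENNReal.ofReal r * ∫⁻ t in Set.Ioi (0 : ℝ),
      μ {x | ENNReal.ofReal t < h x} * ENNReal.ofReal (t ^ (r - 1)) := by
  have key := lintegral_rpow_eq_lintegral_meas_lt_mul μ (f := fun x => (h x).toReal)
    (Eventually.of_forall fun x => ENNReal.toReal_nonneg) hm.ennreal_toReal.aemeasurable hr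
  have h1 : ∫⁻ x, h x ^ r ∂μ = ∫⁻ x, ENNReal.ofReal ((h x).toReal ^ r) ∂μ := by
    refine lintegral_congr_ae ?_
    filter_upwards [hfin] with x hx
    rw [← ENNReal.ofReal_rpow_of_nonneg ENNReal.toReal_nonneg hr.le, ENNReal.ofReal_toReal hx]
  rw [h1, key]
  congr 1
  refine setLIntegral_congr_fun measurableSet_Ioi fun t ht => ?_
  have ht : 0 < t := ht
  congr 1
  refine measure_congr ?_
  filter_upwards [hfin] with x hx
  exact propext (ENNReal.ofReal_lt_iff_lt_toReal ht.le hx).symm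

theorem measurable_meas_lt (μ : Measure α) (h : α → ℝ≥0∞) :
    Measurable fun t : ℝ => μ {x | ENNReal.ofReal t < h x} := by
  refine Antitone.measurable fun s t hst => measure_mono fun x hx => ?_
  exact (ENNReal.ofReal_le_ofReal hst).trans_lt hx

/-- Multiply the weak type inequality by `t ^ (p - 2)` and integrate. On the left the layer cake
formula for `μ` with exponent `p` applies. On the right, integrals of `f` over level sets are
measures of those sets for `ν = f μ`, so the formula for `ν` with exponent `p - 1` applies. The
normalizing factors `p` and `p - 1` of the two formulas are the constants in the conclusion. -/
theorem lintegral_rpow_le_of_weak_type {p : ℝ} (hp : 1 < p) {K K' : ℝ≥0∞} (hK : K ≠ ∞)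
    (hK' : K' ≠ ∞) {f h : α → ℝ≥0∞} (hf : Measurable f) (hh : Measurable h)
    (hfF : ∫⁻ x, f x ^ p ∂μ ≠ ∞) (hhF : ∫⁻ x, h x ^ p ∂μ ≠ ∞)
    (hweak : ∀ t : ℝ, 0 < t →
      ENNReal.ofReal t * μ {x | ENNReal.ofReal t < h x} +
          K' * (ENNReal.ofReal t * μ {x | ENNReal.ofReal t < f x}) ≤
        K * ∫⁻ x in {x | ENNReal.ofReal t < h x}, f x ∂μ +
          K' * ∫⁻ x in {x | ENNReal.ofReal t < f x}, f x ∂μ) :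
    ENNReal.ofReal (p - 1) * (∫⁻ x, h x ^ p ∂μ + K' * ∫⁻ x, f x ^ p ∂μ) ≤
      ENNReal.ofReal p *
        (K * ∫⁻ x, f x * h x ^ (p - 1) ∂μ + K' * ∫⁻ x, f x ^ p ∂μ) := by
  have hp0 : 0 < p := by linarith
  have hp1 : 0 < p - 1 := by linarith
  have fin : ∀ {g : α → ℝ≥0∞}, Measurable g → ∫⁻ x, g x ^ p ∂μ ≠ ∞ → ∀ᵐ x ∂μ, g x ≠ ∞ := by
    intro g hg hgF
    filter_upwards [ae_lt_top (hg.pow_const p) hgF] with x hx h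
    rw [h, ENNReal.top_rpow_of_pos hp0] at hx
    exact lt_irrefl _ hx
  set ν := μ.withDensity f with hν
  have hac : ν ≪ μ := withDensity_absolutelyContinuous μ f
  have hA := lintegral_rpow_eq_lintegral_meas hh (fin hh hhF) hp0
  have hF := lintegral_rpow_eq_lintegral_meas hf (fin hf hfF) hp0
  have hC := lintegral_rpow_eq_lintegral_meas hh (hac.ae_le (fin hh hhF)) hp1
  have hD := lintegral_rpow_eq_lintegral_meas hf (hac.ae_le (fin hf hfF)) hp1
  have hC' : ∫⁻ x, h x ^ (p - 1) ∂ν = ∫⁻ x, f x * h x ^ (p - 1) ∂μ := by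
    rw [hν, lintegral_withDensity_eq_lintegral_mul _ hf (hh.pow_const _)]; rfl
  have hD' : ∫⁻ x, f x ^ (p - 1) ∂ν = ∫⁻ x, f x ^ p ∂μ := by
    rw [hν, lintegral_withDensity_eq_lintegral_mul _ hf (hf.pow_const _)]
    refine lintegral_congr_ae ?_
    filter_upwards [fin hf hfF] with x hx
    rw [Pi.mul_apply]
    by_cases h0 : f x = 0
    · rw [h0, ENNReal.zero_rpow_of_pos hp1, ENNReal.zero_rpow_of_pos hp0, mul_zero]
    · conv_lhs => rw [← ENNReal.rpow_one (f x), ← ENNReal.rpow_mul, one_mul,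
        ← ENNReal.rpow_add _ _ h0 hx]
      congr 1; ring
  have hνs : ∀ s : Set α, MeasurableSet s → ν s = ∫⁻ x in s, f x ∂μ := fun s hs =>
    withDensity_apply f hs
  have mw : ∀ r : ℝ, Measurable fun t : ℝ => ENNReal.ofReal (t ^ r) := fun r =>
    (measurable_id.pow_const r).ennreal_ofReal
  have hint : ∫⁻ t in Set.Ioi (0 : ℝ),
      (μ {x | ENNReal.ofReal t < h x} * ENNReal.ofReal (t ^ (p - 1))
        + K' * (μ {x | ENNReal.ofReal t < f x} * ENNReal.ofReal (t ^ (p - 1)))) ≤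
      ∫⁻ t in Set.Ioi (0 : ℝ), (K * (ν {x | ENNReal.ofReal t < h x} *
          ENNReal.ofReal (t ^ (p - 1 - 1))) +
        K' * (ν {x | ENNReal.ofReal t < f x} * ENNReal.ofReal (t ^ (p - 1 - 1)))) := by
    refine setLIntegral_mono' measurableSet_Ioi fun t ht => ?_
    have ht : 0 < t := ht
    have h1 : ENNReal.ofReal (t ^ (p - 1)) =
        ENNReal.ofReal t * ENNReal.ofReal (t ^ (p - 1 - 1)) := by
      rw [← ENNReal.ofReal_mul ht.le]
      congr 1
      conv_rhs => rw [← Real.rpow_one t, ← Real.rpow_mul ht.le, one_mul, ← Real.rpow_add ht]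
      congr 1; ring
    rw [hνs _ (measurableSet_lt measurable_const hh), hνs _ (measurableSet_lt measurable_const hf),
      h1]
    have := mul_le_mul_left (hweak t ht) (ENNReal.ofReal (t ^ (p - 1 - 1)))
    convert this using 1 <;> ring
  have m1 : Measurable fun t : ℝ => μ {x | ENNReal.ofReal t < h x} * ENNReal.ofReal (t ^ (p - 1)) :=
    (measurable_meas_lt μ h).mul (mw _)
  have m2 : Measurable fun t : ℝ =>
      K * (ν {x | ENNReal.ofReal t < h x} * ENNReal.ofReal (t ^ (p - 1 - 1))) :=
    ((measurable_meas_lt ν h).mul (mw _)).const_mul _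
  rw [lintegral_add_left m1, lintegral_add_left m2,
    lintegral_const_mul' _ _ hK', lintegral_const_mul' _ _ hK', lintegral_const_mul' _ _ hK] at hint
  rw [← hC', hC, hA]
  nth_rewrite 2 [← hD']
  rw [hF, hD]
  have := mul_le_mul_right hint (ENNReal.ofReal (p - 1) * ENNReal.ofReal p)
  convert this using 1 <;> ring

theorem lintegral_mul_rpow_le {p : ℝ} (hp : 1 < p) {f h : α → ℝ≥0∞} (hf : Measurable f)
    (hh : Measurable h) :
    ∫⁻ x, f x * h x ^ (p - 1) ∂μ ≤
      (∫⁻ x, f x ^ p ∂μ) ^ (1 / p) * (∫⁻ x, h x ^ p ∂μ) ^ (1 - 1 / p) := by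
  have hp0 : p ≠ 0 := by linarith
  have hp1 : p - 1 ≠ 0 := by linarith
  have hc : p.HolderConjugate (p / (p - 1)) := Real.HolderConjugate.conjExponent hp
  have := ENNReal.lintegral_mul_le_Lp_mul_Lq μ hc hf.aemeasurable
    (hh.pow_const (p - 1)).aemeasurable
  refine this.trans (le_of_eq ?_)
  congr 1
  have h1 : ∀ x, (h x ^ (p - 1)) ^ (p / (p - 1)) = h x ^ p := fun x => by
    rw [← ENNReal.rpow_mul]; congr 1; field_simp
  simp_rw [h1]
  congr 1; field_simp

/-- The average of `f` over the set `I i`. -/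
def famAvg {ι : Type*} (μ : Measure α) (I : ι → Set α) (f : α → ℝ≥0∞) (i : ι) : ℝ≥0∞ :=
  (μ (I i))⁻¹ * ∫⁻ y in I i, f y ∂μ

/-- The maximal function over a family of sets. -/
def familyMax {ι : Type*} (μ : Measure α) (I : ι → Set α) (S : Set ι) (f : α → ℝ≥0∞) (x : α) :
    ℝ≥0∞ :=
  ⨆ i ∈ S, (I i).indicator (fun _ => famAvg μ I f i) x

variable {ι : Type*} {I : ι → Set α}

theorem measurable_familyMax (hI : ∀ i, MeasurableSet (I i)) {S : Set ι} (hS : S.Countable)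
    (f : α → ℝ≥0∞) : Measurable (familyMax μ I S f) :=
  Measurable.biSup S hS fun i _ => measurable_const.indicator (hI i)

theorem setOf_lt_familyMax (S : Set ι) (f : α → ℝ≥0∞) (t : ℝ≥0∞) :
    {x | t < familyMax μ I S f x} = ⋃ i ∈ {i ∈ S | t < famAvg μ I f i}, I i := by
  ext x
  simp only [familyMax, lt_iSup_iff, Set.mem_ofPred_eq, Set.mem_iUnion, exists_prop]
  refine exists_congr fun i => ?_
  by_cases hx : x ∈ I i
  · simp [hx]
  · simp [hx]

theorem le_famAvg_iff {f : α → ℝ≥0∞} {i : ι} (h0 : μ (I i) ≠ 0) (ht : μ (I i) ≠ ∞) {t : ℝ≥0∞} :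
    t ≤ famAvg μ I f i ↔ t * μ (I i) ≤ ∫⁻ y in I i, f y ∂μ := by
  rw [famAvg, mul_comm _ (∫⁻ y in I i, f y ∂μ), ← div_eq_mul_inv,
    ENNReal.le_div_iff_mul_le (Or.inl h0) (Or.inl ht)]

theorem setLIntegral_ne_top_of_rpow {p : ℝ} (hp : 1 ≤ p) {f : α → ℝ≥0∞}
    (hfF : ∫⁻ x, f x ^ p ∂μ ≠ ∞) {s : Set α} (hs : μ s ≠ ∞) : ∫⁻ y in s, f y ∂μ ≠ ∞ := by
  have h1 : ∀ y, f y ≤ 1 + f y ^ p := fun y => by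
    rcases le_total (f y) 1 with h | h
    · exact h.trans le_self_add
    · calc f y = f y ^ (1 : ℝ) := (ENNReal.rpow_one _).symm
        _ ≤ f y ^ p := ENNReal.rpow_le_rpow_of_exponent_le h hp
        _ ≤ _ := le_add_self
  refine ne_top_of_le_ne_top ?_ (lintegral_mono h1)
  rw [lintegral_add_left measurable_const, setLIntegral_one]
  exact ENNReal.add_ne_top.2 ⟨hs, ne_top_of_le_ne_top hfF (setLIntegral_le_lintegral _ _)⟩

/-- A finite maximum, raised to the power `p`, is at most a finite sum of constants on sets of
finite measure. Finiteness is what later permits cancelling a power of this integral. -/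
theorem lintegral_familyMax_rpow_ne_top {p : ℝ} (hp : 1 < p) {f : α → ℝ≥0∞}
    (hI : ∀ i, MeasurableSet (I i)) (h0 : ∀ i, μ (I i) ≠ 0) (ht : ∀ i, μ (I i) ≠ ∞)
    (hfF : ∫⁻ x, f x ^ p ∂μ ≠ ∞) (S : Finset ι) :
    ∫⁻ x, familyMax μ I S f x ^ p ∂μ ≠ ∞ := by
  have hp0 : 0 < p := by linarith
  have havg : ∀ i, famAvg μ I f i ≠ ∞ := fun i =>
    ENNReal.mul_ne_top (ENNReal.inv_ne_top.2 (h0 i))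
      (setLIntegral_ne_top_of_rpow hp.le hfF (ht i))
  have hb : ∀ x, familyMax μ I S f x ^ p ≤
      ∑ i ∈ S, (I i).indicator (fun _ => famAvg μ I f i ^ p) x := by
    intro x
    rw [← ENNReal.le_rpow_inv_iff hp0]
    refine iSup₂_le fun i hi => ?_
    rw [ENNReal.le_rpow_inv_iff hp0]
    refine le_trans ?_ (Finset.single_le_sum
      (f := fun i => (I i).indicator (fun _ => famAvg μ I f i ^ p) x) (fun _ _ => zero_le) hi)
    by_cases hx : x ∈ I i
    · simp [hx]
    · simp [hx, hp0]
  refine ne_top_of_le_ne_top ?_ (lintegral_mono hb)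
  rw [lintegral_finsetSum _ fun i _ => measurable_const.indicator (hI i)]
  refine ENNReal.sum_ne_top.2 fun i _ => ?_
  rw [lintegral_indicator_const (hI i)]
  exact ENNReal.mul_ne_top (ENNReal.rpow_ne_top_of_nonneg hp0.le (havg i)) (ht i)

/-- A covering inequality for finite subfamilies yields the integrated maximal inequality. -/
theorem lintegral_familyMax_rpow_le_of_covering {p : ℝ} (hp : 1 < p) {K K' : ℝ≥0∞} (hK : K ≠ ∞)
    (hK' : K' ≠ ∞) {f : α → ℝ≥0∞} (hf : Measurable f)
    (hI : ∀ i, MeasurableSet (I i)) (h0 : ∀ i, μ (I i) ≠ 0) (ht : ∀ i, μ (I i) ≠ ∞)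
    (hfF : ∫⁻ x, f x ^ p ∂μ ≠ ∞)
    (hcov : ∀ (T : Finset ι) (t : ℝ≥0∞), t ≠ ∞ →
      (∀ i ∈ T, t * μ (I i) ≤ ∫⁻ y in I i, f y ∂μ) →
      t * μ (⋃ i ∈ T, I i) + K' * (t * μ {x | t < f x}) ≤
        K * ∫⁻ x in ⋃ i ∈ T, I i, f x ∂μ + K' * ∫⁻ x in {x | t < f x}, f x ∂μ)
    (S : Finset ι) :
    ENNReal.ofReal (p - 1) * (∫⁻ x, familyMax μ I S f x ^ p ∂μ + K' * ∫⁻ x, f x ^ p ∂μ) ≤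
      ENNReal.ofReal p * (K * ((∫⁻ x, f x ^ p ∂μ) ^ (1 / p) *
        (∫⁻ x, familyMax μ I S f x ^ p ∂μ) ^ (1 - 1 / p)) + K' * ∫⁻ x, f x ^ p ∂μ) := by
  classical
  have hm := measurable_familyMax (μ := μ) hI S.finite_toSet.countable f
  refine (lintegral_rpow_le_of_weak_type hp hK hK' hf hm hfF
    (lintegral_familyMax_rpow_ne_top hp hI h0 ht hfF S) fun t _ => ?_).trans ?_
  · rw [setOf_lt_familyMax]
    have := hcov {i ∈ S | ENNReal.ofReal t < famAvg μ I f i} (ENNReal.ofReal t)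
      ENNReal.ofReal_ne_top fun i hi =>
        (le_famAvg_iff (h0 i) (ht i)).1 (Finset.mem_filter.1 hi).2.le
    simpa only [Finset.mem_filter, Set.mem_ofPred_eq, Finset.mem_coe] using this
  · gcongr
    exact lintegral_mul_rpow_le hp hf hm

/-- Monotone convergence along the directed set of finite subfamilies; countability of the index set
is needed for it. -/
theorem lintegral_familyMax_univ_rpow_le [Countable ι] {p : ℝ} (hp : 0 < p) {f : α → ℝ≥0∞}
    (hI : ∀ i, MeasurableSet (I i)) {C : ℝ≥0∞}
    (h : ∀ S : Finset ι, ∫⁻ x, familyMax μ I S f x ^ p ∂μ ≤ C) :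
    ∫⁻ x, familyMax μ I Set.univ f x ^ p ∂μ ≤ C := by
  have hmono : ∀ {S T : Set ι}, S ⊆ T → ∀ x, familyMax μ I S f x ≤ familyMax μ I T f x :=
    fun hST x => biSup_mono hST
  have h1 : ∀ x, familyMax μ I Set.univ f x ^ p =
      ⨆ S : Finset ι, familyMax μ I S f x ^ p := by
    intro x
    have h2 : familyMax μ I Set.univ f x = ⨆ S : Finset ι, familyMax μ I S f x := by
      refine le_antisymm (iSup₂_le fun i _ => ?_) (iSup_le fun S => hmono (Set.subset_univ _) x)
      refine le_iSup_of_le {i} ?_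
      simp [familyMax]
    rw [h2]
    exact (ENNReal.orderIsoRpow p hp).map_iSup _
  simp_rw [h1]
  rw [lintegral_iSup_directed]
  · exact iSup_le h
  · exact fun S => ((measurable_familyMax hI S.finite_toSet.countable f).pow_const p).aemeasurable
  · classical
    intro S T
    refine ⟨S ∪ T, fun x => ?_, fun x => ?_⟩
    · exact ENNReal.rpow_le_rpow (hmono (by simp) x) hp.le
    · exact ENNReal.rpow_le_rpow (hmono (by simp) x) hp.le

end MaximalInequality

/-! ### The sharp one-dimensional inequality for uncentered intervals. -/

section Interval

/-- A finite family of open intervals has a subfamily with the same union such that no point lies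
in more than two of its members. -/
theorem exists_subfamily_overlap_le_two {ι : Type*} [DecidableEq ι] (l r : ι → ℝ) (T : Finset ι) :
    ∃ T' ⊆ T, (⋃ i ∈ T', Set.Ioo (l i) (r i)) = ⋃ i ∈ T, Set.Ioo (l i) (r i) ∧
      ∀ x, ({i ∈ T' | x ∈ Set.Ioo (l i) (r i)} : Finset ι).card ≤ 2 := by
  classical
  have hne : ({T' ∈ T.powerset | (⋃ i ∈ T', Set.Ioo (l i) (r i)) =
      ⋃ i ∈ T, Set.Ioo (l i) (r i)} : Finset (Finset ι)).Nonempty :=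
    ⟨T, by simp⟩
  -- A subfamily of least cardinality among those with the same union has no redundant member.
  obtain ⟨T', hT', hmin⟩ := Finset.exists_min_image _ Finset.card hne
  simp only [Finset.mem_filter, Finset.mem_powerset] at hT' hmin
  refine ⟨T', hT'.1, hT'.2, fun x => ?_⟩
  by_contra! hcard
  set X : Finset ι := {i ∈ T' | x ∈ Set.Ioo (l i) (r i)} with hX
  have hXne : X.Nonempty := Finset.card_pos.1 (by omega)
  obtain ⟨i, hi, hil⟩ := Finset.exists_min_image X l hXne
  obtain ⟨j, hj, hjr⟩ := Finset.exists_max_image X r hXne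
  -- If three members contain `x`, take one reaching farthest left and one reaching farthest right.
  -- Their union contains every member through `x`, so a further member `k` is redundant, against
  -- minimality.
  obtain ⟨k, hk, hkij⟩ : ∃ k ∈ X, k ∉ ({i, j} : Finset ι) := by
    refine Finset.exists_mem_notMem_of_card_lt_card (lt_of_le_of_lt ?_ hcard)
    exact Finset.card_le_two
  have hki : i ≠ k := fun h => hkij (by simp [h])
  have hkj : j ≠ k := fun h => hkij (by simp [h])
  have hmem : ∀ {m}, m ∈ X → m ∈ T' ∧ l m < x ∧ x < r m := fun {m} hm => by
    simpa [hX] using hm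
  have herase : (⋃ m ∈ T'.erase k, Set.Ioo (l m) (r m)) = ⋃ m ∈ T', Set.Ioo (l m) (r m) := by
    refine subset_antisymm
      (Set.biUnion_subset_biUnion_left fun m hm => Finset.mem_of_mem_erase hm) ?_
    intro y hy
    simp only [Set.mem_iUnion, exists_prop] at hy ⊢
    obtain ⟨m, hm, hym⟩ := hy
    by_cases hmk : m = k
    · subst hmk
      rcases le_or_gt y x with hyx | hxy
      · exact ⟨i, Finset.mem_erase.2 ⟨hki, (hmem hi).1⟩, (hil m hk).trans_lt hym.1,
          hyx.trans_lt (hmem hi).2.2⟩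
      · exact ⟨j, Finset.mem_erase.2 ⟨hkj, (hmem hj).1⟩, (hmem hj).2.1.trans hxy,
          hym.2.trans_le (hjr m hk)⟩
    · exact ⟨m, Finset.mem_erase.2 ⟨hmk, hm⟩, hym⟩
  have h1 := hmin (T'.erase k) ⟨(Finset.erase_subset _ _).trans hT'.1, herase.trans hT'.2⟩
  have h2 := Finset.card_erase_lt_of_mem (hmem hk).1
  omega

/-- The weak type inequality for finite families of intervals. -/
theorem interval_covering {ι : Type*} (l r : ι → ℝ) {f : ℝ → ℝ≥0∞} (hf : Measurable f)
    (hfin : ∀ i, ∫⁻ y in Set.Ioo (l i) (r i), f y ≠ ∞) (T : Finset ι) (t : ℝ≥0∞)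
    (hT : ∀ i ∈ T, t * volume (Set.Ioo (l i) (r i)) ≤ ∫⁻ y in Set.Ioo (l i) (r i), f y) :
    t * volume (⋃ i ∈ T, Set.Ioo (l i) (r i)) + t * volume {x | t < f x} ≤
      (∫⁻ x in ⋃ i ∈ T, Set.Ioo (l i) (r i), f x) + ∫⁻ x in {x | t < f x}, f x := by
  classical
  obtain ⟨T', hT', hU, hover⟩ := exists_subfamily_overlap_le_two l r T
  rw [← hU]
  set U := ⋃ i ∈ T', Set.Ioo (l i) (r i) with hUdef
  have hUm : MeasurableSet U := Finset.measurableSet_biUnion _ fun _ _ => measurableSet_Ioo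
  have hfm : MeasurableSet {x | t < f x} := measurableSet_lt measurable_const hf
  set g : ℝ → ℝ≥0∞ := fun x => ∑ i ∈ T', (Set.Ioo (l i) (r i)).indicator 1 x with hg
  have hgm : Measurable g :=
    Finset.measurable_sum _ fun i _ => measurable_one.indicator measurableSet_Ioo
  have hgcard : ∀ x, g x = (({i ∈ T' | x ∈ Set.Ioo (l i) (r i)} : Finset ι).card : ℝ≥0∞) := by
    intro x
    rw [Finset.card_filter]
    push_cast
    exact Finset.sum_congr rfl fun i _ => by simp [Set.indicator_apply]
  -- With `g` the overlap count this says `(t - f)(1_U + 1_{f > t} - g) ≤ 0`. Where `f > t` the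
  -- second factor is nonnegative because `g ≤ 2` and `g` vanishes off `U`; where `f ≤ t` it is
  -- nonpositive because `g ≥ 1` on `U`.
  have hpoint : ∀ x, U.indicator (fun _ => t) x + {x | t < f x}.indicator (fun _ => t) x +
      f x * g x ≤ U.indicator f x + {x | t < f x}.indicator f x + t * g x := by
    intro x
    have hUx : x ∈ U ↔ g x ≠ 0 := by
      rw [hgcard, Nat.cast_ne_zero, Finset.card_ne_zero]
      simp only [hUdef, Finset.Nonempty, Set.mem_iUnion, Finset.mem_filter, exists_prop]
    have h2 := hover x
    have h3 := hgcard x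
    generalize ({i ∈ T' | x ∈ Set.Ioo (l i) (r i)} : Finset ι).card = m at h2 h3
    by_cases hft : t < f x
    · have hind : ∀ u : ℝ → ℝ≥0∞, {x | t < f x}.indicator u x = u x := fun u =>
        Set.indicator_of_mem (by exact hft) _
      rw [hind, hind]
      interval_cases m
      · have : x ∉ U := by rw [hUx, h3]; simp
        rw [Set.indicator_of_notMem this, Set.indicator_of_notMem this, h3]
        simpa using hft.le
      · have : x ∈ U := by rw [hUx, h3]; simp
        rw [Set.indicator_of_mem this, Set.indicator_of_mem this, h3]
        simp only [Nat.cast_one, mul_one]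
        calc t + t + f x = t + (f x + t) := by ring
          _ ≤ f x + (f x + t) := by gcongr
          _ = _ := by ring
      · have : x ∈ U := by rw [hUx, h3]; simp
        rw [Set.indicator_of_mem this, Set.indicator_of_mem this, h3]
        apply le_of_eq; push_cast; ring
    · have hind : ∀ u : ℝ → ℝ≥0∞, {x | t < f x}.indicator u x = 0 := fun u =>
        Set.indicator_of_notMem (by exact hft) _
      rw [hind, hind]
      interval_cases m
      · have : x ∉ U := by rw [hUx, h3]; simp
        rw [Set.indicator_of_notMem this, Set.indicator_of_notMem this, h3]
        simp
      · have : x ∈ U := by rw [hUx, h3]; simp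
        rw [Set.indicator_of_mem this, Set.indicator_of_mem this, h3]
        simp [add_comm]
      · have : x ∈ U := by rw [hUx, h3]; simp
        rw [Set.indicator_of_mem this, Set.indicator_of_mem this, h3]
        push_cast
        calc t + 0 + f x * 2 = t + f x + f x := by ring
          _ ≤ t + f x + t := by gcongr; exact not_lt.1 hft
          _ = _ := by ring
  have hint := lintegral_mono (μ := volume) hpoint
  have m1 : Measurable fun x => U.indicator (fun _ => t) x := measurable_const.indicator hUm
  have m2 : Measurable fun x => {x | t < f x}.indicator (fun _ => t) x :=
    measurable_const.indicator hfm
  have m3 : Measurable fun x => U.indicator f x := hf.indicator hUm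
  have m4 : Measurable fun x => {x | t < f x}.indicator f x := hf.indicator hfm
  have m12 : Measurable fun x => U.indicator (fun _ => t) x +
      {x | t < f x}.indicator (fun _ => t) x := m1.add m2
  have m34 : Measurable fun x => U.indicator f x + {x | t < f x}.indicator f x := m3.add m4
  rw [lintegral_add_left m12, lintegral_add_left m1, lintegral_add_left m34,
    lintegral_add_left m3, lintegral_indicator_const hUm, lintegral_indicator_const hfm,
    lintegral_indicator hUm, lintegral_indicator hfm, lintegral_const_mul _ hgm] at hint
  have hg1 : ∫⁻ x, g x = ∑ i ∈ T', volume (Set.Ioo (l i) (r i)) := by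
    rw [hg, lintegral_finsetSum _ fun i _ => measurable_one.indicator measurableSet_Ioo]
    exact Finset.sum_congr rfl fun i _ => lintegral_indicator_one measurableSet_Ioo
  have hg2 : ∫⁻ x, f x * g x = ∑ i ∈ T', ∫⁻ x in Set.Ioo (l i) (r i), f x := by
    simp_rw [hg, Finset.mul_sum]
    have hm : ∀ i ∈ T', Measurable fun x =>
        f x * (Set.Ioo (l i) (r i)).indicator (1 : ℝ → ℝ≥0∞) x :=
      fun i _ => hf.mul (measurable_one.indicator measurableSet_Ioo)
    rw [lintegral_finsetSum _ hm]
    refine Finset.sum_congr rfl fun i _ => ?_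
    rw [← lintegral_indicator measurableSet_Ioo]
    congr 1 with x
    by_cases hx : x ∈ Set.Ioo (l i) (r i)
    · simp [hx]
    · simp only [Set.indicator_of_notMem hx, mul_zero]
  have hle : t * ∫⁻ x, g x ≤ ∫⁻ x, f x * g x := by
    rw [hg1, hg2, Finset.mul_sum]
    exact Finset.sum_le_sum fun i hi => hT i (hT' hi)
  have hne : ∫⁻ x, f x * g x ≠ ∞ := by
    rw [hg2]
    exact ENNReal.sum_ne_top.2 fun i _ => hfin i
  -- The hypothesis on averages gives `t ∫ g ≤ ∫ f g`, and `∫ f g` is finite, so the two overlap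
  -- terms cancel.
  refine (ENNReal.add_le_add_iff_right hne).1 (hint.trans ?_)
  gcongr

/-- Index set for the intervals with rational endpoints. -/
abbrev RatInterval : Type := {q : ℚ × ℚ // q.1 < q.2}

/-- The open interval with given rational endpoints. -/
def RatInterval.toSet (i : RatInterval) : Set ℝ := Set.Ioo (i.1.1 : ℝ) (i.1.2 : ℝ)

theorem RatInterval.measurableSet (i : RatInterval) : MeasurableSet i.toSet := measurableSet_Ioo

theorem RatInterval.volume_eq (i : RatInterval) :
    volume i.toSet = ENNReal.ofReal ((i.1.2 : ℝ) - i.1.1) := Real.volume_Ioo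

theorem RatInterval.volume_ne_zero (i : RatInterval) : volume i.toSet ≠ 0 := by
  have : (i.1.1 : ℝ) < i.1.2 := by exact_mod_cast i.2
  rw [i.volume_eq, ne_eq, ENNReal.ofReal_eq_zero]; linarith

theorem RatInterval.volume_ne_top (i : RatInterval) : volume i.toSet ≠ ∞ := by
  rw [i.volume_eq]; exact ENNReal.ofReal_ne_top

/-- The uncentered maximal function over intervals of the line is bounded on `Lᵖ` with the sharp
constant. -/
theorem lintegral_intervalMax_rpow_le {p c : ℝ} (hp : 1 < p) (hc0 : 0 < c)
    (hc : ∀ x : ℝ, 0 < x → (p - 1) * x ^ p ≤ p * x ^ (p - 1) + 1 → x ≤ c)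
    {f : ℝ → ℝ≥0∞} (hf : Measurable f) :
    ∫⁻ x, familyMax volume RatInterval.toSet Set.univ f x ^ p ≤
      ENNReal.ofReal c ^ p * ∫⁻ x, f x ^ p := by
  have hp0 : 0 < p := by linarith
  by_cases hF : ∫⁻ x, f x ^ p = ∞
  · rw [hF, ENNReal.mul_top]
    · exact le_top
    · rw [ne_eq, ENNReal.rpow_eq_zero_iff_of_pos hp0, ENNReal.ofReal_eq_zero]; linarith
  refine lintegral_familyMax_univ_rpow_le hp0 RatInterval.measurableSet fun S => ?_
  have hmain := lintegral_familyMax_rpow_le_of_covering (μ := volume) (I := RatInterval.toSet) hp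
    ENNReal.one_ne_top ENNReal.one_ne_top hf RatInterval.measurableSet RatInterval.volume_ne_zero
    RatInterval.volume_ne_top hF (fun T t _ hT => by
      rw [one_mul, one_mul, one_mul]
      exact interval_covering (fun i : RatInterval => (i.1.1 : ℝ))
        (fun i => (i.1.2 : ℝ)) hf
        (fun i => setLIntegral_ne_top_of_rpow hp.le hF i.volume_ne_top) T t hT) S
  have hA := lintegral_familyMax_rpow_ne_top hp RatInterval.measurableSet
    RatInterval.volume_ne_zero RatInterval.volume_ne_top hF S
  generalize ∫⁻ x, familyMax volume RatInterval.toSet S f x ^ p = A at hmain hA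
  generalize ∫⁻ x, f x ^ p = F at hmain hF
  lift A to NNReal using hA
  lift F to NNReal using hF
  obtain ⟨a, rfl⟩ : ∃ a : NNReal, A = a ^ p :=
    ⟨A ^ p⁻¹, by rw [NNReal.rpow_inv_rpow hp0.ne']⟩
  obtain ⟨b, rfl⟩ : ∃ b : NNReal, F = b ^ p :=
    ⟨F ^ p⁻¹, by rw [NNReal.rpow_inv_rpow hp0.ne']⟩
  -- In terms of the norms `a = A ^ (1 / p)` and `b = F ^ (1 / p)` the inequality is one between
  -- real numbers. Divided by `b ^ p` it becomes the defining inequality of `c` for `x = a / b`; the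
  -- case `b = 0` forces `a = 0`.
  have hreal : (p - 1) * ((a : ℝ) ^ p + (b : ℝ) ^ p) ≤
      p * ((b : ℝ) * (a : ℝ) ^ (p - 1) + (b : ℝ) ^ p) := by
    have h1 : ((b : ℝ≥0∞) ^ p) ^ (1 / p) = b := by
      rw [← ENNReal.rpow_mul, mul_one_div_cancel hp0.ne', ENNReal.rpow_one]
    have h2 : ((a : ℝ≥0∞) ^ p) ^ (1 - 1 / p) = (a : ℝ≥0∞) ^ (p - 1) := by
      rw [← ENNReal.rpow_mul]; congr 1; field_simp
    simp only [one_mul, ENNReal.coe_rpow_of_nonneg _ hp0.le] at hmain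
    rw [h1, h2, ← ENNReal.coe_rpow_of_nonneg _ hp0.le, ← ENNReal.coe_rpow_of_nonneg _ hp0.le,
      ← ENNReal.coe_rpow_of_nonneg _ (by linarith : 0 ≤ p - 1)] at hmain
    have := ENNReal.toReal_mono (by finiteness) hmain
    rw [ENNReal.toReal_mul, ENNReal.toReal_mul, ENNReal.toReal_add (by finiteness) (by finiteness),
      ENNReal.toReal_add (by finiteness) (by finiteness), ENNReal.toReal_mul,
      ENNReal.toReal_ofReal (by linarith), ENNReal.toReal_ofReal (by linarith)] at this
    simpa using this
  have hab : (a : ℝ) ≤ c * b := by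
    rcases (b.2).eq_or_lt with hb | hb
    · have hb : (b : ℝ) = 0 := hb.symm
      rw [hb, Real.zero_rpow hp0.ne'] at hreal
      rcases (a.2).eq_or_lt with ha | ha
      · have ha : (a : ℝ) = 0 := ha.symm
        rw [ha, hb]; simp
      · have := mul_pos (by linarith : 0 < p - 1) (Real.rpow_pos_of_pos ha p)
        simp only [NNReal.val_eq_coe] at this
        linarith
    · have hb : 0 < (b : ℝ) := hb
      rcases (a.2).eq_or_lt with ha | ha
      · have ha : (a : ℝ) = 0 := ha.symm
        rw [ha]; positivity
      · have ha : 0 < (a : ℝ) := ha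
        have := hc (a / b) (by positivity) ?_
        · rwa [div_le_iff₀ hb] at this
        · rw [Real.div_rpow ha.le hb.le, Real.div_rpow ha.le hb.le]
          have hbp : 0 < (b : ℝ) ^ p := Real.rpow_pos_of_pos hb p
          have hb1 : (b : ℝ) ^ (p - 1) = (b : ℝ) ^ p / b := Real.rpow_sub_one hb.ne' p
          rw [hb1]
          rw [← sub_nonneg]
          have : p * ((a : ℝ) ^ (p - 1) / ((b : ℝ) ^ p / b)) + 1 - (p - 1) * ((a : ℝ) ^ p / b ^ p) =
            (p * ((b : ℝ) * (a : ℝ) ^ (p - 1) + (b : ℝ) ^ p) -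
              (p - 1) * ((a : ℝ) ^ p + (b : ℝ) ^ p)) / b ^ p := by field_simp; ring
          rw [this]
          exact div_nonneg (by linarith) hbp.le
  rw [ENNReal.coe_rpow_of_nonneg _ hp0.le, ENNReal.coe_rpow_of_nonneg _ hp0.le,
    ← ENNReal.mul_rpow_of_nonneg _ _ hp0.le]
  refine ENNReal.rpow_le_rpow ?_ hp0.le
  rw [← ENNReal.ofReal_coe_nnreal, ← ENNReal.ofReal_coe_nnreal, ← ENNReal.ofReal_mul hc0.le]
  exact ENNReal.ofReal_le_ofReal hab

end Interval

/-! ### Boxes by iteration: domination by one-dimensional maximal functions. -/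

section StrongUpper

/-- The open box whose sides are the given rational intervals. -/
def ratBox {n : ℕ} (i : Fin n → RatInterval) : Set (Fin n → ℝ) :=
  Set.univ.pi fun k => (i k).toSet

theorem measurableSet_ratBox {n : ℕ} (i : Fin n → RatInterval) : MeasurableSet (ratBox i) :=
  MeasurableSet.univ_pi fun k => (i k).measurableSet

theorem volume_ratBox {n : ℕ} (i : Fin n → RatInterval) :
    volume (ratBox i) = ∏ k, volume (i k).toSet := volume_pi_pi _

/-- The splitting of the first coordinate. -/
def consEquiv (n : ℕ) : ℝ × (Fin n → ℝ) ≃ᵐ (Fin (n + 1) → ℝ) :=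
  (MeasurableEquiv.piFinSuccAbove (fun _ => ℝ) 0).symm

theorem consEquiv_apply {n : ℕ} (z : ℝ × (Fin n → ℝ)) :
    consEquiv n z = Fin.cons z.1 z.2 := by
  ext k
  refine Fin.cases ?_ (fun j => ?_) k
  · simp [consEquiv, MeasurableEquiv.piFinSuccAbove]
  · simp [consEquiv, MeasurableEquiv.piFinSuccAbove]

theorem measurePreserving_consEquiv (n : ℕ) : MeasurePreserving (consEquiv n) :=
  (volume_preserving_piFinSuccAbove (fun _ : Fin (n + 1) => ℝ) 0).symm

attribute [irreducible] consEquiv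

theorem consEquiv_preimage_ratBox {n : ℕ} (i : Fin (n + 1) → RatInterval) :
    consEquiv n ⁻¹' ratBox i = (i 0).toSet ×ˢ ratBox (fun k => i k.succ) := by
  ext z
  simp [ratBox, consEquiv_apply, Fin.forall_fin_succ, Set.mem_pi]

/-- By Tonelli's theorem an average over a box is the average, in the first variable, of averages in
the remaining ones. -/
theorem famAvg_ratBox_succ {n : ℕ} (i : Fin (n + 1) → RatInterval) {f : (Fin (n + 1) → ℝ) → ℝ≥0∞}
    (hf : Measurable f) :
    famAvg volume ratBox f i = (volume (i 0).toSet)⁻¹ * ∫⁻ y in (i 0).toSet,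
      famAvg volume ratBox (fun y' => f (consEquiv n (y, y'))) fun k => i k.succ := by
  have hmp := measurePreserving_consEquiv n
  have h1 : ∫⁻ y in ratBox i, f y = ∫⁻ y in (i 0).toSet, ∫⁻ y' in ratBox fun k => i k.succ,
      f (consEquiv n (y, y')) := by
    rw [← hmp.setLIntegral_comp_preimage_emb (consEquiv n).measurableEmbedding,
      consEquiv_preimage_ratBox, Measure.volume_eq_prod, setLIntegral_prod]
    exact (hf.comp (consEquiv n).measurable).aemeasurable
  simp only [famAvg]
  rw [h1, volume_ratBox, Fin.prod_univ_succ, ← volume_ratBox, lintegral_const_mul',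
    ENNReal.mul_inv (Or.inl (i 0).volume_ne_zero) (Or.inl (i 0).volume_ne_top), mul_assoc]
  rw [ENNReal.inv_ne_top, volume_ratBox, Finset.prod_ne_zero_iff]
  exact fun k _ => (i k.succ).volume_ne_zero

/-- Inside the iterated average, each average in the last variables is at most the lower-dimensional
maximal function at the given point. The resulting interval average is controlled by the maximal
function in the first variable. -/
theorem familyMax_ratBox_succ_le {n : ℕ} {f : (Fin (n + 1) → ℝ) → ℝ≥0∞} (hf : Measurable f)
    (z : ℝ × (Fin n → ℝ)) :
    familyMax volume ratBox Set.univ f (consEquiv n z) ≤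
      familyMax volume RatInterval.toSet Set.univ
        (fun y => familyMax volume ratBox Set.univ (fun y' => f (consEquiv n (y, y'))) z.2) z.1 := by
  refine iSup₂_le fun i _ => Set.indicator_apply_le' (fun hz => ?_) fun _ => zero_le
  have hz : z ∈ consEquiv n ⁻¹' ratBox i := hz
  rw [consEquiv_preimage_ratBox] at hz
  refine le_trans ?_ (le_iSup₂ (i 0) (Set.mem_univ _))
  rw [Set.indicator_of_mem hz.1, famAvg_ratBox_succ i hf, famAvg]
  gcongr with y
  refine le_trans ?_ (le_iSup₂ (fun k => i k.succ) (Set.mem_univ _))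
  rw [Set.indicator_of_mem hz.2]

theorem measurable_familyMax_ratBox_uncurry {n : ℕ} {f : (Fin (n + 1) → ℝ) → ℝ≥0∞}
    (hf : Measurable f) : Measurable fun z : ℝ × (Fin n → ℝ) =>
      familyMax volume ratBox Set.univ (fun y' => f (consEquiv n (z.1, y'))) z.2 := by
  refine Measurable.biSup _ (Set.to_countable _) fun i _ => ?_
  have h1 : Measurable fun y : ℝ =>
      famAvg volume ratBox (fun y' => f (consEquiv n (y, y'))) i := by
    refine Measurable.const_mul ?_ _
    exact Measurable.lintegral_prod_right' (f := fun z => f (consEquiv n z))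
      (hf.comp (consEquiv n).measurable)
  have h2 : (fun z : ℝ × (Fin n → ℝ) => (ratBox i).indicator
      (fun _ => famAvg volume ratBox (fun y' => f (consEquiv n (z.1, y'))) i) z.2) =
      (Prod.snd ⁻¹' ratBox i).indicator fun z =>
        famAvg volume ratBox (fun y' => f (consEquiv n (z.1, y'))) i := by
    ext z
    by_cases hz : z.2 ∈ ratBox i
    · rw [Set.indicator_of_mem hz, Set.indicator_of_mem (by exact hz)]
    · rw [Set.indicator_of_notMem hz, Set.indicator_of_notMem (by exact hz)]
  rw [h2]
  exact (h1.comp measurable_fst).indicator (measurable_snd (measurableSet_ratBox i))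

/-- The iterated maximal inequality for boxes. -/
theorem lintegral_boxMax_rpow_le {p : ℝ} (hp : 1 < p) {C : ℝ≥0∞}
    (hC : ∀ {g : ℝ → ℝ≥0∞}, Measurable g →
      ∫⁻ x, familyMax volume RatInterval.toSet Set.univ g x ^ p ≤ C * ∫⁻ x, g x ^ p) (n : ℕ)
    {f : (Fin n → ℝ) → ℝ≥0∞} (hf : Measurable f) :
    ∫⁻ x, familyMax volume ratBox Set.univ f x ^ p ≤ C ^ n * ∫⁻ x, f x ^ p := by
  induction n with
  | zero =>
    rw [pow_zero, one_mul]
    refine lintegral_mono fun x => ENNReal.rpow_le_rpow ?_ (by linarith)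
    refine iSup₂_le fun i _ => Set.indicator_apply_le' (fun _ => ?_) fun _ => zero_le
    -- `ℝ⁰` is a single point with Dirac measure, so every average equals the value of `f` there.
    have hv : (volume : Measure (Fin 0 → ℝ)) = Measure.dirac x := Measure.pi_of_empty _ x
    have hb : ratBox i = Set.univ := by ext; simp [ratBox]
    rw [famAvg, hb, hv]
    simp
  | succ n ih =>
    have hmp := measurePreserving_consEquiv n
    have hf' : Measurable fun z => f (consEquiv n z) := hf.comp (consEquiv n).measurable
    obtain ⟨G, hG, hGe⟩ : ∃ G : ℝ × (Fin n → ℝ) → ℝ≥0∞, Measurable G ∧ ∀ y x',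
        familyMax volume ratBox Set.univ (fun y' => f (consEquiv n (y, y'))) x' = G (y, x') :=
      ⟨_, measurable_familyMax_ratBox_uncurry hf, fun _ _ => rfl⟩
    have hle : ∀ x x', familyMax volume ratBox Set.univ f (consEquiv n (x, x')) ≤
        familyMax volume RatInterval.toSet Set.univ (fun y => G (y, x')) x := fun x x' => by
      simpa only [hGe] using familyMax_ratBox_succ_le hf (x, x')
    have hfy : ∀ y, Measurable fun y' => f (consEquiv n (y, y')) := fun y =>
      hf'.comp measurable_prodMk_left
    have hm : Measurable fun z => familyMax volume ratBox Set.univ f (consEquiv n z) ^ p :=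
      ((measurable_familyMax measurableSet_ratBox (Set.to_countable _) f).pow_const p).comp
        (consEquiv n).measurable
    rw [← hmp.lintegral_comp_emb (consEquiv n).measurableEmbedding,
      ← hmp.lintegral_comp_emb (consEquiv n).measurableEmbedding, Measure.volume_eq_prod,
      lintegral_prod_symm' _ hm, lintegral_prod _ (hf'.pow_const p).aemeasurable]
    -- For fixed `x'` the one-dimensional inequality acts in the first variable and costs one factor
    -- `C`. After exchanging the integrals, the induction hypothesis acts in the other variables for
    -- fixed `y`.
    calc ∫⁻ x', ∫⁻ x, familyMax volume ratBox Set.univ f (consEquiv n (x, x')) ^ p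
        ≤ ∫⁻ x', C * ∫⁻ y, G (y, x') ^ p := by
          refine lintegral_mono fun x' => ?_
          refine le_trans (lintegral_mono fun x => ?_) (hC (hG.comp measurable_prodMk_right))
          exact ENNReal.rpow_le_rpow (hle x x') (by linarith)
      _ = C * ∫⁻ y, ∫⁻ x', G (y, x') ^ p := by
          rw [lintegral_const_mul _ (hG.pow_const p).lintegral_prod_left',
            lintegral_lintegral_swap]
          exact ((hG.comp measurable_swap).pow_const p).aemeasurable
      _ ≤ C * ∫⁻ y, C ^ n * ∫⁻ x', f (consEquiv n (y, x')) ^ p := by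
          gcongr with y
          simp_rw [← hGe]
          exact ih (hfy y)
      _ = C ^ (n + 1) * ∫⁻ y, ∫⁻ x', f (consEquiv n (y, x')) ^ p := by
          rw [lintegral_const_mul _ (hf'.pow_const p).lintegral_prod_right', pow_succ', mul_assoc]

theorem exists_rat_seq_lt_tendsto (a : ℝ) :
    ∃ u : ℕ → ℚ, (∀ k, (u k : ℝ) < a) ∧ Tendsto (fun k => (u k : ℝ)) atTop (𝓝 a) := by
  have h : ∀ k : ℕ, ∃ q : ℚ, a - 1 / ((k : ℝ) + 1) < q ∧ (q : ℝ) < a := fun k =>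
    exists_rat_btwn (by have : 0 < 1 / ((k : ℝ) + 1) := by positivity
                        linarith)
  choose u hu hu' using h
  refine ⟨u, hu', tendsto_of_tendsto_of_tendsto_of_le_of_le ?_ tendsto_const_nhds
    (fun k => (hu k).le) fun k => (hu' k).le⟩
  simpa using tendsto_const_nhds.sub (tendsto_one_div_add_atTop_nhds_zero_nat (𝕜 := ℝ))

theorem exists_rat_seq_gt_tendsto (a : ℝ) :
    ∃ u : ℕ → ℚ, (∀ k, a < (u k : ℝ)) ∧ Tendsto (fun k => (u k : ℝ)) atTop (𝓝 a) := by
  obtain ⟨u, hu, hu'⟩ := exists_rat_seq_lt_tendsto (-a)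
  refine ⟨fun k => -u k, fun k => ?_, ?_⟩
  · have := hu k; push_cast; linarith
  · simpa using hu'.neg

/-- A box is enlarged to rational boxes shrinking down to it. The integral over the original box is
at most the countable supremum times the enlarged volume, and the volumes converge. -/
theorem strongMaximal_le_boxMax (n : ℕ) (f : (Fin n → ℝ) → ℝ) (x : Fin n → ℝ) :
    strongMaximal n f x ≤ familyMax volume ratBox Set.univ (fun y => ‖f y‖ₑ) x := by
  refine iSup₂_le fun a b => iSup₂_le fun ha hb => ?_
  choose u hu hu' using fun i => exists_rat_seq_lt_tendsto (a i)
  choose v hv hv' using fun i => exists_rat_seq_gt_tendsto (b i)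
  set W := familyMax volume ratBox Set.univ (fun y => ‖f y‖ₑ) x with hW
  have hP0 : ∏ i, ENNReal.ofReal (b i - a i) ≠ 0 := by
    rw [Finset.prod_ne_zero_iff]
    intro i _
    rw [ne_eq, ENNReal.ofReal_eq_zero]
    linarith [ha i, hb i]
  have hPt : ∏ i, ENNReal.ofReal (b i - a i) ≠ ∞ :=
    ENNReal.prod_ne_top fun i _ => ENNReal.ofReal_ne_top
  rw [mul_comm, ← div_eq_mul_inv, ENNReal.div_le_iff hP0 hPt]
  have hlim : Tendsto (fun k => W * ∏ i, ENNReal.ofReal ((v i k : ℝ) - u i k)) atTop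
      (𝓝 (W * ∏ i, ENNReal.ofReal (b i - a i))) := by
    refine ENNReal.Tendsto.const_mul ?_ (Or.inl hP0)
    exact ENNReal.tendsto_finsetProd_of_ne_top _
      (fun i _ => ENNReal.tendsto_ofReal ((hv' i).sub (hu' i)))
      fun i _ => ENNReal.ofReal_ne_top
  refine ge_of_tendsto' hlim fun k => ?_
  have hlt : ∀ i, u i k < v i k := fun i => by
    have : (u i k : ℝ) < v i k := by linarith [hu i k, hv i k, ha i, hb i]
    exact_mod_cast this
  set j : Fin n → RatInterval := fun i => ⟨(u i k, v i k), hlt i⟩ with hj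
  have hsub : Set.Icc a b ⊆ ratBox j := fun y hy i _ =>
    ⟨(hu i k).trans_le (hy.1 i), (hy.2 i).trans_lt (hv i k)⟩
  have hxj : x ∈ ratBox j := hsub ⟨fun i => (ha i).le, fun i => (hb i).le⟩
  have hvol : volume (ratBox j) = ∏ i, ENNReal.ofReal ((v i k : ℝ) - u i k) := by
    rw [volume_ratBox]
    exact Finset.prod_congr rfl fun i _ => (j i).volume_eq
  have h1 : famAvg volume ratBox (fun y => ‖f y‖ₑ) j ≤ W := by
    refine le_trans (le_of_eq ?_) (le_iSup₂ j (Set.mem_univ _))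
    rw [Set.indicator_of_mem hxj]
  rw [famAvg, hvol, mul_comm, ← div_eq_mul_inv, ENNReal.div_le_iff] at h1
  · exact (lintegral_mono_set hsub).trans h1
  · rw [← hvol, volume_ratBox, Finset.prod_ne_zero_iff]
    exact fun i _ => (j i).volume_ne_zero
  · exact ENNReal.prod_ne_top fun i _ => ENNReal.ofReal_ne_top

end StrongUpper

/-! ### Passing from integral inequalities to the operator norm. -/

section OpNorm

variable {X : Type*} [MeasureSpace X]

theorem eLpNorm_ofReal_eq {ε : Type*} [TopologicalSpace ε] [ContinuousENorm ε] {p : ℝ}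
    (hp : 0 < p) (f : X → ε) :
    eLpNorm f (ENNReal.ofReal p) volume = (∫⁻ x, ‖f x‖ₑ ^ p) ^ (1 / p) := by
  rw [eLpNorm_eq_lintegral_rpow_enorm_toReal (by simpa using hp) ENNReal.ofReal_ne_top,
    ENNReal.toReal_ofReal hp.le]

/-- A family maximal function that is bounded on `Lᵖ` bounds the operator norm of every operator
it dominates. -/
theorem opNorm_le_of_familyMax {p : ℝ} (hp : 1 < p) {ι : Type*} {I : ι → Set X}
    {T : (X → ℝ) → X → ℝ≥0∞}
    (hT : ∀ f x, T f x ≤ familyMax volume I Set.univ (fun y => ‖f y‖ₑ) x) {C : ℝ≥0∞}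
    (hC : ∀ {g : X → ℝ≥0∞}, Measurable g →
      ∫⁻ x, familyMax volume I Set.univ g x ^ p ≤ C ^ p * ∫⁻ x, g x ^ p) :
    opNorm p T ≤ C := by
  have hp0 : 0 < p := by linarith
  refine sInf_le fun f hf => ?_
  -- Averages depend only on the almost everywhere class of `f`, so a measurable representative has
  -- the same maximal function at every point.
  obtain ⟨g, hg, hfg⟩ := hf.1.aemeasurable.enorm
  rw [eLpNorm_ofReal_eq hp0, eLpNorm_ofReal_eq hp0]
  have h1 : ∀ x, T f x ≤ familyMax volume I Set.univ g x := fun x => by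
    refine (hT f x).trans (le_of_eq ?_)
    have : ∀ i, famAvg volume I (fun y => ‖f y‖ₑ) i = famAvg volume I g i := fun i => by
      rw [famAvg, famAvg, lintegral_congr_ae (ae_restrict_of_ae hfg)]
    simp only [familyMax, this]
  have h2 : ∫⁻ x, ‖f x‖ₑ ^ p = ∫⁻ x, g x ^ p :=
    lintegral_congr_ae (hfg.mono fun x hx => by simp only [hx])
  rw [h2]
  calc (∫⁻ x, ‖T f x‖ₑ ^ p) ^ (1 / p) ≤ (C ^ p * ∫⁻ x, g x ^ p) ^ (1 / p) := by
        refine ENNReal.rpow_le_rpow ?_ (by positivity)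
        refine le_trans (lintegral_mono fun x => ?_) (hC hg)
        exact ENNReal.rpow_le_rpow (h1 x) hp0.le
    _ = C * (∫⁻ x, g x ^ p) ^ (1 / p) := by
        rw [ENNReal.mul_rpow_of_nonneg _ _ (by positivity), ← ENNReal.rpow_mul,
          mul_one_div_cancel hp0.ne', ENNReal.rpow_one]

theorem opNorm_strongMaximal_le {p c : ℝ} (hp : 1 < p) (hc0 : 0 < c)
    (hc : ∀ x : ℝ, 0 < x → (p - 1) * x ^ p ≤ p * x ^ (p - 1) + 1 → x ≤ c) (n : ℕ) :
    opNorm p (strongMaximal n) ≤ ENNReal.ofReal (c ^ n) := by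
  refine opNorm_le_of_familyMax hp (strongMaximal_le_boxMax n) fun hg => ?_
  have := lintegral_boxMax_rpow_le hp (fun hg => lintegral_intervalMax_rpow_le hp hc0 hc hg) n hg
  rwa [ENNReal.ofReal_pow hc0.le, ← ENNReal.rpow_natCast, ← ENNReal.rpow_mul, mul_comm (n : ℝ) p,
    ENNReal.rpow_mul, ENNReal.rpow_natCast]

end OpNorm

/-! ### Strict lower bound for the strong maximal operator, by products of powers. -/

section StrongLower

variable {X : Type*} [MeasureSpace X]

theorem eLpNorm_div_le_opNorm {p : ℝ} {T : (X → ℝ) → X → ℝ≥0∞} {f : X → ℝ}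
    (hf : MemLp f (ENNReal.ofReal p) volume) (h0 : eLpNorm f (ENNReal.ofReal p) volume ≠ 0) :
    eLpNorm (T f) (ENNReal.ofReal p) volume / eLpNorm f (ENNReal.ofReal p) volume ≤ opNorm p T := by
  refine le_sInf fun C hC => ?_
  rw [ENNReal.div_le_iff h0 hf.2.ne]
  exact hC f hf

/-- Meant for test functions whose maximal function dominates a fixed multiple of the function
itself, so that no norm has to be compared. -/
theorem le_opNorm_of_pointwise {p : ℝ} (hp : 0 < p) {T : (X → ℝ) → X → ℝ≥0∞} {f : X → ℝ}
    (hf : MemLp f (ENNReal.ofReal p) volume) (h0 : eLpNorm f (ENNReal.ofReal p) volume ≠ 0)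
    {K : ℝ≥0∞} (hKt : K ≠ ∞) (hK : ∀ x, K * ‖f x‖ₑ ≤ T f x) : K ≤ opNorm p T := by
  refine le_trans ?_ (eLpNorm_div_le_opNorm hf h0)
  rw [ENNReal.le_div_iff_mul_le (Or.inl h0) (Or.inl hf.2.ne), eLpNorm_ofReal_eq hp,
    eLpNorm_ofReal_eq hp]
  calc K * (∫⁻ x, ‖f x‖ₑ ^ p) ^ (1 / p) = (∫⁻ x, K ^ p * ‖f x‖ₑ ^ p) ^ (1 / p) := by
        rw [lintegral_const_mul' _ _ (ENNReal.rpow_ne_top_of_nonneg hp.le hKt),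
          ENNReal.mul_rpow_of_nonneg _ _ (by positivity), ← ENNReal.rpow_mul,
          mul_one_div_cancel hp.ne', ENNReal.rpow_one]
    _ ≤ _ := by
        refine ENNReal.rpow_le_rpow (lintegral_mono fun x => ?_) (by positivity)
        rw [← ENNReal.mul_rpow_of_nonneg _ _ hp.le]
        exact ENNReal.rpow_le_rpow (hK x) hp.le

theorem lintegral_pi_prod {n : ℕ} {f : Fin n → ℝ → ℝ≥0∞} (hf : ∀ i, Measurable (f i)) :
    ∫⁻ x : Fin n → ℝ, ∏ i, f i (x i) = ∏ i, ∫⁻ t, f i t := by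
  induction n with
  | zero =>
    have hv : (volume : Measure (Fin 0 → ℝ)) = Measure.dirac 0 := Measure.pi_of_empty _ 0
    simp [hv]
  | succ n ih =>
    have hm : Measurable fun y : Fin n → ℝ => ∏ i : Fin n, f i.succ (y i) :=
      Finset.measurable_fun_prod _ fun i _ => (hf i.succ).comp (measurable_pi_apply i)
    rw [← (measurePreserving_consEquiv n).lintegral_comp_emb (consEquiv n).measurableEmbedding,
      Measure.volume_eq_prod, Fin.prod_univ_succ, ← ih fun i => hf i.succ,
      ← lintegral_prod_mul (hf 0).aemeasurable hm.aemeasurable]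
    refine lintegral_congr fun z => ?_
    rw [consEquiv_apply, Fin.prod_univ_succ]
    simp

theorem lintegral_Ioc_rpow {α a : ℝ} (hα : 0 < α) (ha : 0 ≤ a) :
    ∫⁻ x in Set.Ioc 0 a, ENNReal.ofReal (|x| ^ (α - 1)) = ENNReal.ofReal (a ^ α / α) := by
  have h1 : ∫⁻ x in Set.Ioc 0 a, ENNReal.ofReal (|x| ^ (α - 1)) =
      ∫⁻ x in Set.Ioc 0 a, ENNReal.ofReal (x ^ (α - 1)) :=
    setLIntegral_congr_fun measurableSet_Ioc fun x hx => by simp only [abs_of_pos hx.1]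
  have hint : IntegrableOn (fun x : ℝ => x ^ (α - 1)) (Set.Ioc 0 a) :=
    (intervalIntegrable_iff_integrableOn_Ioc_of_le ha).1
      (intervalIntegral.intervalIntegrable_rpow' (by linarith))
  rw [h1, ← ofReal_integral_eq_lintegral_ofReal hint, ← intervalIntegral.integral_of_le ha,
    integral_rpow (Or.inl (by linarith))]
  · simp [Real.zero_rpow hα.ne']
  · filter_upwards [ae_restrict_mem measurableSet_Ioc] with x hx
    exact Real.rpow_nonneg hx.1.le _

theorem lintegral_Ico_neg {b : ℝ} (g : ℝ → ℝ≥0∞) :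
    ∫⁻ x in Set.Ico (-b) 0, g x = ∫⁻ x in Set.Ioc 0 b, g (-x) := by
  rw [← (Measure.measurePreserving_neg (volume : Measure ℝ)).setLIntegral_comp_preimage_emb
    (MeasurableEquiv.neg ℝ).measurableEmbedding]
  simp

theorem lintegral_Icc_rpow_abs {α a b : ℝ} (hα : 0 < α) (ha : 0 ≤ a) (hb : 0 ≤ b) :
    ∫⁻ x in Set.Icc (-b) a, ENNReal.ofReal (|x| ^ (α - 1)) =
      ENNReal.ofReal ((a ^ α + b ^ α) / α) := by
  have h1 : Set.Icc (-b) a =ᵐ[volume] (Set.Ico (-b) 0 ∪ Set.Ioc 0 a : Set ℝ) := by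
    have h2 : Set.Icc (-b) a \ {0} = Set.Ico (-b) 0 ∪ Set.Ioc 0 a := by
      ext x
      simp only [Set.mem_sdiff, Set.mem_Icc, Set.mem_singleton_iff, Set.mem_union, Set.mem_Ico,
        Set.mem_Ioc]
      constructor
      · rintro ⟨⟨h1, h2⟩, h3⟩
        rcases lt_or_gt_of_ne h3 with h | h
        · exact Or.inl ⟨h1, h⟩
        · exact Or.inr ⟨h, h2⟩
      · rintro (⟨h1, h2⟩ | ⟨h1, h2⟩)
        · exact ⟨⟨h1, by linarith⟩, h2.ne⟩
        · exact ⟨⟨by linarith, h2⟩, h1.ne'⟩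
    rw [← h2]
    exact (sdiff_null_ae_eq_self (measure_singleton 0)).symm
  rw [setLIntegral_congr h1, lintegral_union measurableSet_Ioc, lintegral_Ico_neg]
  · simp only [abs_neg]
    rw [lintegral_Ioc_rpow hα hb, lintegral_Ioc_rpow hα ha, ← ENNReal.ofReal_add (by positivity)
      (by positivity)]
    congr 1; ring
  · exact Set.disjoint_left.2 fun x hx hx' => by linarith [hx.2, hx'.1]

/-- The one-dimensional building block `|x| ^ β χ_{[-1, 1]}` of the extremizing functions for the
strong maximal operator. -/
def powFun (β x : ℝ) : ℝ := (Set.Icc (-1) 1).indicator (fun x => |x| ^ β) x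

theorem measurable_powFun (β : ℝ) : Measurable (powFun β) :=
  (measurable_id.abs.pow_const β).indicator measurableSet_Icc

theorem powFun_nonneg (β x : ℝ) : 0 ≤ powFun β x :=
  Set.indicator_nonneg (fun _ _ => Real.rpow_nonneg (abs_nonneg _) _) _

theorem enorm_powFun (β x : ℝ) :
    ‖powFun β x‖ₑ = (Set.Icc (-1) 1).indicator (fun x => ENNReal.ofReal (|x| ^ β)) x := by
  rw [Real.enorm_eq_ofReal (powFun_nonneg β x), powFun]
  by_cases hx : x ∈ Set.Icc (-1 : ℝ) 1
  · simp only [Set.indicator_of_mem hx]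
  · simp only [Set.indicator_of_notMem hx, ENNReal.ofReal_zero]

theorem lintegral_powFun_rpow {β p : ℝ} (hp : 0 < p) (hβ : 0 < β * p + 1) :
    ∫⁻ x, ‖powFun β x‖ₑ ^ p = ENNReal.ofReal (2 / (β * p + 1)) := by
  have h1 : ∀ x, ‖powFun β x‖ₑ ^ p = (Set.Icc (-1 : ℝ) 1).indicator
      (fun x => ENNReal.ofReal (|x| ^ (β * p + 1 - 1))) x := by
    intro x
    rw [enorm_powFun]
    by_cases hx : x ∈ Set.Icc (-1 : ℝ) 1
    · rw [Set.indicator_of_mem hx, Set.indicator_of_mem hx, add_sub_cancel_right,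
        Real.rpow_mul (abs_nonneg x), ENNReal.ofReal_rpow_of_nonneg
        (Real.rpow_nonneg (abs_nonneg x) _) hp.le]
    · rw [Set.indicator_of_notMem hx, Set.indicator_of_notMem hx, ENNReal.zero_rpow_of_pos hp]
  simp_rw [h1]
  rw [lintegral_indicator measurableSet_Icc, lintegral_Icc_rpow_abs hβ zero_le_one zero_le_one]
  norm_num

/-- Every point has an interval over which the average of `powFun` is large. -/
theorem exists_interval_powFun {α s t : ℝ} (hα : 0 < α) (hα1 : α < 1) (hs0 : 0 < s) (hs1 : s < 1)
    (ht : 1 < t) {x : ℝ} (hx : powFun (α - 1) x ≠ 0) :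
    ∃ a b : ℝ, a < x ∧ x < b ∧
      ENNReal.ofReal ((1 + s ^ α) / (α * (t + s))) * ‖powFun (α - 1) x‖ₑ ≤
        (ENNReal.ofReal (b - a))⁻¹ * ∫⁻ y in Set.Icc a b, ‖powFun (α - 1) y‖ₑ := by
  have hmem : x ∈ Set.Icc (-1 : ℝ) 1 := by
    by_contra h
    exact hx (Set.indicator_of_notMem h _)
  have hx0 : x ≠ 0 := by
    rintro rfl
    apply hx
    rw [powFun, Set.indicator_of_mem hmem, abs_zero, Real.zero_rpow (by linarith)]
  have hr0 : 0 < |x| := abs_pos.2 hx0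
  have hr1 : |x| ≤ 1 := abs_le.2 hmem
  -- Of the interval `[a, b]` only the part `[-v, u]` inside `[-1, 1]` is used, with `{u, v} = {|x|,
  -- s |x|}`. The stretch from `x` to `t x`, present only to make `x` interior, may leave the
  -- support and is discarded.
  have key : ∀ u v : ℝ, 0 < u → 0 < v → u ≤ 1 → v ≤ 1 → u ^ α + v ^ α = |x| ^ α * (1 + s ^ α) →
      ∀ a b : ℝ, a ≤ -v → u ≤ b → b - a = |x| * (t + s) →
      ENNReal.ofReal ((1 + s ^ α) / (α * (t + s))) * ‖powFun (α - 1) x‖ₑ ≤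
        (ENNReal.ofReal (b - a))⁻¹ * ∫⁻ y in Set.Icc a b, ‖powFun (α - 1) y‖ₑ := by
    intro u v hu hv hu1 hv1 huv a b hav hub hba
    have h1 : ENNReal.ofReal ((u ^ α + v ^ α) / α) ≤
        ∫⁻ y in Set.Icc a b, ‖powFun (α - 1) y‖ₑ := by
      rw [← lintegral_Icc_rpow_abs hα hu.le hv.le]
      calc ∫⁻ y in Set.Icc (-v) u, ENNReal.ofReal (|y| ^ (α - 1))
          = ∫⁻ y in Set.Icc (-v) u, ‖powFun (α - 1) y‖ₑ := by
            refine setLIntegral_congr_fun measurableSet_Icc fun y hy => ?_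
            rw [enorm_powFun, Set.indicator_of_mem]
            exact ⟨by linarith [hy.1], by linarith [hy.2]⟩
        _ ≤ _ := lintegral_mono_set (Set.Icc_subset_Icc hav hub)
    refine le_trans (le_of_eq ?_) (mul_le_mul_right h1 _)
    have h2 : 0 < s ^ α := Real.rpow_pos_of_pos hs0 α
    rw [enorm_powFun, Set.indicator_of_mem hmem, huv, hba,
      ← ENNReal.ofReal_inv_of_pos (by positivity),
      ← ENNReal.ofReal_mul (by positivity), ← ENNReal.ofReal_mul (by positivity),
      Real.rpow_sub_one hr0.ne']
    congr 1
    field_simp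
  have hsr : 0 < s * |x| := by positivity
  have hsr1 : s * |x| ≤ 1 := by nlinarith
  have hsp : (s * |x|) ^ α = s ^ α * |x| ^ α := Real.mul_rpow hs0.le hr0.le
  rcases lt_or_gt_of_ne hx0 with h | h
  · refine ⟨t * x, -(s * x), by nlinarith, by nlinarith, ?_⟩
    have hax : |x| = -x := abs_of_neg h
    refine key (s * |x|) |x| hsr hr0 hsr1 hr1 (by rw [hsp]; ring) _ _ ?_ ?_ ?_
    · rw [hax]; nlinarith
    · rw [hax]; nlinarith
    · rw [hax]; ring
  · refine ⟨-(s * x), t * x, by nlinarith, by nlinarith, ?_⟩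
    have hax : |x| = x := abs_of_pos h
    refine key |x| (s * |x|) hr0 hsr hr1 hsr1 (by rw [hsp]; ring) _ _ ?_ ?_ ?_
    · rw [hax]
    · rw [hax]; nlinarith
    · rw [hax]; ring

/-- The product of copies of `powFun`, one for each coordinate. -/
def powProd (n : ℕ) (β : ℝ) (x : Fin n → ℝ) : ℝ := ∏ i, powFun β (x i)

theorem enorm_powProd {n : ℕ} {β : ℝ} (x : Fin n → ℝ) :
    ‖powProd n β x‖ₑ = ∏ i, ‖powFun β (x i)‖ₑ := by
  rw [powProd, Real.enorm_eq_ofReal (Finset.prod_nonneg fun i _ => powFun_nonneg β _),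
    ENNReal.ofReal_prod_of_nonneg fun i _ => powFun_nonneg β _]
  exact Finset.prod_congr rfl fun i _ => (Real.enorm_eq_ofReal (powFun_nonneg β _)).symm

theorem lintegral_powProd_rpow {n : ℕ} {β p : ℝ} (hp : 0 < p) (hβ : 0 < β * p + 1) :
    ∫⁻ x, ‖powProd n β x‖ₑ ^ p = ENNReal.ofReal (2 / (β * p + 1)) ^ n := by
  simp_rw [enorm_powProd, ← ENNReal.prod_rpow_of_nonneg hp.le]
  rw [lintegral_pi_prod fun i => (measurable_powFun β).enorm.pow_const p]
  simp [lintegral_powFun_rpow hp hβ]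

/-- Choosing a good interval in each coordinate gives a box over which the average of a product is
the product of the averages. Points where the product vanishes need no box. -/
theorem le_strongMaximal_powProd {n : ℕ} {α s t : ℝ} (hα : 0 < α) (hα1 : α < 1) (hs0 : 0 < s)
    (hs1 : s < 1) (ht : 1 < t) (x : Fin n → ℝ) :
    ENNReal.ofReal ((1 + s ^ α) / (α * (t + s))) ^ n * ‖powProd n (α - 1) x‖ₑ ≤
      strongMaximal n (powProd n (α - 1)) x := by
  by_cases hx : powProd n (α - 1) x = 0
  · simp [hx]
  have hx' : ∀ i, powFun (α - 1) (x i) ≠ 0 := fun i => by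
    rw [powProd, Finset.prod_eq_zero_iff] at hx
    push Not at hx
    exact hx i (Finset.mem_univ i)
  choose a b ha hb hab using fun i => exists_interval_powFun hα hα1 hs0 hs1 ht (hx' i)
  refine le_trans ?_ (le_iSup₂_of_le a b (le_iSup₂_of_le ha hb le_rfl))
  have hbox : ∫⁻ y in Set.Icc a b, ‖powProd n (α - 1) y‖ₑ =
      ∏ i, ∫⁻ y in Set.Icc (a i) (b i), ‖powFun (α - 1) y‖ₑ := by
    have h1 : ∀ y, (Set.Icc a b).indicator (fun y => ‖powProd n (α - 1) y‖ₑ) y =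
        ∏ i, (Set.Icc (a i) (b i)).indicator (fun y => ‖powFun (α - 1) y‖ₑ) (y i) := by
      intro y
      by_cases hy : y ∈ Set.Icc a b
      · rw [Set.indicator_of_mem hy, enorm_powProd]
        exact Finset.prod_congr rfl fun i _ => by
          rw [Set.indicator_of_mem (show y i ∈ Set.Icc (a i) (b i) from ⟨hy.1 i, hy.2 i⟩)]
      · rw [Set.indicator_of_notMem hy]
        obtain ⟨i, hi⟩ : ∃ i, y i ∉ Set.Icc (a i) (b i) := by
          by_contra! h
          exact hy ⟨fun i => (h i).1, fun i => (h i).2⟩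
        exact (Finset.prod_eq_zero (Finset.mem_univ i) (Set.indicator_of_notMem hi _)).symm
    rw [← lintegral_indicator measurableSet_Icc]
    simp_rw [h1]
    rw [lintegral_pi_prod fun i => (measurable_powFun _).enorm.indicator measurableSet_Icc]
    exact Finset.prod_congr rfl fun i _ => lintegral_indicator measurableSet_Icc _
  have hinv : (∏ i, ENNReal.ofReal (b i - a i))⁻¹ = ∏ i, (ENNReal.ofReal (b i - a i))⁻¹ :=
    ENNReal.prod_inv_distrib fun i _ j _ _ => Or.inr ENNReal.ofReal_ne_top
  rw [hbox, hinv, ← Finset.prod_mul_distrib, enorm_powProd]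
  calc _ = ∏ i, ENNReal.ofReal ((1 + s ^ α) / (α * (t + s))) * ‖powFun (α - 1) (x i)‖ₑ := by
        rw [Finset.prod_mul_distrib]; simp
    _ ≤ _ := Finset.prod_le_prod' fun i _ => hab i

/-- At `α = q = 1 / p'`, `t = 1` and `s = 1 / 2` the factor is `(1 + 2 ^ (-q)) / (3 q / 2)`. This is
more than `1 / q` because `2 ^ (-q) > 1 / 2`. By continuity the strict inequality survives a small
`δ > 0` added to both `α` and `t`, and `α > 1 / p'` is exactly what makes the power `p`-integrable
at the origin. -/
theorem exists_exponent_lt {p : ℝ} (hp : 1 < p) :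
    ∃ α t : ℝ, 0 < α ∧ α < 1 ∧ 1 < t ∧ 0 < (α - 1) * p + 1 ∧
      p / (p - 1) < (1 + (1 / 2 : ℝ) ^ α) / (α * (t + 1 / 2)) := by
  have hp1 : 0 < p - 1 := by linarith
  set q : ℝ := (p - 1) / p with hq
  have hq0 : 0 < q := by positivity
  have hq1 : q < 1 := by rw [hq, div_lt_one (by linarith)]; linarith
  have hlim : Tendsto (fun δ : ℝ => (1 + (1 / 2 : ℝ) ^ (q + δ)) / ((q + δ) * (1 + δ + 1 / 2)))
      (𝓝[>] 0) (𝓝 ((1 + (1 / 2 : ℝ) ^ (q + 0)) / ((q + 0) * (1 + 0 + 1 / 2)))) := by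
    refine Tendsto.mono_left (ContinuousAt.tendsto ?_) nhdsWithin_le_nhds
    refine ContinuousAt.div ?_ (by fun_prop) (by rw [add_zero]; positivity)
    refine continuousAt_const.add (ContinuousAt.rpow continuousAt_const (by fun_prop) ?_)
    left; norm_num
  have hgt : p / (p - 1) < (1 + (1 / 2 : ℝ) ^ (q + 0)) / ((q + 0) * (1 + 0 + 1 / 2)) := by
    have h1 : (1 / 2 : ℝ) ^ (1 : ℝ) < (1 / 2 : ℝ) ^ q :=
      Real.rpow_lt_rpow_of_exponent_gt (by norm_num) (by norm_num) hq1
    have h2 : p / (p - 1) = 1 / q := by rw [hq]; field_simp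
    rw [Real.rpow_one] at h1
    rw [h2, add_zero, add_zero, div_lt_div_iff₀ hq0 (by positivity)]
    nlinarith
  have hev := hlim.eventually_const_lt hgt
  have hsmall : ∀ᶠ δ : ℝ in 𝓝[>] 0, δ < 1 - q :=
    (eventually_lt_nhds (by linarith)).filter_mono nhdsWithin_le_nhds
  obtain ⟨δ, h1, h2, h3⟩ := (hev.and (hsmall.and self_mem_nhdsWithin)).exists
  have h3 : 0 < δ := h3
  refine ⟨q + δ, 1 + δ, by linarith, by linarith, by linarith, ?_, h1⟩
  have : (q + δ - 1) * p + 1 = δ * p := by rw [hq]; field_simp; ring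
  rw [this]; positivity

theorem lt_opNorm_strongMaximal {p : ℝ} (hp : 1 < p) {n : ℕ} (hn : 1 ≤ n) :
    ENNReal.ofReal ((p / (p - 1)) ^ n) < opNorm p (strongMaximal n) := by
  obtain ⟨α, t, hα, hα1, ht, hβ, hlt⟩ := exists_exponent_lt hp
  have hp0 : 0 < p := by linarith
  have hp' : 0 < p / (p - 1) := div_pos hp0 (by linarith)
  have hI := lintegral_powProd_rpow (n := n) hp0 hβ
  have hpos : 0 < ENNReal.ofReal (2 / ((α - 1) * p + 1)) ^ n :=
    ENNReal.pow_pos (ENNReal.ofReal_pos.2 (by positivity)) n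
  have hm : Measurable (powProd n (α - 1)) :=
    Finset.measurable_fun_prod _ fun i _ => (measurable_powFun _).comp (measurable_pi_apply i)
  have hnorm := eLpNorm_ofReal_eq (X := Fin n → ℝ) hp0 (powProd n (α - 1))
  rw [hI] at hnorm
  have hmem : MemLp (powProd n (α - 1)) (ENNReal.ofReal p) volume := by
    refine ⟨hm.aestronglyMeasurable, ?_⟩
    rw [hnorm]
    exact ENNReal.rpow_lt_top_of_nonneg (by positivity) (by finiteness)
  have h0 : eLpNorm (powProd n (α - 1)) (ENNReal.ofReal p) volume ≠ 0 := by
    rw [hnorm]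
    exact (ENNReal.rpow_pos hpos (by finiteness)).ne'
  have hle := le_opNorm_of_pointwise hp0 hmem h0 (by finiteness)
    (le_strongMaximal_powProd (n := n) hα hα1 one_half_pos one_half_lt_one ht)
  refine lt_of_lt_of_le ?_ hle
  rw [ENNReal.ofReal_pow hp'.le]
  exact ENNReal.pow_lt_pow_left (by omega) ((ENNReal.ofReal_lt_ofReal_iff (hp'.trans hlt)).2 hlt)

end StrongLower

/-! ### Upper bound for balls by Vitali's covering lemma. -/

section BallUpper

variable {n : ℕ}

/-- The closed balls with centers in a dense sequence and rational radii. -/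
def ratBall (i : ℕ × {q : ℚ // 0 < q}) : Set (EuclideanSpace ℝ (Fin n)) :=
  Metric.closedBall (TopologicalSpace.denseSeq _ i.1) (i.2.1 : ℝ)

theorem measurableSet_ratBall (i : ℕ × {q : ℚ // 0 < q}) :
    MeasurableSet (ratBall i : Set (EuclideanSpace ℝ (Fin n))) :=
  Metric.isClosed_closedBall.measurableSet

theorem volume_closedBall_ne_zero (z : EuclideanSpace ℝ (Fin n)) {r : ℝ} (hr : 0 < r) :
    volume (Metric.closedBall z r) ≠ 0 :=
  (Metric.measure_closedBall_pos volume z hr).ne'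

theorem volume_closedBall_ne_top (z : EuclideanSpace ℝ (Fin n)) (r : ℝ) :
    volume (Metric.closedBall z r) ≠ ∞ := measure_closedBall_lt_top.ne

theorem volume_ratBall_ne_zero (i : ℕ × {q : ℚ // 0 < q}) :
    volume (ratBall i : Set (EuclideanSpace ℝ (Fin n))) ≠ 0 :=
  volume_closedBall_ne_zero _ (by exact_mod_cast i.2.2)

/-- The balls of a disjoint subfamily, enlarged five times, cover the union, which costs the factor
`5 ^ n`. Disjointness lets their integrals add up to at most the integral over the union. -/
theorem ball_covering {f : EuclideanSpace ℝ (Fin n) → ℝ≥0∞}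
    (T : Finset (ℕ × {q : ℚ // 0 < q})) (t : ℝ≥0∞)
    (hT : ∀ i ∈ T, t * volume (ratBall i : Set (EuclideanSpace ℝ (Fin n))) ≤
      ∫⁻ y in ratBall i, f y) :
    t * volume (⋃ i ∈ T, ratBall i : Set (EuclideanSpace ℝ (Fin n))) ≤
      5 ^ n * ∫⁻ x in ⋃ i ∈ T, ratBall i, f x := by
  have hpos : ∀ i : ℕ × {q : ℚ // 0 < q}, (0 : ℝ) < (i.2.1 : ℝ) := fun i => by
    exact_mod_cast i.2.2
  -- The sum of the radii serves as the uniform bound on radii that Vitali's lemma asks for.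
  obtain ⟨u, huT, hdisj, hcov⟩ := Vitali.exists_disjoint_subfamily_covering_enlargement_closedBall
    (T : Set (ℕ × {q : ℚ // 0 < q}))
    (fun i => TopologicalSpace.denseSeq (EuclideanSpace ℝ (Fin n)) i.1) (fun i => (i.2.1 : ℝ))
    (∑ i ∈ T, (i.2.1 : ℝ))
    (fun i hi => Finset.single_le_sum (f := fun i : ℕ × {q : ℚ // 0 < q} => (i.2.1 : ℝ))
      (fun j _ => (hpos j).le) hi) 5 (by norm_num)
  obtain ⟨u, rfl⟩ := (T.finite_toSet.subset huT).exists_finset_coe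
  have huT' : u ⊆ T := by exact_mod_cast huT
  have hfive : ∀ i : ℕ × {q : ℚ // 0 < q}, volume (Metric.closedBall
      (TopologicalSpace.denseSeq (EuclideanSpace ℝ (Fin n)) i.1) (5 * (i.2.1 : ℝ))) =
      5 ^ n * volume (ratBall i : Set (EuclideanSpace ℝ (Fin n))) := by
    intro i
    rw [ratBall, Measure.addHaar_closedBall_mul _ _ (by norm_num) (hpos i).le,
      Measure.addHaar_closedBall_center _ (TopologicalSpace.denseSeq _ i.1),
      finrank_euclideanSpace_fin, ENNReal.ofReal_pow (by norm_num)]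
    norm_num
  have hsub : (⋃ i ∈ T, ratBall i : Set (EuclideanSpace ℝ (Fin n))) ⊆ ⋃ i ∈ u, Metric.closedBall
      (TopologicalSpace.denseSeq (EuclideanSpace ℝ (Fin n)) i.1) (5 * (i.2.1 : ℝ)) := by
    refine Set.iUnion₂_subset fun i hi => ?_
    obtain ⟨j, hj, hij⟩ := hcov i hi
    exact hij.trans (Set.subset_biUnion_of_mem (u := fun i : ℕ × {q : ℚ // 0 < q} =>
      Metric.closedBall (TopologicalSpace.denseSeq (EuclideanSpace ℝ (Fin n)) i.1)
        (5 * (i.2.1 : ℝ))) hj)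
  calc t * volume (⋃ i ∈ T, ratBall i : Set (EuclideanSpace ℝ (Fin n)))
      ≤ t * ∑ i ∈ u, 5 ^ n * volume (ratBall i : Set (EuclideanSpace ℝ (Fin n))) := by
        gcongr
        refine (measure_mono hsub).trans ((measure_biUnion_finset_le _ _).trans (le_of_eq ?_))
        exact Finset.sum_congr rfl fun i _ => hfive i
    _ = 5 ^ n * ∑ i ∈ u, t * volume (ratBall i : Set (EuclideanSpace ℝ (Fin n))) := by
        rw [← Finset.mul_sum, ← Finset.mul_sum]; ring
    _ ≤ 5 ^ n * ∑ i ∈ u, ∫⁻ y in ratBall i, f y := by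
        gcongr with i hi
        exact hT i (huT' hi)
    _ = 5 ^ n * ∫⁻ y in ⋃ i ∈ u, ratBall i, f y := by
        rw [lintegral_biUnion_finset (t := ratBall) hdisj fun i _ => measurableSet_ratBall i]
    _ ≤ _ := by
        exact mul_le_mul_right (lintegral_mono_set (Set.biUnion_subset_biUnion_left huT')) _

/-- For rational `q > r` some point of the dense sequence lies within `q - r` of the centre, and the
ball of radius `q` about it contains the given ball. The volumes converge as `q` decreases to `r`.
-/
theorem ballMaximal_le_familyMax (f : EuclideanSpace ℝ (Fin n) → ℝ)
    (x : EuclideanSpace ℝ (Fin n)) :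
    ballMaximal n f x ≤ familyMax volume ratBall Set.univ (fun y => ‖f y‖ₑ) x := by
  refine iSup₂_le fun z r => iSup₂_le fun hr hx => ?_
  obtain ⟨q, hq, hq'⟩ := exists_rat_seq_gt_tendsto r
  set W := familyMax volume ratBall Set.univ (fun y => ‖f y‖ₑ) x with hW
  have hvol : ∀ (w : EuclideanSpace ℝ (Fin n)) (s : ℝ), 0 ≤ s →
      volume (Metric.closedBall w s) = ENNReal.ofReal (s ^ n) *
        volume (Metric.ball (0 : EuclideanSpace ℝ (Fin n)) 1) := fun w s hs => by
    rw [Measure.addHaar_closedBall _ _ hs, finrank_euclideanSpace_fin]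
  rw [mul_comm, ← div_eq_mul_inv, ENNReal.div_le_iff (volume_closedBall_ne_zero z hr)
    (volume_closedBall_ne_top z r), hvol z r hr.le]
  have hlim : Tendsto (fun k => W * (ENNReal.ofReal ((q k : ℝ) ^ n) *
      volume (Metric.ball (0 : EuclideanSpace ℝ (Fin n)) 1))) atTop
      (𝓝 (W * (ENNReal.ofReal (r ^ n) *
        volume (Metric.ball (0 : EuclideanSpace ℝ (Fin n)) 1)))) := by
    refine ENNReal.Tendsto.const_mul (ENNReal.Tendsto.mul_const (ENNReal.tendsto_ofReal
      (hq'.pow n)) (Or.inr measure_ball_lt_top.ne)) (Or.inl ?_)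
    rw [← hvol z r hr.le]
    exact volume_closedBall_ne_zero z hr
  refine ge_of_tendsto' hlim fun k => ?_
  have hq0 : (0 : ℝ) < q k := hr.trans (hq k)
  obtain ⟨m, hm⟩ := (TopologicalSpace.denseRange_denseSeq (EuclideanSpace ℝ (Fin n))).exists_dist_lt
    z (sub_pos.2 (hq k))
  set j : ℕ × {q : ℚ // 0 < q} := (m, ⟨q k, by exact_mod_cast hq0⟩) with hj
  have hsub : Metric.closedBall z r ⊆ ratBall j := by
    refine Metric.closedBall_subset_closedBall' ?_
    simp only [hj]
    linarith
  have h1 : famAvg volume ratBall (fun y => ‖f y‖ₑ) j ≤ W := by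
    refine le_trans (le_of_eq ?_) (le_iSup₂ j (Set.mem_univ _))
    rw [Set.indicator_of_mem (hsub hx)]
  have hvj : volume (ratBall j : Set (EuclideanSpace ℝ (Fin n))) =
      ENNReal.ofReal ((q k : ℝ) ^ n) * volume (Metric.ball (0 : EuclideanSpace ℝ (Fin n)) 1) :=
    hvol _ _ hq0.le
  rw [famAvg, mul_comm, ← div_eq_mul_inv, ENNReal.div_le_iff (volume_ratBall_ne_zero j)
    (volume_closedBall_ne_top _ _), hvj] at h1
  exact (lintegral_mono_set hsub).trans h1

/-- The covering inequality, with no second term, gives `(p - 1) A ≤ p 5 ^ n F ^ (1 / p) A ^ (1 - 1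
/ p)` for finite subfamilies. Cancelling the power of `A` gives the constant. -/
theorem opNorm_ballMaximal_le {p : ℝ} (hp : 1 < p) (n : ℕ) :
    opNorm p (ballMaximal n) ≤ ENNReal.ofReal (conj p * 5 ^ n) := by
  have hp0 : 0 < p := by linarith
  have hp1 : 0 < p - 1 := by linarith
  have hc := conj_pos hp
  refine opNorm_le_of_familyMax hp ballMaximal_le_familyMax fun {f} hf => ?_
  by_cases hF : ∫⁻ x, f x ^ p = ∞
  · rw [hF, ENNReal.mul_top]
    · exact le_top
    · rw [ne_eq, ENNReal.rpow_eq_zero_iff_of_pos hp0, ENNReal.ofReal_eq_zero, not_le]; positivity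
  refine lintegral_familyMax_univ_rpow_le hp0 measurableSet_ratBall fun S => ?_
  have hmain := lintegral_familyMax_rpow_le_of_covering (μ := volume) (I := ratBall) hp
    (K := 5 ^ n) (K' := 0) (by finiteness) ENNReal.zero_ne_top hf measurableSet_ratBall
    volume_ratBall_ne_zero (fun i => volume_closedBall_ne_top _ _) hF (fun T t _ hT => by
      simpa only [zero_mul, add_zero] using ball_covering T t hT) S
  have hA := lintegral_familyMax_rpow_ne_top hp measurableSet_ratBall volume_ratBall_ne_zero
    (fun i => volume_closedBall_ne_top _ _) hF S
  generalize ∫⁻ x, familyMax volume ratBall S f x ^ p = A at hmain hA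
  generalize ∫⁻ x, f x ^ p = F at hmain hF
  simp only [zero_mul, add_zero] at hmain
  by_cases hA0 : A = 0
  · rw [hA0]; exact zero_le
  have hAp : A = A ^ (1 / p) * A ^ (1 - 1 / p) := by
    rw [← ENNReal.rpow_add _ _ hA0 hA]; simp
  have h1 : A ^ (1 / p) ≤ ENNReal.ofReal (conj p * 5 ^ n) * F ^ (1 / p) := by
    have hB0 : A ^ (1 - 1 / p) ≠ 0 := by
      rw [ne_eq, ENNReal.rpow_eq_zero_iff]; tauto
    have hBt : A ^ (1 - 1 / p) ≠ ∞ :=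
      ENNReal.rpow_ne_top_of_nonneg (by rw [sub_nonneg, div_le_one hp0]; exact hp.le) hA
    have hk0 : ENNReal.ofReal (p - 1) ≠ 0 := by simpa using hp
    have hk : ENNReal.ofReal p = ENNReal.ofReal (p - 1) * ENNReal.ofReal (conj p) := by
      rw [← ENNReal.ofReal_mul hp1.le, conj]; congr 1; field_simp
    rw [ENNReal.ofReal_mul hc.le, ENNReal.ofReal_pow (by norm_num), ENNReal.ofReal_ofNat,
      ← ENNReal.mul_le_mul_iff_left hB0 hBt, ← hAp,
      ← ENNReal.mul_le_mul_iff_right hk0 ENNReal.ofReal_ne_top]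
    refine hmain.trans (le_of_eq ?_)
    rw [hk]; ring
  calc A = (A ^ (1 / p)) ^ p := by
        rw [← ENNReal.rpow_mul, one_div_mul_cancel hp0.ne', ENNReal.rpow_one]
    _ ≤ (ENNReal.ofReal (conj p * 5 ^ n) * F ^ (1 / p)) ^ p := ENNReal.rpow_le_rpow h1 hp0.le
    _ = _ := by
        rw [ENNReal.mul_rpow_of_nonneg _ _ hp0.le, ← ENNReal.rpow_mul, one_div_mul_cancel hp0.ne',
          ENNReal.rpow_one]

end BallUpper

/-! ### Polar coordinates for nonnegative functions. -/

section Polar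

variable {E : Type*} [NormedAddCommGroup E] [NormedSpace ℝ E] [MeasurableSpace E] [BorelSpace E]
  [FiniteDimensional ℝ E] [Nontrivial E] (μ : Measure E) [μ.IsAddHaarMeasure]

/-- Integration in polar coordinates for nonnegative functions. -/
theorem lintegral_eq_lintegral_polar {F : E → ℝ≥0∞} (hF : Measurable F) :
    ∫⁻ x, F x ∂μ = ∫⁻ θ : Metric.sphere (0 : E) 1, (∫⁻ r in Set.Ioi (0 : ℝ),
      F (r • (θ : E)) * ENNReal.ofReal (r ^ (Module.finrank ℝ E - 1))) ∂μ.toSphere := by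
  have hmp := μ.measurePreserving_homeomorphUnitSphereProd
  have hm : Measurable fun z : Metric.sphere (0 : E) 1 × Set.Ioi (0 : ℝ) =>
      F ((z.2 : ℝ) • (z.1 : E)) :=
    hF.comp ((measurable_subtype_coe.comp measurable_snd).smul
      (measurable_subtype_coe.comp measurable_fst))
  calc ∫⁻ x, F x ∂μ = ∫⁻ x : ({0}ᶜ : Set E), F x ∂(μ.comap (↑)) := by
        rw [lintegral_subtype_comap (measurableSet_singleton _).compl, restrict_compl_singleton]
    _ = ∫⁻ z, F ((z.2 : ℝ) • (z.1 : E))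
          ∂(μ.toSphere.prod (Measure.volumeIoiPow (Module.finrank ℝ E - 1))) := by
        rw [← hmp.lintegral_comp_emb (Homeomorph.measurableEmbedding _)]
        refine lintegral_congr fun x => ?_
        rw [← homeomorphUnitSphereProd_symm_apply_coe, Homeomorph.symm_apply_apply]
    _ = _ := by
        rw [lintegral_prod _ hm.aemeasurable]
        refine lintegral_congr fun θ => ?_
        have hmθ : Measurable fun r : ℝ => F (r • (θ : E)) :=
          hF.comp (measurable_id.smul_const _)
        have hw : Measurable fun r : Set.Ioi (0 : ℝ) =>
            ENNReal.ofReal ((r : ℝ) ^ (Module.finrank ℝ E - 1)) := by fun_prop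
        have hmθ' : Measurable fun r : Set.Ioi (0 : ℝ) => F ((r : ℝ) • (θ : E)) :=
          hmθ.comp measurable_subtype_coe
        rw [Measure.volumeIoiPow, lintegral_withDensity_eq_lintegral_mul _ hw hmθ']
        simp only [Pi.mul_apply]
        rw [lintegral_subtype_comap measurableSet_Ioi fun r : ℝ =>
          ENNReal.ofReal (r ^ (Module.finrank ℝ E - 1)) * F (r • (θ : E))]
        simp_rw [mul_comm]

theorem lintegral_fun_norm_eq {g : ℝ → ℝ≥0∞} (hg : Measurable g) :
    ∫⁻ x, g ‖x‖ ∂μ = μ.toSphere Set.univ *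
      ∫⁻ r in Set.Ioi (0 : ℝ), g r * ENNReal.ofReal (r ^ (Module.finrank ℝ E - 1)) := by
  rw [lintegral_eq_lintegral_polar μ (F := fun x => g ‖x‖) (hg.comp measurable_norm)]
  have : ∀ θ : Metric.sphere (0 : E) 1, ∫⁻ r in Set.Ioi (0 : ℝ),
      g ‖r • (θ : E)‖ * ENNReal.ofReal (r ^ (Module.finrank ℝ E - 1)) =
      ∫⁻ r in Set.Ioi (0 : ℝ), g r * ENNReal.ofReal (r ^ (Module.finrank ℝ E - 1)) := by
    intro θ
    refine setLIntegral_congr_fun measurableSet_Ioi fun r hr => ?_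
    have hr : 0 < r := hr
    rw [norm_smul, norm_eq_of_mem_sphere, mul_one, Real.norm_of_nonneg hr.le]
  simp_rw [this]
  rw [lintegral_const, mul_comm]

end Polar

/-! ### The average of `|y| ^ (-n / p)` over the ball with diameter from the origin to a unit
vector. -/

section HalfBall

theorem lintegral_Ioi_rpow_mul_exp {q : ℝ} (hq : -1 < q) :
    ∫⁻ r in Set.Ioi (0 : ℝ), ENNReal.ofReal (r ^ q * Real.exp (-r ^ 2)) =
      ENNReal.ofReal (1 / 2 * Real.Gamma ((q + 1) / 2)) := by
  have h := integral_rpow_mul_exp_neg_rpow (p := 2) (by norm_num) hq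
  have hi := integrableOn_rpow_mul_exp_neg_rpow hq (p := 2) (by norm_num)
  simp only [Real.rpow_two] at h hi
  rw [← h, ofReal_integral_eq_lintegral_ofReal hi]
  filter_upwards [ae_restrict_mem measurableSet_Ioi] with x hx
  have hx : 0 < x := hx
  positivity

variable {m : ℕ}

/-- The unit vector of the first coordinate axis. -/
def axis (m : ℕ) : EuclideanSpace ℝ (Fin (m + 1)) := EuclideanSpace.single 0 1

theorem norm_axis : ‖axis m‖ = 1 := by simp [axis]

theorem inner_axis (y : EuclideanSpace ℝ (Fin (m + 1))) : inner ℝ y (axis m) = y 0 := by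
  simp [axis, EuclideanSpace.inner_single_right]

theorem measurable_coord : Measurable fun y : EuclideanSpace ℝ (Fin (m + 1)) => y 0 := by
  fun_prop

/-- A Gaussian integral in Cartesian coordinates. -/
theorem lintegral_posPart_rpow_mul_exp {a : ℝ} (ha : 0 < a) :
    ∫⁻ y : EuclideanSpace ℝ (Fin (m + 1)),
      ENNReal.ofReal ((max (y 0) 0) ^ a * Real.exp (-‖y‖ ^ 2)) =
      ENNReal.ofReal (1 / 2 * Real.Gamma ((a + 1) / 2)) * ENNReal.ofReal (√Real.pi) ^ m := by
  set f : Fin (m + 1) → ℝ → ℝ≥0∞ := Fin.cons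
    (fun t => ENNReal.ofReal ((max t 0) ^ a * Real.exp (-t ^ 2)))
    (fun _ t => ENNReal.ofReal (Real.exp (-t ^ 2))) with hf
  have hfm : ∀ i, Measurable (f i) := by
    intro i
    refine Fin.cases ?_ (fun j => ?_) i
    · simp only [hf, Fin.cons_zero]
      exact (((measurable_id.max measurable_const).pow_const a).mul
        (measurable_id.pow_const 2).neg.exp).ennreal_ofReal
    · simp only [hf, Fin.cons_succ]
      exact (measurable_id.pow_const 2).neg.exp.ennreal_ofReal
  have h1 : ∀ y : EuclideanSpace ℝ (Fin (m + 1)),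
      ENNReal.ofReal ((max (y 0) 0) ^ a * Real.exp (-‖y‖ ^ 2)) =
        ∏ i, f i (WithLp.ofLp y i) := by
    intro y
    have hy : Real.exp (-‖y‖ ^ 2) =
        Real.exp (-(y 0) ^ 2) * ∏ i : Fin m, Real.exp (-(y i.succ) ^ 2) := by
      rw [← Real.exp_sum, ← Real.exp_add, EuclideanSpace.norm_sq_eq, Fin.sum_univ_succ]
      congr 1
      simp only [Real.norm_eq_abs, sq_abs, Finset.sum_neg_distrib]
      ring
    rw [hy, ← mul_assoc, ENNReal.ofReal_mul (by positivity),
      ENNReal.ofReal_prod_of_nonneg fun i _ => (Real.exp_pos _).le, Fin.prod_univ_succ]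
    simp [hf]
  simp_rw [h1]
  have hmp := PiLp.volume_preserving_ofLp (Fin (m + 1))
  have h2 := hmp.lintegral_comp_emb
    (MeasurableEquiv.toLp 2 (Fin (m + 1) → ℝ)).symm.measurableEmbedding
    (fun z : Fin (m + 1) → ℝ => ∏ i, f i (z i))
  rw [h2, lintegral_pi_prod hfm, Fin.prod_univ_succ]
  congr 1
  · simp only [hf, Fin.cons_zero]
    rw [← lintegral_Ioi_rpow_mul_exp (by linarith), ← lintegral_indicator measurableSet_Ioi]
    refine lintegral_congr fun t => ?_
    by_cases ht : 0 < t
    · rw [Set.indicator_of_mem (by exact ht), max_eq_left ht.le]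
    · rw [Set.indicator_of_notMem (by exact ht), max_eq_right (not_lt.1 ht),
        Real.zero_rpow ha.ne', zero_mul, ENNReal.ofReal_zero]
  · simp only [hf, Fin.cons_succ]
    have h3 : ∫⁻ t : ℝ, ENNReal.ofReal (Real.exp (-t ^ 2)) = ENNReal.ofReal (√Real.pi) := by
      have hg := integral_gaussian 1
      have hi := integrable_exp_neg_mul_sq one_pos
      simp only [neg_mul, one_mul, div_one] at hg hi
      rw [← hg, ofReal_integral_eq_lintegral_ofReal hi]
      exact Eventually.of_forall fun t => (Real.exp_pos _).le
    rw [h3]; simp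

/-- The moments of the first coordinate on a hemisphere. -/
theorem lintegral_sphere_posPart_rpow {a : ℝ} (ha : 0 < a) :
    (∫⁻ θ : Metric.sphere (0 : EuclideanSpace ℝ (Fin (m + 1))) 1,
      ENNReal.ofReal ((max ((θ : EuclideanSpace ℝ (Fin (m + 1))) 0) 0) ^ a)
        ∂(volume : Measure (EuclideanSpace ℝ (Fin (m + 1)))).toSphere) =
      ENNReal.ofReal (√Real.pi ^ m * Real.Gamma ((a + 1) / 2) /
        Real.Gamma ((a + (m + 1)) / 2)) := by
  have hG : 0 < Real.Gamma ((a + (m + 1)) / 2) := Real.Gamma_pos_of_pos (by positivity)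
  have hG1 : 0 < Real.Gamma ((a + 1) / 2) := Real.Gamma_pos_of_pos (by positivity)
  have hF : Measurable fun y : EuclideanSpace ℝ (Fin (m + 1)) =>
      ENNReal.ofReal ((max (y 0) 0) ^ a * Real.exp (-‖y‖ ^ 2)) :=
    (((measurable_coord.max measurable_const).pow_const a).mul
      (measurable_norm.pow_const 2).neg.exp).ennreal_ofReal
  -- The Gaussian integral known from Cartesian coordinates factors in polar coordinates into the
  -- wanted spherical moment and a radial Gamma integral, by which one divides.
  have h := lintegral_eq_lintegral_polar
    (volume : Measure (EuclideanSpace ℝ (Fin (m + 1)))) hF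
  have hin : ∀ θ : Metric.sphere (0 : EuclideanSpace ℝ (Fin (m + 1))) 1,
      ∫⁻ r in Set.Ioi (0 : ℝ), ENNReal.ofReal
        ((max ((r • (θ : EuclideanSpace ℝ (Fin (m + 1)))) 0) 0) ^ a *
          Real.exp (-‖r • (θ : EuclideanSpace ℝ (Fin (m + 1)))‖ ^ 2)) *
        ENNReal.ofReal (r ^ (Module.finrank ℝ (EuclideanSpace ℝ (Fin (m + 1))) - 1)) =
      ENNReal.ofReal ((max ((θ : EuclideanSpace ℝ (Fin (m + 1))) 0) 0) ^ a) *
        ENNReal.ofReal (1 / 2 * Real.Gamma ((a + (m + 1)) / 2)) := by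
    intro θ
    have hq : (a + m + 1) / 2 = (a + (m + 1)) / 2 := by ring
    rw [← hq, ← lintegral_Ioi_rpow_mul_exp (by have : (0 : ℝ) ≤ m := m.cast_nonneg
                                               linarith),
      ← lintegral_const_mul' _ _ ENNReal.ofReal_ne_top]
    refine setLIntegral_congr_fun measurableSet_Ioi fun r hr => ?_
    have hr : 0 < r := hr
    rw [finrank_euclideanSpace_fin, Nat.add_sub_cancel, norm_smul, norm_eq_of_mem_sphere, mul_one,
      Real.norm_of_nonneg hr.le, ← ENNReal.ofReal_mul (by positivity),
      ← ENNReal.ofReal_mul (by positivity)]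
    congr 1
    have h1 : max ((r • (θ : EuclideanSpace ℝ (Fin (m + 1)))) 0) 0 =
        r * max ((θ : EuclideanSpace ℝ (Fin (m + 1))) 0) 0 := by
      rw [mul_max_of_nonneg _ _ hr.le, mul_zero]; rfl
    rw [h1, Real.mul_rpow hr.le (le_max_right _ _), Real.rpow_add hr, Real.rpow_natCast]
    ring
  simp_rw [hin] at h
  rw [lintegral_posPart_rpow_mul_exp ha, lintegral_mul_const' _ _ ENNReal.ofReal_ne_top] at h
  have hne : ENNReal.ofReal (1 / 2 * Real.Gamma ((a + (m + 1)) / 2)) ≠ 0 := by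
    rw [ne_eq, ENNReal.ofReal_eq_zero, not_le]; positivity
  rw [← ENNReal.mul_left_inj hne ENNReal.ofReal_ne_top, ← h, ← ENNReal.ofReal_pow (by positivity),
    ← ENNReal.ofReal_mul (by positivity), ← ENNReal.ofReal_mul (by positivity)]
  congr 1
  field_simp

/-- The integral of a power of the norm over the ball that has the segment from the origin to a
unit vector as a diameter. -/
theorem lintegral_closedBall_half_axis {a : ℝ} (ha : 0 < a) :
    ∫⁻ y in Metric.closedBall ((1 / 2 : ℝ) • axis m) (1 / 2),
      ENNReal.ofReal (‖y‖ ^ (a - (m + 1))) =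
      ENNReal.ofReal (1 / a * (√Real.pi ^ m * Real.Gamma ((a + 1) / 2) /
        Real.Gamma ((a + (m + 1)) / 2))) := by
  -- In the direction `θ` the condition `|rθ - e / 2| ≤ 1 / 2` reads `r ^ 2 ≤ r θ₀`. The ray
  -- therefore meets the ball in `(0, θ₀]`, or not at all away from the origin when `θ₀ ≤ 0`.
  have hmem : ∀ (r : ℝ) (θ : Metric.sphere (0 : EuclideanSpace ℝ (Fin (m + 1))) 1), 0 < r →
      (r • (θ : EuclideanSpace ℝ (Fin (m + 1))) ∈ Metric.closedBall ((1 / 2 : ℝ) • axis m) (1 / 2) ↔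
        r ≤ max ((θ : EuclideanSpace ℝ (Fin (m + 1))) 0) 0) := by
    intro r θ hr
    rw [mem_closedBall_iff_norm, ← pow_le_pow_iff_left₀ (norm_nonneg _)
      (one_half_pos (α := ℝ)).le two_ne_zero, norm_sub_sq_real, norm_smul, norm_smul,
      norm_eq_of_mem_sphere, norm_axis,
      real_inner_smul_left, real_inner_smul_right, inner_axis, Real.norm_of_nonneg hr.le]
    set c := (θ : EuclideanSpace ℝ (Fin (m + 1))) 0
    have h1 : (r * 1) ^ 2 - 2 * (r * (1 / 2 * c)) + (‖(1 / 2 : ℝ)‖ * 1) ^ 2 ≤ (1 / 2) ^ 2 ↔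
        r * r ≤ r * c := by
      rw [Real.norm_of_nonneg one_half_pos.le]
      constructor <;> intro h <;> nlinarith
    rw [h1, mul_le_mul_iff_right₀ hr, le_max_iff]
    constructor
    · exact Or.inl
    · rintro (h | h)
      · exact h
      · linarith
  have hF : Measurable ((Metric.closedBall ((1 / 2 : ℝ) • axis m) (1 / 2)).indicator
      fun y => ENNReal.ofReal (‖y‖ ^ (a - (m + 1)))) :=
    (measurable_norm.pow_const _).ennreal_ofReal.indicator
      Metric.isClosed_closedBall.measurableSet
  rw [← lintegral_indicator Metric.isClosed_closedBall.measurableSet,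
    lintegral_eq_lintegral_polar _ hF, ENNReal.ofReal_mul (by positivity),
    ← lintegral_sphere_posPart_rpow ha, ← lintegral_const_mul' _ _ ENNReal.ofReal_ne_top]
  refine lintegral_congr fun θ => ?_
  set c := max ((θ : EuclideanSpace ℝ (Fin (m + 1))) 0) 0 with hc
  have hc0 : 0 ≤ c := le_max_right _ _
  rw [← ENNReal.ofReal_mul (by positivity), one_div_mul_eq_div, ← lintegral_Ioc_rpow ha hc0,
    ← Set.inter_eq_left.2 (show Set.Ioc 0 c ⊆ Set.Ioi 0 from fun x hx => hx.1),
    ← setLIntegral_indicator measurableSet_Ioc]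
  refine setLIntegral_congr_fun measurableSet_Ioi fun r hr => ?_
  have hr : 0 < r := hr
  by_cases hrc : r ≤ c
  · rw [Set.indicator_of_mem ((hmem r θ hr).2 hrc),
      Set.indicator_of_mem (show r ∈ Set.Ioc 0 c from ⟨hr, hrc⟩),
      finrank_euclideanSpace_fin, Nat.add_sub_cancel, norm_smul, norm_eq_of_mem_sphere, mul_one,
      Real.norm_of_nonneg hr.le, ← ENNReal.ofReal_mul (by positivity), abs_of_pos hr,
      ← Real.rpow_natCast, ← Real.rpow_add hr]
    congr 2; ring
  · rw [Set.indicator_of_notMem (fun h => hrc ((hmem r θ hr).1 h)),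
      Set.indicator_of_notMem (fun h : r ∈ Set.Ioc 0 c => hrc h.2), zero_mul]

/-- Since `-n / p = n / p' - n`, this is the preceding integral with `a = n / p'`, divided by the
volume of a ball of radius `1 / 2`; the result is the Gamma form of `E_n`. -/
theorem average_closedBall_half_axis {p : ℝ} (hp : 1 < p) (hm : 1 ≤ m) :
    (volume (Metric.closedBall ((1 / 2 : ℝ) • axis m) (1 / 2)))⁻¹ *
      ∫⁻ y in Metric.closedBall ((1 / 2 : ℝ) • axis m) (1 / 2),
        ENNReal.ofReal (‖y‖ ^ (-(((m + 1 : ℕ) : ℝ) / p))) =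
      ENNReal.ofReal (betaBound p (m + 1)) := by
  have hc := conj_pos hp
  have hp0 : 0 < p := by linarith
  have ha : 0 < ((m : ℝ) + 1) / conj p := by positivity
  have hexp : -(((m + 1 : ℕ) : ℝ) / p) = ((m : ℝ) + 1) / conj p - (m + 1) := by
    have := one_div_conj hp
    rw [div_eq_mul_one_div ((m : ℝ) + 1) (conj p), this]
    push_cast; ring
  have hG0 : 0 < Real.Gamma (((m : ℝ) + 1) / 2) := Real.Gamma_pos_of_pos (by positivity)
  have hG1 : 0 < Real.Gamma ((((m : ℝ) + 1) / conj p + 1) / 2) :=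
    Real.Gamma_pos_of_pos (by positivity)
  have hG2 : 0 < Real.Gamma ((((m : ℝ) + 1) / conj p + (m + 1)) / 2) :=
    Real.Gamma_pos_of_pos (by positivity)
  rw [hexp, lintegral_closedBall_half_axis ha, EuclideanSpace.volume_closedBall, Fintype.card_fin,
    betaBound_eq_Gamma hp (by omega)]
  push_cast
  rw [Real.Gamma_add_one (by positivity), ← ENNReal.ofReal_pow (by positivity),
    ← ENNReal.ofReal_mul (by positivity), ← ENNReal.ofReal_inv_of_pos (by positivity),
    ← ENNReal.ofReal_mul (by positivity)]
  congr 1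
  have h1 : ((m : ℝ) + 1) / (2 * conj p) + 1 / 2 = (((m : ℝ) + 1) / conj p + 1) / 2 := by
    field_simp
  have h2 : ((m : ℝ) + 1) / 2 * (1 / conj p + 1) = (((m : ℝ) + 1) / conj p + (m + 1)) / 2 := by
    field_simp
  rw [h1, h2, pow_succ (√Real.pi), pow_succ (1 / 2 : ℝ), one_div_pow]
  have hpi : 0 < √Real.pi := Real.sqrt_pos.2 Real.pi_pos
  field_simp

end HalfBall

/-! ### Behaviour of the ball maximal function under isometries, dilations and multiples. -/

section Symmetry

variable {n : ℕ}

theorem le_ballMaximal (f : EuclideanSpace ℝ (Fin n) → ℝ) {x z : EuclideanSpace ℝ (Fin n)} {r : ℝ}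
    (hr : 0 < r) (hx : x ∈ Metric.closedBall z r) :
    (volume (Metric.closedBall z r))⁻¹ * ∫⁻ y in Metric.closedBall z r, ‖f y‖ₑ ≤
      ballMaximal n f x :=
  le_iSup₂_of_le z r (le_iSup₂_of_le hr hx le_rfl)

theorem ballMaximal_mono {f g : EuclideanSpace ℝ (Fin n) → ℝ} (h : ∀ y, ‖f y‖ₑ ≤ ‖g y‖ₑ)
    (x : EuclideanSpace ℝ (Fin n)) : ballMaximal n f x ≤ ballMaximal n g x :=
  iSup₂_mono fun _ _ => iSup₂_mono fun _ _ => mul_le_mul_right (lintegral_mono h) _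

theorem ballMaximal_const_mul {k : ℝ} (f : EuclideanSpace ℝ (Fin n) → ℝ)
    (x : EuclideanSpace ℝ (Fin n)) :
    ballMaximal n (fun y => k * f y) x = ‖k‖ₑ * ballMaximal n f x := by
  simp only [ballMaximal, ENNReal.mul_iSup, enorm_mul]
  refine iSup_congr fun z => iSup_congr fun r => iSup_congr fun _ => iSup_congr fun _ => ?_
  rw [lintegral_const_mul' _ _ enorm_ne_top, mul_left_comm]

theorem ballMaximal_le_of_bound {f : EuclideanSpace ℝ (Fin n) → ℝ} {C : ℝ≥0∞}
    (h : ∀ y, ‖f y‖ₑ ≤ C) (x : EuclideanSpace ℝ (Fin n)) : ballMaximal n f x ≤ C := by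
  refine iSup₂_le fun z r => iSup₂_le fun hr _ => ?_
  calc (volume (Metric.closedBall z r))⁻¹ * ∫⁻ y in Metric.closedBall z r, ‖f y‖ₑ
      ≤ (volume (Metric.closedBall z r))⁻¹ * ∫⁻ _ in Metric.closedBall z r, C := by
        gcongr; exact h _
    _ = C := by
        rw [setLIntegral_const, mul_left_comm, ENNReal.inv_mul_cancel
          (volume_closedBall_ne_zero z hr) (volume_closedBall_ne_top z r), mul_one]

theorem ballMaximal_le_of_isometry (U : EuclideanSpace ℝ (Fin n) ≃ₗᵢ[ℝ] EuclideanSpace ℝ (Fin n))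
    {f : EuclideanSpace ℝ (Fin n) → ℝ} (hf : ∀ y, f (U y) = f y) (x : EuclideanSpace ℝ (Fin n)) :
    ballMaximal n f x ≤ ballMaximal n f (U x) := by
  refine iSup₂_le fun z r => iSup₂_le fun hr hx => ?_
  refine le_trans (le_of_eq ?_) (le_ballMaximal f (x := U x) (z := U z) hr ?_)
  · have hpre : U ⁻¹' Metric.closedBall (U z) r = Metric.closedBall z r := by
      ext y; simp
    rw [← U.measurePreserving.setLIntegral_comp_preimage_emb
      U.toHomeomorph.measurableEmbedding (fun y => ‖f y‖ₑ) (Metric.closedBall (U z) r), hpre]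
    simp only [hf]
    rw [Measure.addHaar_closedBall_center, Measure.addHaar_closedBall_center _ (U z)]
  · simpa using hx

/-- The maximal function of a radial function is radial. -/
theorem ballMaximal_eq_of_norm_eq {f : EuclideanSpace ℝ (Fin n) → ℝ}
    (hf : ∀ y z, ‖y‖ = ‖z‖ → f y = f z) {x x' : EuclideanSpace ℝ (Fin n)} (h : ‖x‖ = ‖x'‖) :
    ballMaximal n f x = ballMaximal n f x' := by
  have key : ∀ {u v : EuclideanSpace ℝ (Fin n)}, ‖u‖ = ‖v‖ →
      ballMaximal n f u ≤ ballMaximal n f v := by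
    intro u v huv
    -- Vectors of equal norm are exchanged by the reflection in the hyperplane orthogonal to their
    -- difference.
    have := ballMaximal_le_of_isometry (Submodule.reflection (ℝ ∙ (u - v))ᗮ)
      (f := f) (fun y => hf _ _ (LinearIsometryEquiv.norm_map _ y)) u
    rwa [Submodule.reflection_sub huv] at this
  exact le_antisymm (key h) (key h.symm)

/-- Dilation maps balls to balls and multiplies volumes and integrals by the same Jacobian. The
reverse inequality follows by dilating with `c⁻¹`. -/
theorem ballMaximal_comp_smul_le {c : ℝ} (hc : 0 < c) (f : EuclideanSpace ℝ (Fin n) → ℝ)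
    (x : EuclideanSpace ℝ (Fin n)) :
    ballMaximal n (fun y => f (c • y)) x ≤ ballMaximal n f (c • x) := by
  refine iSup₂_le fun z r => iSup₂_le fun hr hx => ?_
  have hpre : (fun y => c • y) ⁻¹' Metric.closedBall (c • z) (c * r) = Metric.closedBall z r := by
    ext y
    simp only [Set.mem_preimage, Metric.mem_closedBall, dist_smul₀, Real.norm_of_nonneg hc.le]
    exact mul_le_mul_iff_right₀ hc
  have hemb : MeasurableEmbedding fun y : EuclideanSpace ℝ (Fin n) => c • y :=
    (Homeomorph.smulOfNeZero c hc.ne').measurableEmbedding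
  set k := ENNReal.ofReal |(c ^ Module.finrank ℝ (EuclideanSpace ℝ (Fin n)))⁻¹| with hk
  have hk0 : k ≠ 0 := by
    rw [hk, ne_eq, ENNReal.ofReal_eq_zero, not_le]; positivity
  have hkt : k ≠ ∞ := ENNReal.ofReal_ne_top
  have hvol : volume (Metric.closedBall z r) = k * volume (Metric.closedBall (c • z) (c * r)) := by
    rw [← hpre, Measure.addHaar_preimage_smul _ hc.ne']
  have hint : ∫⁻ y in Metric.closedBall z r, ‖f (c • y)‖ₑ =
      k * ∫⁻ y in Metric.closedBall (c • z) (c * r), ‖f y‖ₑ := by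
    have h1 := Measure.map_addHaar_smul (volume : Measure (EuclideanSpace ℝ (Fin n))) hc.ne'
    have h2 := hemb.restrict_map volume (Metric.closedBall (c • z) (c * r))
    rw [hpre] at h2
    rw [← hemb.lintegral_map (fun y => ‖f y‖ₑ), ← h2]
    simp only [h1, Measure.restrict_smul, lintegral_smul_measure, smul_eq_mul, ← hk]
  refine le_trans (le_of_eq ?_) (le_ballMaximal f (x := c • x) (z := c • z) (mul_pos hc hr) ?_)
  · rw [hint, hvol, ENNReal.mul_inv (Or.inl hk0) (Or.inl hkt)]
    rw [mul_mul_mul_comm, ENNReal.inv_mul_cancel hk0 hkt, one_mul]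
  · have : x ∈ (fun y => c • y) ⁻¹' Metric.closedBall (c • z) (c * r) := by rwa [hpre]
    exact this

theorem ballMaximal_comp_smul {c : ℝ} (hc : 0 < c) (f : EuclideanSpace ℝ (Fin n) → ℝ)
    (x : EuclideanSpace ℝ (Fin n)) :
    ballMaximal n (fun y => f (c • y)) x = ballMaximal n f (c • x) := by
  refine le_antisymm (ballMaximal_comp_smul_le hc f x) ?_
  have := ballMaximal_comp_smul_le (inv_pos.2 hc) (fun y => f (c • y)) (c • x)
  simpa [smul_smul, hc.ne'] using this

end Symmetry

/-! ### The homogeneous function and its truncations. -/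

section TestFunction

variable {m : ℕ} {p : ℝ}

/-- The homogeneous function `|x| ^ (-n / p)` on `ℝⁿ`, where `n = m + 1`. -/
def normPow (m : ℕ) (p : ℝ) (x : EuclideanSpace ℝ (Fin (m + 1))) : ℝ :=
  ‖x‖ ^ (-(((m + 1 : ℕ) : ℝ) / p))

theorem testFun_eq_indicator (ε N : ℝ) (x : EuclideanSpace ℝ (Fin (m + 1))) :
    testFun (m + 1) p ε N x = (norm ⁻¹' Set.Icc ε N).indicator (normPow m p) x := by
  by_cases h : ‖x‖ ∈ Set.Icc ε N
  · rw [Set.indicator_of_mem (by exact h), testFun, Set.indicator_of_mem h, normPow, Pi.one_apply,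
      mul_one]
  · rw [Set.indicator_of_notMem (by exact h), testFun, Set.indicator_of_notMem h, mul_zero]

theorem enorm_normPow (x : EuclideanSpace ℝ (Fin (m + 1))) :
    ‖normPow m p x‖ₑ = ENNReal.ofReal (‖x‖ ^ (-(((m + 1 : ℕ) : ℝ) / p))) :=
  Real.enorm_eq_ofReal (Real.rpow_nonneg (norm_nonneg x) _)

theorem enorm_testFun_le (ε N : ℝ) (x : EuclideanSpace ℝ (Fin (m + 1))) :
    ‖testFun (m + 1) p ε N x‖ₑ ≤ ‖normPow m p x‖ₑ := by
  rw [testFun_eq_indicator]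
  exact enorm_indicator_le_enorm_self _ _

theorem measurable_normPow : Measurable (normPow m p) := measurable_norm.pow_const _

theorem measurable_testFun (ε N : ℝ) : Measurable (testFun (m + 1) p ε N) := by
  have : testFun (m + 1) p ε N = (norm ⁻¹' Set.Icc ε N).indicator (normPow m p) :=
    funext (testFun_eq_indicator ε N)
  rw [this]
  exact measurable_normPow.indicator (measurable_norm measurableSet_Icc)

/-- Radial symmetry moves `x` to `‖x‖` times the axis vector, and homogeneity, `f(‖x‖ y) = f(x)
f(y)`, extracts the dilation. -/
theorem ballMaximal_normPow (x : EuclideanSpace ℝ (Fin (m + 1))) (hx : x ≠ 0) :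
    ballMaximal (m + 1) (normPow m p) x =
      ‖normPow m p x‖ₑ * ballMaximal (m + 1) (normPow m p) (axis m) := by
  have hr : 0 < ‖x‖ := norm_pos_iff.2 hx
  have h1 : ballMaximal (m + 1) (normPow m p) x =
      ballMaximal (m + 1) (normPow m p) (‖x‖ • axis m) :=
    ballMaximal_eq_of_norm_eq (fun y z h => by simp only [normPow, h])
      (by rw [norm_smul, norm_axis, mul_one, norm_norm])
  have h2 : (fun y => normPow m p (‖x‖ • y)) = fun y => normPow m p x * normPow m p y := by
    ext y
    simp only [normPow]
    rw [norm_smul, norm_norm, Real.mul_rpow hr.le (norm_nonneg y)]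
  rw [h1, ← ballMaximal_comp_smul hr, h2, ballMaximal_const_mul]

/-- The scaling of the homogeneous function persists, except that the truncation window is divided
by `‖x‖`. Away from both edges the rescaled window is almost all of `(0, ∞)`. -/
theorem ballMaximal_testFun (ε N : ℝ) (x : EuclideanSpace ℝ (Fin (m + 1))) (hx : x ≠ 0) :
    ballMaximal (m + 1) (testFun (m + 1) p ε N) x = ‖normPow m p x‖ₑ *
      ballMaximal (m + 1) (testFun (m + 1) p (ε / ‖x‖) (N / ‖x‖)) (axis m) := by
  have hr : 0 < ‖x‖ := norm_pos_iff.2 hx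
  have h1 : ballMaximal (m + 1) (testFun (m + 1) p ε N) x =
      ballMaximal (m + 1) (testFun (m + 1) p ε N) (‖x‖ • axis m) :=
    ballMaximal_eq_of_norm_eq (fun y z h => by simp only [testFun, h])
      (by rw [norm_smul, norm_axis, mul_one, norm_norm])
  have h2 : (fun y => testFun (m + 1) p ε N (‖x‖ • y)) =
      fun y => normPow m p x * testFun (m + 1) p (ε / ‖x‖) (N / ‖x‖) y := by
    ext y
    simp only [testFun, normPow]
    rw [norm_smul, norm_norm, Real.mul_rpow hr.le (norm_nonneg y), mul_assoc]
    congr 2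
    have : ‖x‖ * ‖y‖ ∈ Set.Icc ε N ↔ ‖y‖ ∈ Set.Icc (ε / ‖x‖) (N / ‖x‖) := by
      rw [Set.mem_Icc, Set.mem_Icc, div_le_iff₀ hr, le_div_iff₀ hr, mul_comm ‖x‖]
    by_cases h : ‖x‖ * ‖y‖ ∈ Set.Icc ε N
    · rw [Set.indicator_of_mem h, Set.indicator_of_mem (this.1 h), Pi.one_apply, Pi.one_apply]
    · rw [Set.indicator_of_notMem h, Set.indicator_of_notMem fun h' => h (this.2 h')]
  rw [h1, ← ballMaximal_comp_smul hr, h2, ballMaximal_const_mul]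

theorem enorm_testFun_mono {ε ε' N N' : ℝ} (hε : ε' ≤ ε) (hN : N ≤ N')
    (x : EuclideanSpace ℝ (Fin (m + 1))) :
    ‖testFun (m + 1) p ε N x‖ₑ ≤ ‖testFun (m + 1) p ε' N' x‖ₑ := by
  rw [testFun_eq_indicator, testFun_eq_indicator, enorm_indicator_eq_indicator_enorm,
    enorm_indicator_eq_indicator_enorm]
  exact Set.indicator_le_indicator_of_subset (Set.preimage_mono (Set.Icc_subset_Icc hε hN))
    (fun _ => zero_le) x

/-- The maximal functions of the truncations exhaust that of the homogeneous function. -/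
theorem exists_lt_ballMaximal_testFun (hp : 1 < p) {ℓ : ℝ≥0∞} {x : EuclideanSpace ℝ (Fin (m + 1))}
    (h : ℓ < ballMaximal (m + 1) (normPow m p) x) :
    ∃ R : ℝ, 1 ≤ R ∧ ℓ < ballMaximal (m + 1) (testFun (m + 1) p R⁻¹ R) x := by
  simp only [ballMaximal, lt_iSup_iff] at h
  obtain ⟨z, r, hr, hx, h⟩ := h
  have hmono : ∀ k l : ℕ, k ≤ l → ∀ y : EuclideanSpace ℝ (Fin (m + 1)),
      ‖testFun (m + 1) p ((k : ℝ) + 1)⁻¹ (k + 1) y‖ₑ ≤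
        ‖testFun (m + 1) p ((l : ℝ) + 1)⁻¹ (l + 1) y‖ₑ := by
    intro k l hkl y
    have hkl' : (k : ℝ) ≤ l := by exact_mod_cast hkl
    exact enorm_testFun_mono (inv_anti₀ (by positivity) (by linarith)) (by linarith) y
  have hlim : Tendsto (fun k : ℕ => ∫⁻ y in Metric.closedBall z r,
      ‖testFun (m + 1) p ((k : ℝ) + 1)⁻¹ (k + 1) y‖ₑ) atTop
      (𝓝 (∫⁻ y in Metric.closedBall z r, ‖normPow m p y‖ₑ)) := by
    refine lintegral_tendsto_of_tendsto_of_monotone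
      (fun k => (measurable_testFun _ _).enorm.aemeasurable)
      (Eventually.of_forall fun y k l hkl => hmono k l hkl y) (Eventually.of_forall fun y => ?_)
    refine tendsto_const_nhds.congr' ?_
    by_cases hy : y = 0
    · refine Eventually.of_forall fun k => ?_
      -- Real powers satisfy `0 ^ s = 0` for `s ≠ 0`, so the homogeneous function vanishes at the
      -- origin, as its truncations do.
      have h0 : normPow m p y = 0 := by
        rw [normPow, hy, norm_zero, Real.zero_rpow]
        have : (0 : ℝ) < ((m + 1 : ℕ) : ℝ) / p := by positivity
        linarith
      have h1 := enorm_testFun_le (p := p) ((k : ℝ) + 1)⁻¹ (k + 1) y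
      rw [h0, enorm_zero] at h1 ⊢
      exact (le_antisymm h1 zero_le).symm
    · have hy0 : 0 < ‖y‖ := norm_pos_iff.2 hy
      filter_upwards [eventually_ge_atTop (max ⌈‖y‖⌉₊ ⌈‖y‖⁻¹⌉₊)] with k hk
      have h1 : ‖y‖ ≤ k := (Nat.le_ceil _).trans (by exact_mod_cast (le_max_left _ _).trans hk)
      have h2 : ‖y‖⁻¹ ≤ k := (Nat.le_ceil _).trans (by exact_mod_cast (le_max_right _ _).trans hk)
      rw [testFun_eq_indicator, Set.indicator_of_mem]
      refine ⟨?_, by linarith⟩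
      exact inv_le_of_inv_le₀ hy0 (by linarith)
  have hlim' := ENNReal.Tendsto.const_mul (a := (volume (Metric.closedBall z r))⁻¹) hlim
    (Or.inr (ENNReal.inv_ne_top.2 (volume_closedBall_ne_zero z hr)))
  obtain ⟨k, hk⟩ := (hlim'.eventually_const_lt h).exists
  exact ⟨k + 1, by linarith [k.cast_nonneg (α := ℝ)], hk.trans_le (le_ballMaximal _ hr hx)⟩

end TestFunction

/-! ### The limit of the ratio of norms: bulk, edges, and comparison. -/

section Limit

variable {m : ℕ} {p : ℝ}

/-- The surface measure of the unit sphere of `ℝⁿ`, where `n = m + 1`. -/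
def sphereMass (m : ℕ) : ℝ≥0∞ :=
  (volume : Measure (EuclideanSpace ℝ (Fin (m + 1)))).toSphere Set.univ

theorem sphereMass_ne_zero : sphereMass m ≠ 0 :=
  (Measure.measure_univ_ne_zero).2 (Measure.toSphere_ne_zero _)

theorem sphereMass_ne_top : sphereMass m ≠ ∞ := measure_ne_top _ _

theorem lintegral_norm_preimage_rpow {S : Set ℝ} (hS : MeasurableSet S) (hS0 : S ⊆ Set.Ioi 0)
    (s : ℝ) :
    ∫⁻ x : EuclideanSpace ℝ (Fin (m + 1)) in norm ⁻¹' S, ENNReal.ofReal (‖x‖ ^ s) =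
      sphereMass m * ∫⁻ r in S, ENNReal.ofReal (r ^ (s + m)) := by
  have hg : Measurable (S.indicator fun r : ℝ => ENNReal.ofReal (r ^ s)) :=
    (measurable_id.pow_const s).ennreal_ofReal.indicator hS
  have h1 := lintegral_fun_norm_eq (volume : Measure (EuclideanSpace ℝ (Fin (m + 1)))) hg
  rw [← lintegral_indicator (measurable_norm hS)]
  calc _ = ∫⁻ x : EuclideanSpace ℝ (Fin (m + 1)),
        S.indicator (fun r : ℝ => ENNReal.ofReal (r ^ s)) ‖x‖ := lintegral_congr fun x => rfl
    _ = _ := by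
      rw [h1, sphereMass]
      congr 1
      rw [← Set.inter_eq_left.2 hS0, ← setLIntegral_indicator hS]
      refine setLIntegral_congr_fun measurableSet_Ioi fun r hr => ?_
      have hr : 0 < r := hr
      by_cases h : r ∈ S
      · rw [Set.inter_eq_left.2 hS0, Set.indicator_of_mem h, Set.indicator_of_mem h,
          finrank_euclideanSpace_fin, Nat.add_sub_cancel, ← ENNReal.ofReal_mul (by positivity),
          ← Real.rpow_natCast, ← Real.rpow_add hr]
      · rw [Set.inter_eq_left.2 hS0, Set.indicator_of_notMem h, Set.indicator_of_notMem h, zero_mul]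

/-- The weight `|x| ^ (-n)` becomes `dr / r` in polar coordinates; this logarithmic divergence makes
all bounded errors negligible. -/
theorem lintegral_annulus {a b : ℝ} (ha : 0 < a) (hab : a ≤ b) :
    ∫⁻ x : EuclideanSpace ℝ (Fin (m + 1)) in norm ⁻¹' Set.Icc a b,
      ENNReal.ofReal (‖x‖ ^ (-((m + 1 : ℕ) : ℝ))) =
      sphereMass m * ENNReal.ofReal (Real.log (b / a)) := by
  rw [lintegral_norm_preimage_rpow measurableSet_Icc fun r hr => ha.trans_le hr.1]
  congr 1
  have h1 : ∀ r ∈ Set.Icc a b, ENNReal.ofReal (r ^ (-((m + 1 : ℕ) : ℝ) + m)) =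
      ENNReal.ofReal r⁻¹ := by
    intro r hr
    rw [← Real.rpow_neg_one]
    congr 2; push_cast; ring
  have hint : IntegrableOn (fun r : ℝ => r⁻¹) (Set.Icc a b) :=
    (continuousOn_inv₀.mono fun r hr => (ha.trans_le hr.1).ne').integrableOn_Icc
  rw [setLIntegral_congr_fun measurableSet_Icc h1, ← ofReal_integral_eq_lintegral_ofReal hint,
    integral_Icc_eq_integral_Ioc, ← intervalIntegral.integral_of_le hab,
    integral_inv_of_pos ha (ha.trans_le hab)]
  filter_upwards [ae_restrict_mem measurableSet_Icc] with r hr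
  exact inv_nonneg.2 (ha.trans_le hr.1).le

theorem enorm_normPow_rpow (hp : 0 < p) (x : EuclideanSpace ℝ (Fin (m + 1))) :
    ‖normPow m p x‖ₑ ^ p = ENNReal.ofReal (‖x‖ ^ (-((m + 1 : ℕ) : ℝ))) := by
  rw [enorm_normPow, ENNReal.ofReal_rpow_of_nonneg (by positivity) hp.le,
    ← Real.rpow_mul (norm_nonneg x)]
  congr 2
  field_simp

theorem lintegral_testFun_rpow (hp : 0 < p) {ε N : ℝ} (hε : 0 < ε) (hN : ε ≤ N) :
    ∫⁻ x, ‖testFun (m + 1) p ε N x‖ₑ ^ p = sphereMass m * ENNReal.ofReal (Real.log (N / ε)) := by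
  rw [← lintegral_annulus hε hN, ← lintegral_indicator (measurable_norm measurableSet_Icc)]
  refine lintegral_congr fun x => ?_
  rw [testFun_eq_indicator]
  by_cases h : x ∈ norm ⁻¹' Set.Icc ε N
  · rw [Set.indicator_of_mem h, Set.indicator_of_mem h, enorm_normPow_rpow hp]
  · rw [Set.indicator_of_notMem h, Set.indicator_of_notMem h, enorm_zero,
      ENNReal.zero_rpow_of_pos hp]

theorem memLp_testFun (hp : 0 < p) {ε N : ℝ} (hε : 0 < ε) (hN : ε < N) :
    MemLp (testFun (m + 1) p ε N) (ENNReal.ofReal p) volume ∧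
      eLpNorm (testFun (m + 1) p ε N) (ENNReal.ofReal p) volume ≠ 0 := by
  have hlog : 0 < Real.log (N / ε) := Real.log_pos (by rwa [one_lt_div hε])
  have hfin : sphereMass m * ENNReal.ofReal (Real.log (N / ε)) ≠ ∞ :=
    ENNReal.mul_ne_top sphereMass_ne_top ENNReal.ofReal_ne_top
  refine ⟨⟨(measurable_testFun ε N).aestronglyMeasurable, ?_⟩, ?_⟩
  · rw [eLpNorm_ofReal_eq hp, lintegral_testFun_rpow hp hε hN.le]
    exact ENNReal.rpow_lt_top_of_nonneg (by positivity) hfin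
  · rw [eLpNorm_ofReal_eq hp, lintegral_testFun_rpow hp hε hN.le]
    refine (ENNReal.rpow_pos ?_ hfin).ne'
    exact ENNReal.mul_pos sphereMass_ne_zero (ENNReal.ofReal_pos.2 hlog).ne'

/-- Lower estimate in the bulk. -/
theorem le_lintegral_ballMaximal_testFun (hp : 0 < p) {ℓ : ℝ≥0∞} {R : ℝ} (hR : 1 ≤ R)
    (h : ℓ ≤ ballMaximal (m + 1) (testFun (m + 1) p R⁻¹ R) (axis m)) {ε N : ℝ} (hε : 0 < ε)
    (hN : ε * R ≤ N / R) :
    ℓ ^ p * (sphereMass m * ENNReal.ofReal (Real.log (N / R / (ε * R)))) ≤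
      ∫⁻ x, ballMaximal (m + 1) (testFun (m + 1) p ε N) x ^ p := by
  have hR0 : 0 < R := by linarith
  rw [← lintegral_annulus (mul_pos hε hR0) hN,
    ← lintegral_const_mul _ (measurable_norm.pow_const _).ennreal_ofReal]
  refine le_trans (setLIntegral_mono' (measurable_norm measurableSet_Icc) fun x hx => ?_)
    (setLIntegral_le_lintegral _ _)
  have hx0 : 0 < ‖x‖ := (mul_pos hε hR0).trans_le hx.1
  rw [ballMaximal_testFun _ _ _ (norm_pos_iff.1 hx0), ENNReal.mul_rpow_of_nonneg _ _ hp.le,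
    enorm_normPow_rpow hp, mul_comm]
  gcongr
  -- For `ε R ≤ ‖x‖ ≤ N / R` the rescaled window `[ε / ‖x‖, N / ‖x‖]` contains `[1 / R, R]`.
  refine h.trans (ballMaximal_mono (fun y => enorm_testFun_mono ?_ ?_ y) _)
  · rw [div_le_iff₀ hx0, le_inv_mul_iff₀ hR0, mul_comm]
    exact hx.1
  · rw [le_div_iff₀ hx0, mul_comm]
    exact (le_div_iff₀ hR0).1 hx.2

/-- The test function, hence its maximal function, is at most `ε ^ (-n / p)`. Its `p`-th power `ε ^
(-n)` is compensated by the volume of the ball of radius `ε`. -/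
theorem lintegral_ballMaximal_near (hp : 0 < p) {ε N : ℝ} (hε : 0 < ε) :
    ∫⁻ x : EuclideanSpace ℝ (Fin (m + 1)) in Metric.ball 0 ε,
      ballMaximal (m + 1) (testFun (m + 1) p ε N) x ^ p ≤
      volume (Metric.ball (0 : EuclideanSpace ℝ (Fin (m + 1))) 1) := by
  have hb : ∀ y : EuclideanSpace ℝ (Fin (m + 1)), ‖testFun (m + 1) p ε N y‖ₑ ≤
      ENNReal.ofReal (ε ^ (-(((m + 1 : ℕ) : ℝ) / p))) := by
    intro y
    rw [testFun_eq_indicator]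
    by_cases h : y ∈ norm ⁻¹' Set.Icc ε N
    · rw [Set.indicator_of_mem h, enorm_normPow]
      refine ENNReal.ofReal_le_ofReal (Real.rpow_le_rpow_of_nonpos hε h.1 ?_)
      rw [neg_nonpos]; positivity
    · rw [Set.indicator_of_notMem h, enorm_zero]; exact zero_le
  calc _ ≤ ∫⁻ _ in Metric.ball (0 : EuclideanSpace ℝ (Fin (m + 1))) ε,
        ENNReal.ofReal (ε ^ (-(((m + 1 : ℕ) : ℝ) / p))) ^ p :=
        lintegral_mono fun x => ENNReal.rpow_le_rpow (ballMaximal_le_of_bound hb x) hp.le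
    _ = _ := by
        rw [setLIntegral_const, Measure.addHaar_ball _ _ hε.le, finrank_euclideanSpace_fin,
          ENNReal.ofReal_rpow_of_nonneg (by positivity) hp.le, ← Real.rpow_mul hε.le,
          ← mul_assoc, ← ENNReal.ofReal_mul (by positivity), ← Real.rpow_natCast,
          ← Real.rpow_add hε]
        have : -(((m + 1 : ℕ) : ℝ) / p) * p + ((m + 1 : ℕ) : ℝ) = 0 := by field_simp; ring
        rw [this, Real.rpow_zero, ENNReal.ofReal_one, one_mul]

/-- Here the truncation is simply dropped. Going up to `2 N` instead of `N` costs only an additive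
`log 2` and keeps the remaining points far from the support. -/
theorem lintegral_ballMaximal_mid (hp : 0 < p) {ε N : ℝ} (hε : 0 < ε) (hN : ε ≤ N) :
    ∫⁻ x : EuclideanSpace ℝ (Fin (m + 1)) in norm ⁻¹' Set.Icc ε (2 * N),
      ballMaximal (m + 1) (testFun (m + 1) p ε N) x ^ p ≤
      ballMaximal (m + 1) (normPow m p) (axis m) ^ p *
        (sphereMass m * ENNReal.ofReal (Real.log (2 * N / ε))) := by
  rw [← lintegral_annulus hε (by linarith),
    ← lintegral_const_mul _ (measurable_norm.pow_const _).ennreal_ofReal]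
  refine setLIntegral_mono' (measurable_norm measurableSet_Icc) fun x hx => ?_
  have hx0 : 0 < ‖x‖ := hε.trans_le hx.1
  rw [← enorm_normPow_rpow hp, ← ENNReal.mul_rpow_of_nonneg _ _ hp.le]
  refine ENNReal.rpow_le_rpow ?_ hp.le
  rw [mul_comm, ← ballMaximal_normPow _ (norm_pos_iff.1 hx0)]
  exact ballMaximal_mono (enorm_testFun_le ε N) x

/-- A ball containing `x` and meeting the support, which lies in `‖y‖ ≤ N < ‖x‖ / 2`, has diameter
at least `‖x‖ / 2` and so radius at least `‖x‖ / 4`. The average is then at most the whole integral,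
of order `N ^ (n / p')`, over that volume. Balls missing the support contribute nothing. -/
theorem ballMaximal_testFun_far_le (hp : 1 < p) {ε N : ℝ} (hε : 0 < ε) (hN : ε < N)
    {x : EuclideanSpace ℝ (Fin (m + 1))} (hx : 2 * N < ‖x‖) :
    ballMaximal (m + 1) (testFun (m + 1) p ε N) x ≤
      (4 ^ (m + 1) * (volume (Metric.ball (0 : EuclideanSpace ℝ (Fin (m + 1))) 1))⁻¹ *
        (sphereMass m * ENNReal.ofReal (1 / ((m + 1) / conj p)))) *
      (ENNReal.ofReal (N ^ (((m : ℝ) + 1) / conj p)) *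
        ENNReal.ofReal (‖x‖ ^ (-((m + 1 : ℕ) : ℝ)))) := by
  have hN0 : 0 < N := hε.trans hN
  have hx0 : 0 < ‖x‖ := by linarith
  have hb0 : 0 < ((m : ℝ) + 1) / conj p := div_pos (by positivity) (conj_pos hp)
  refine iSup₂_le fun z r => iSup₂_le fun hr hxz => ?_
  by_cases hex : ∃ y ∈ Metric.closedBall z r, ‖y‖ ≤ N
  · obtain ⟨y, hy, hyN⟩ := hex
    have hr4 : ‖x‖ / 4 ≤ r := by
      have h1 : ‖x - y‖ ≤ r + r := by
        rw [← dist_eq_norm]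
        exact (dist_triangle_right x y z).trans (add_le_add hxz hy)
      have h2 := norm_sub_norm_le x y
      linarith
    have hvol : (volume (Metric.closedBall z r))⁻¹ ≤ 4 ^ (m + 1) *
        (volume (Metric.ball (0 : EuclideanSpace ℝ (Fin (m + 1))) 1))⁻¹ *
        ENNReal.ofReal (‖x‖ ^ (-((m + 1 : ℕ) : ℝ))) := by
      have h1 : ENNReal.ofReal ((‖x‖ / 4) ^ (m + 1)) *
          volume (Metric.ball (0 : EuclideanSpace ℝ (Fin (m + 1))) 1) ≤
          volume (Metric.closedBall z r) := by
        rw [Measure.addHaar_closedBall _ _ hr.le, finrank_euclideanSpace_fin]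
        gcongr
      refine (ENNReal.inv_le_inv.2 h1).trans (le_of_eq ?_)
      rw [ENNReal.mul_inv (Or.inr measure_ball_lt_top.ne)
        (Or.inl ENNReal.ofReal_ne_top), ← ENNReal.ofReal_inv_of_pos (by positivity), mul_right_comm]
      congr 1
      have h4 : (4 : ℝ≥0∞) ^ (m + 1) = ENNReal.ofReal (4 ^ (m + 1)) := by
        rw [ENNReal.ofReal_pow (by norm_num)]; norm_num
      rw [h4, ← ENNReal.ofReal_mul (by positivity), Real.rpow_neg hx0.le, Real.rpow_natCast,
        div_pow, inv_div, div_eq_mul_inv]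
    have hint : ∫⁻ y in Metric.closedBall z r, ‖testFun (m + 1) p ε N y‖ₑ ≤
        sphereMass m * ENNReal.ofReal (1 / ((m + 1) / conj p)) *
          ENNReal.ofReal (N ^ (((m : ℝ) + 1) / conj p)) := by
      have hexp : -(((m + 1 : ℕ) : ℝ) / p) + m = ((m : ℝ) + 1) / conj p - 1 := by
        rw [div_eq_mul_one_div ((m : ℝ) + 1) (conj p), one_div_conj hp]
        push_cast; ring
      calc _ ≤ ∫⁻ y, ‖testFun (m + 1) p ε N y‖ₑ := setLIntegral_le_lintegral _ _
        _ ≤ ∫⁻ y : EuclideanSpace ℝ (Fin (m + 1)) in norm ⁻¹' Set.Ioc 0 N,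
              ENNReal.ofReal (‖y‖ ^ (-(((m + 1 : ℕ) : ℝ) / p))) := by
            rw [← lintegral_indicator (measurable_norm measurableSet_Ioc)]
            refine lintegral_mono fun y => ?_
            rw [testFun_eq_indicator]
            by_cases h : y ∈ norm ⁻¹' Set.Icc ε N
            · rw [Set.indicator_of_mem h, enorm_normPow, Set.indicator_of_mem]
              exact ⟨hε.trans_le h.1, h.2⟩
            · rw [Set.indicator_of_notMem h, enorm_zero]; exact zero_le
        _ = sphereMass m * ENNReal.ofReal (N ^ (((m : ℝ) + 1) / conj p) /
              (((m : ℝ) + 1) / conj p)) := by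
            rw [lintegral_norm_preimage_rpow measurableSet_Ioc (fun r hr => hr.1), hexp,
              ← lintegral_Ioc_rpow hb0 hN0.le]
            congr 1
            exact setLIntegral_congr_fun measurableSet_Ioc fun r hr => by rw [abs_of_pos hr.1]
        _ = _ := by
            rw [mul_assoc, ← ENNReal.ofReal_mul (by positivity), one_div_mul_eq_div]
    refine (mul_le_mul' hvol hint).trans (le_of_eq ?_)
    ring
  · push Not at hex
    have : ∫⁻ y in Metric.closedBall z r, ‖testFun (m + 1) p ε N y‖ₑ = 0 := by
      refine setLIntegral_eq_zero Metric.isClosed_closedBall.measurableSet fun y hy => ?_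
      rw [testFun_eq_indicator, Set.indicator_of_notMem, enorm_zero, Pi.zero_apply]
      exact fun h => (hex y hy).not_ge h.2
    rw [this, mul_zero]
    exact zero_le

/-- The `p`-th power of the pointwise decay is of order `N ^ b ‖x‖ ^ (-(b + n))` with `b = n (p - 1)
> 0`. Its integral over `‖x‖ > 2 N` does not depend on `N`. -/
theorem exists_lintegral_ballMaximal_far_le (hp : 1 < p) :
    ∃ C : ℝ≥0∞, C ≠ ∞ ∧ ∀ ε N : ℝ, 0 < ε → ε < N →
      ∫⁻ x : EuclideanSpace ℝ (Fin (m + 1)) in norm ⁻¹' Set.Ioi (2 * N),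
        ballMaximal (m + 1) (testFun (m + 1) p ε N) x ^ p ≤ C := by
  have hp0 : 0 < p := by linarith
  set K := 4 ^ (m + 1) * (volume (Metric.ball (0 : EuclideanSpace ℝ (Fin (m + 1))) 1))⁻¹ *
    (sphereMass m * ENNReal.ofReal (1 / ((m + 1) / conj p))) with hK
  have hKt : K ≠ ∞ := by
    refine ENNReal.mul_ne_top (ENNReal.mul_ne_top (by finiteness) (ENNReal.inv_ne_top.2 ?_))
      (ENNReal.mul_ne_top sphereMass_ne_top ENNReal.ofReal_ne_top)
    exact (Metric.measure_ball_pos _ _ one_pos).ne'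
  have hpt : ∀ {ε N : ℝ} {x : EuclideanSpace ℝ (Fin (m + 1))}, 0 < ε → ε < N → 2 * N < ‖x‖ →
      _ ≤ K * _ := fun hε hN hx => ballMaximal_testFun_far_le hp hε hN hx
  clear_value K
  set b : ℝ := ((m : ℝ) + 1) * (p - 1) with hb
  have hb0 : 0 < b := mul_pos (by positivity) (by linarith)
  have hbp : ((m : ℝ) + 1) / conj p * p = b := by
    rw [div_eq_mul_one_div, one_div_conj hp, hb]; field_simp
  refine ⟨K ^ p * (sphereMass m * ENNReal.ofReal (2 ^ (-b) / b)), ?_, fun ε N hε hN => ?_⟩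
  · exact ENNReal.mul_ne_top (ENNReal.rpow_ne_top_of_nonneg hp0.le hKt)
      (ENNReal.mul_ne_top sphereMass_ne_top ENNReal.ofReal_ne_top)
  have hN0 : 0 < N := hε.trans hN
  have hS : MeasurableSet (norm ⁻¹' Set.Ioi (2 * N) : Set (EuclideanSpace ℝ (Fin (m + 1)))) :=
    measurable_norm measurableSet_Ioi
  calc _ ≤ ∫⁻ x : EuclideanSpace ℝ (Fin (m + 1)) in norm ⁻¹' Set.Ioi (2 * N),
        K ^ p * (ENNReal.ofReal (N ^ b) * ENNReal.ofReal (‖x‖ ^ (-(b + (m + 1))))) := by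
        refine setLIntegral_mono' hS fun x hx => ?_
        have hx : 2 * N < ‖x‖ := hx
        refine (ENNReal.rpow_le_rpow (hpt hε hN hx) hp0.le).trans
          (le_of_eq ?_)
        rw [ENNReal.mul_rpow_of_nonneg _ _ hp0.le, ENNReal.mul_rpow_of_nonneg _ _ hp0.le,
          ENNReal.ofReal_rpow_of_nonneg (by positivity) hp0.le,
          ENNReal.ofReal_rpow_of_nonneg (by positivity) hp0.le, ← Real.rpow_mul hN0.le,
          ← Real.rpow_mul (norm_nonneg x), hbp]
        congr 4
        rw [hb]; push_cast; ring
    _ = K ^ p * (ENNReal.ofReal (N ^ b) * (sphereMass m *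
          ∫⁻ r in Set.Ioi (2 * N), ENNReal.ofReal (r ^ (-b - 1)))) := by
        rw [lintegral_const_mul' _ _ (ENNReal.rpow_ne_top_of_nonneg hp0.le hKt),
          lintegral_const_mul' _ _ ENNReal.ofReal_ne_top,
          lintegral_norm_preimage_rpow measurableSet_Ioi
            fun r hr => (by positivity : 0 < 2 * N).trans hr]
        have : -(b + (m + 1)) + m = -b - 1 := by ring
        rw [this]
    _ = _ := by
        have h2N : 0 < 2 * N := by positivity
        have hi := integrableOn_Ioi_rpow_of_lt (by linarith : -b - 1 < -1) h2N
        rw [← ofReal_integral_eq_lintegral_ofReal hi, integral_Ioi_rpow_of_lt (by linarith) h2N,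
          mul_left_comm (ENNReal.ofReal (N ^ b)), ← ENNReal.ofReal_mul (by positivity)]
        · congr 3
          have hNb : N ^ b * N ^ (-b) = 1 := by rw [← Real.rpow_add hN0]; simp
          rw [sub_add_cancel, Real.mul_rpow (by norm_num) hN0.le]
          calc N ^ b * (-(2 ^ (-b) * N ^ (-b)) / (-b)) = (N ^ b * N ^ (-b)) * (2 ^ (-b) / b) := by
                field_simp
            _ = _ := by rw [hNb, one_mul]
        · filter_upwards [ae_restrict_mem measurableSet_Ioi] with r hr
          exact Real.rpow_nonneg (h2N.trans hr).le _

theorem exists_lintegral_ballMaximal_le (hp : 1 < p) :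
    ∃ C : ℝ≥0∞, C ≠ ∞ ∧ ∀ ε N : ℝ, 0 < ε → ε < N →
      ∫⁻ x, ballMaximal (m + 1) (testFun (m + 1) p ε N) x ^ p ≤
        ballMaximal (m + 1) (normPow m p) (axis m) ^ p *
          (sphereMass m * ENNReal.ofReal (Real.log (2 * N / ε))) + C := by
  have hp0 : 0 < p := by linarith
  obtain ⟨C, hC, hfar⟩ := exists_lintegral_ballMaximal_far_le (m := m) hp
  refine ⟨volume (Metric.ball (0 : EuclideanSpace ℝ (Fin (m + 1))) 1) + C,
    ENNReal.add_ne_top.2 ⟨measure_ball_lt_top.ne, hC⟩, fun ε N hε hN => ?_⟩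
  have hcover : (Set.univ : Set (EuclideanSpace ℝ (Fin (m + 1)))) ⊆
      norm ⁻¹' Set.Icc ε (2 * N) ∪ (Metric.ball 0 ε ∪ norm ⁻¹' Set.Ioi (2 * N)) := by
    intro x _
    by_cases h1 : ‖x‖ < ε
    · exact Or.inr (Or.inl (by simpa using h1))
    · by_cases h2 : 2 * N < ‖x‖
      · exact Or.inr (Or.inr h2)
      · exact Or.inl ⟨not_lt.1 h1, not_lt.1 h2⟩
  rw [← setLIntegral_univ]
  refine (lintegral_mono_set hcover).trans ((lintegral_union_le _ _ _).trans ?_)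
  refine add_le_add (lintegral_ballMaximal_mid hp0 hε hN.le)
    ((lintegral_union_le _ _ _).trans ?_)
  exact add_le_add (lintegral_ballMaximal_near hp0 hε) (hfar ε N hε hN)

theorem tendsto_log_div_atTop :
    Tendsto (fun q : ℝ × ℝ => Real.log (q.2 / q.1)) (𝓝[>] 0 ×ˢ atTop) atTop := by
  refine Real.tendsto_log_atTop.comp ?_
  have h1 : Tendsto (fun q : ℝ × ℝ => q.2) (𝓝[>] (0 : ℝ) ×ˢ atTop) atTop := tendsto_snd
  have h2 : Tendsto (fun q : ℝ × ℝ => q.1⁻¹) (𝓝[>] (0 : ℝ) ×ˢ atTop) atTop :=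
    tendsto_inv_nhdsGT_zero.comp tendsto_fst
  simpa only [div_eq_mul_inv] using h1.atTop_mul_atTop₀ h2

theorem eventually_pos_and_lt :
    ∀ᶠ q : ℝ × ℝ in 𝓝[>] 0 ×ˢ atTop, 0 < q.1 ∧ q.1 < q.2 := by
  have h1 : ∀ᶠ q : ℝ × ℝ in 𝓝[>] 0 ×ˢ atTop, 0 < q.1 ∧ q.1 < 1 :=
    tendsto_fst.eventually (Ioo_mem_nhdsGT one_pos)
  have h2 : ∀ᶠ q : ℝ × ℝ in 𝓝[>] (0 : ℝ) ×ˢ atTop, 1 < q.2 :=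
    tendsto_snd.eventually (eventually_gt_atTop 1)
  filter_upwards [h1, h2] with q hq1 hq2
  exact ⟨hq1.1, hq1.2.trans hq2⟩

/-- The quotients of norms of the test functions converge to the value of the maximal function of
the homogeneous function at a unit vector. -/
theorem tendsto_ratio_testFun (hp : 1 < p) :
    Tendsto (fun q : ℝ × ℝ =>
        eLpNorm (ballMaximal (m + 1) (testFun (m + 1) p q.1 q.2)) (ENNReal.ofReal p) volume /
        eLpNorm (testFun (m + 1) p q.1 q.2) (ENNReal.ofReal p) volume)
      (𝓝[>] 0 ×ˢ atTop) (𝓝 (ballMaximal (m + 1) (normPow m p) (axis m))) := by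
  have hp0 : 0 < p := by linarith
  set L := ballMaximal (m + 1) (normPow m p) (axis m) with hL
  set T : ℝ × ℝ → ℝ := fun q => Real.log (q.2 / q.1) with hT
  have hTlim : Tendsto T (𝓝[>] 0 ×ˢ atTop) atTop := tendsto_log_div_atTop
  have hTpos : ∀ᶠ q in 𝓝[>] 0 ×ˢ atTop, 0 < T q := hTlim.eventually_gt_atTop 0
  set A : ℝ × ℝ → ℝ≥0∞ := fun q =>
    ∫⁻ x, ballMaximal (m + 1) (testFun (m + 1) p q.1 q.2) x ^ p with hA
  have hratio : ∀ᶠ q : ℝ × ℝ in 𝓝[>] 0 ×ˢ atTop,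
      (A q / (sphereMass m * ENNReal.ofReal (T q))) ^ (1 / p) =
      eLpNorm (ballMaximal (m + 1) (testFun (m + 1) p q.1 q.2)) (ENNReal.ofReal p) volume /
        eLpNorm (testFun (m + 1) p q.1 q.2) (ENNReal.ofReal p) volume := by
    filter_upwards [eventually_pos_and_lt] with q hq
    rw [eLpNorm_ofReal_eq hp0, eLpNorm_ofReal_eq hp0, lintegral_testFun_rpow hp0 hq.1 hq.2.le,
      ENNReal.div_rpow_of_nonneg _ _ (by positivity)]
    rfl
  have hone : ∀ k : ℝ, Tendsto (fun q => ENNReal.ofReal ((T q + k) / T q))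
      (𝓝[>] 0 ×ˢ atTop) (𝓝 1) := by
    intro k
    rw [← ENNReal.ofReal_one]
    refine ENNReal.tendsto_ofReal ?_
    have h1 : Tendsto (fun q => 1 + k / T q) (𝓝[>] 0 ×ˢ atTop) (𝓝 (1 + 0)) :=
      tendsto_const_nhds.add (tendsto_const_nhds.div_atTop hTlim)
    rw [add_zero] at h1
    refine h1.congr' ?_
    filter_upwards [hTpos] with q hq
    field_simp
  have hroot : ∀ a : ℝ≥0∞, (a ^ p) ^ (1 / p) = a := fun a => by
    rw [← ENNReal.rpow_mul, mul_one_div_cancel hp0.ne', ENNReal.rpow_one]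
  have hquot : ∀ (a : ℝ≥0∞) {t k : ℝ}, 0 < t → a * (sphereMass m * ENNReal.ofReal k) /
      (sphereMass m * ENNReal.ofReal t) = a * ENNReal.ofReal (k / t) := by
    intro a t k ht
    rw [mul_div_assoc, ENNReal.mul_div_mul_left _ _ sphereMass_ne_zero sphereMass_ne_top,
      ENNReal.ofReal_div_of_pos ht]
  -- Two one-sided estimates in the order topology, valid also if `L` is infinite. From below, `L`
  -- is approached by a fixed window `[1 / R, R]`, which loses `2 log R` out of `T = log (N / ε)`.
  -- From above, the errors are `log 2` and a bounded constant. All are negligible against `T → ∞`.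
  refine Tendsto.congr' hratio (tendsto_order.2 ⟨fun ℓ hℓ => ?_, fun u hu => ?_⟩)
  · obtain ⟨ℓ', hℓ', hℓL⟩ := exists_between hℓ
    obtain ⟨R, hR1, hR⟩ := exists_lt_ballMaximal_testFun hp hℓL
    have hR0 : 0 < R := by linarith
    have hlim : Tendsto (fun q => (ℓ' ^ p * ENNReal.ofReal ((T q + -(2 * Real.log R)) / T q)) ^
        (1 / p)) (𝓝[>] 0 ×ˢ atTop) (𝓝 ((ℓ' ^ p * 1) ^ (1 / p))) :=
      (ENNReal.Tendsto.const_mul (hone _) (Or.inl one_ne_zero)).ennrpow_const _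
    rw [mul_one, hroot] at hlim
    filter_upwards [hlim.eventually_const_lt hℓ', hTpos, eventually_pos_and_lt,
      hTlim.eventually_ge_atTop (2 * Real.log R)] with q hq hTq hqpos hTR
    refine hq.trans_le (ENNReal.rpow_le_rpow ?_ (by positivity))
    have hq2 : 0 < q.2 := hqpos.1.trans hqpos.2
    have hlog : Real.log (q.2 / R / (q.1 * R)) = T q + -(2 * Real.log R) := by
      have h1 : q.2 / R / (q.1 * R) = q.2 / q.1 / (R * R) := by
        have := hqpos.1.ne'
        field_simp
      rw [h1, Real.log_div (div_pos hq2 hqpos.1).ne' (by positivity), Real.log_mul hR0.ne' hR0.ne']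
      ring
    have hcond : q.1 * R ≤ q.2 / R := by
      have h1 : 0 ≤ Real.log (q.2 / R / (q.1 * R)) := by rw [hlog]; linarith
      have hpos : 0 < q.1 * R := mul_pos hqpos.1 hR0
      have h2 := (Real.log_nonneg_iff (div_pos (div_pos hq2 hR0) hpos)).1 h1
      exact (one_le_div hpos).1 h2
    have := le_lintegral_ballMaximal_testFun hp0 hR1 hR.le hqpos.1 hcond
    rw [hlog] at this
    rw [← hquot _ hTq]
    exact ENNReal.div_le_div_right this _
  · obtain ⟨C, hC, hle⟩ := exists_lintegral_ballMaximal_le (m := m) hp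
    have hzero : Tendsto (fun q => C / sphereMass m * ENNReal.ofReal (T q)⁻¹)
        (𝓝[>] 0 ×ˢ atTop) (𝓝 (C / sphereMass m * 0)) := by
      refine ENNReal.Tendsto.const_mul ?_ (Or.inr (ENNReal.div_ne_top hC sphereMass_ne_zero))
      rw [← ENNReal.ofReal_zero]
      exact ENNReal.tendsto_ofReal (tendsto_inv_atTop_zero.comp hTlim)
    have hlim : Tendsto (fun q => (L ^ p * ENNReal.ofReal ((T q + Real.log 2) / T q) +
        C / sphereMass m * ENNReal.ofReal (T q)⁻¹) ^ (1 / p)) (𝓝[>] 0 ×ˢ atTop)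
        (𝓝 ((L ^ p * 1 + C / sphereMass m * 0) ^ (1 / p))) :=
      ((ENNReal.Tendsto.const_mul (hone _) (Or.inl one_ne_zero)).add hzero).ennrpow_const _
    rw [mul_one, mul_zero, add_zero, hroot] at hlim
    filter_upwards [hlim.eventually_lt_const hu, hTpos, eventually_pos_and_lt] with q hq hTq hqpos
    refine lt_of_le_of_lt (ENNReal.rpow_le_rpow ?_ (by positivity)) hq
    have hq2 : 0 < q.2 := hqpos.1.trans hqpos.2
    have hlog : Real.log (2 * q.2 / q.1) = T q + Real.log 2 := by
      rw [mul_div_assoc, Real.log_mul two_ne_zero (div_pos hq2 hqpos.1).ne', add_comm]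
    have := hle q.1 q.2 hqpos.1 hqpos.2
    rw [hlog] at this
    refine (ENNReal.div_le_div_right this _).trans (le_of_eq ?_)
    rw [ENNReal.add_div, hquot _ hTq, ENNReal.ofReal_inv_of_pos hTq]
    congr 1
    rw [div_eq_mul_inv, ENNReal.mul_inv (Or.inl sphereMass_ne_zero) (Or.inl sphereMass_ne_top),
      div_eq_mul_inv, mul_assoc]

/-- The unit vector is the endpoint of a diameter of the half ball, so it lies on the boundary of a
closed ball that is admissible in the supremum. -/
theorem betaBound_le_ballMaximal_normPow (hp : 1 < p) (hm : 1 ≤ m) :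
    ENNReal.ofReal (betaBound p (m + 1)) ≤ ballMaximal (m + 1) (normPow m p) (axis m) := by
  rw [← average_closedBall_half_axis hp hm]
  simp_rw [← enorm_normPow]
  refine le_ballMaximal _ one_half_pos ?_
  rw [mem_closedBall_iff_norm]
  have : axis m - (1 / 2 : ℝ) • axis m = (1 / 2 : ℝ) • axis m := by
    rw [← one_smul ℝ (axis m), smul_smul, ← sub_smul]; norm_num
  rw [this, norm_smul, norm_axis]
  norm_num

theorem betaBound_le_opNorm (hp : 1 < p) {n : ℕ} (hn : 2 ≤ n) :
    ENNReal.ofReal (betaBound p n) ≤ opNorm p (ballMaximal n) := by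
  obtain ⟨m, rfl⟩ : ∃ m, n = m + 1 := ⟨n - 1, by omega⟩
  refine (betaBound_le_ballMaximal_normPow hp (by omega)).trans
    (le_of_tendsto (tendsto_ratio_testFun hp) ?_)
  filter_upwards [eventually_pos_and_lt] with q hq
  have := memLp_testFun (m := m) (p := p) (by linarith) hq.1 hq.2
  exact eLpNorm_div_le_opNorm this.1 this.2

end Limit

/-! ### Exponential growth of both operator norms, and the assembled theorem. -/

theorem growsExponentially_opNorm_ballMaximal {p : ℝ} (hp : 1 < p) :
    GrowsExponentially fun n => opNorm p (ballMaximal n) := by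
  have hg := one_lt_growthBase hp
  have hc := conj_pos hp
  set A := conj p * √((1 + 1 / conj p) / 2) with hA
  have hA0 : 0 < A := by positivity
  -- The asymptotic equivalence makes `E_n` at least half of `A √(growthBase p) ^ n` for large `n`,
  -- whence the constant `A / 2`; the upper bound comes from Vitali's lemma.
  refine ⟨√(growthBase p), A / 2, 5, conj p, by rwa [Real.lt_sqrt zero_le_one, one_pow],
    by positivity, ?_⟩
  filter_upwards [(betaBound_isEquivalent hp).isLittleO.bound one_half_pos, eventually_ge_atTop 2]
    with n hbound hn
  refine ⟨(ENNReal.ofReal_le_ofReal ?_).trans (betaBound_le_opNorm hp hn),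
    opNorm_ballMaximal_le hp n⟩
  have hpow : growthBase p ^ ((n : ℝ) / 2) = √(growthBase p) ^ n := by
    rw [Real.sqrt_eq_rpow, ← Real.rpow_natCast, ← Real.rpow_mul (by linarith)]
    congr 1; ring
  simp only [Pi.sub_apply, ← hA, hpow] at hbound
  rw [Real.norm_eq_abs, Real.norm_of_nonneg (by positivity : 0 ≤ A * √(growthBase p) ^ n)] at hbound
  linarith [neg_abs_le (betaBound p n - A * √(growthBase p) ^ n)]

theorem opNorm_strongMaximal_lt {p : ℝ} (hp : 1 < p) {n : ℕ} (hn : 1 ≤ n) :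
    opNorm p (strongMaximal n) < ENNReal.ofReal ((2 * p / (p - 1)) ^ n) := by
  obtain ⟨c, ⟨hc0, -⟩, -, -, hlt, hmax⟩ := exists_sharpConstant hp
  exact (opNorm_strongMaximal_le hp hc0 hmax n).trans_lt
    ((ENNReal.ofReal_lt_ofReal_iff (pow_pos (hc0.trans hlt) n)).2
      (pow_lt_pow_left₀ hlt hc0.le (by omega)))

theorem growsExponentially_opNorm_strongMaximal {p : ℝ} (hp : 1 < p) :
    GrowsExponentially fun n => opNorm p (strongMaximal n) := by
  refine ⟨p / (p - 1), 1, 2 * p / (p - 1), 1, one_lt_conj hp, one_pos, ?_⟩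
  filter_upwards [eventually_ge_atTop 1] with n hn
  rw [one_mul, one_mul]
  exact ⟨(lt_opNorm_strongMaximal hp hn).le, (opNorm_strongMaximal_lt hp hn).le⟩

end UncenteredMaximal

end


theorem mainTheorem3 (p : ℝ) (hp : 1 < p) :
    -- the operator norm of the ball maximal function on `Lᵖ(ℝⁿ)` grows exponentially
    UncenteredMaximal.GrowsExponentially
      (fun n => UncenteredMaximal.opNorm p (UncenteredMaximal.ballMaximal n)) ∧
    -- the test functions lie in `Lᵖ`, are not zero there, and the ratio of norms has a limit,
    -- as `ε → 0` and `N → ∞`, that is at least the explicit expression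
    (∀ n : ℕ, 2 ≤ n →
      (∀ ε N : ℝ, 0 < ε → ε < N →
        MemLp (UncenteredMaximal.testFun n p ε N) (ENNReal.ofReal p) volume ∧
        eLpNorm (UncenteredMaximal.testFun n p ε N) (ENNReal.ofReal p) volume ≠ 0) ∧
      ∃ L : ℝ≥0∞,
        Tendsto (fun q : ℝ × ℝ =>
            eLpNorm (UncenteredMaximal.ballMaximal n (UncenteredMaximal.testFun n p q.1 q.2))
              (ENNReal.ofReal p) volume /
            eLpNorm (UncenteredMaximal.testFun n p q.1 q.2) (ENNReal.ofReal p) volume)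
          (𝓝[>] 0 ×ˢ atTop) (𝓝 L) ∧
        ENNReal.ofReal (UncenteredMaximal.betaBound p n) ≤ L) ∧
    -- hence the operator norm is at least that expression
    (∀ n : ℕ, 2 ≤ n → ENNReal.ofReal (UncenteredMaximal.betaBound p n) ≤
      UncenteredMaximal.opNorm p (UncenteredMaximal.ballMaximal n)) ∧
    -- the expression as an integral
    (∀ n : ℕ, 2 ≤ n → UncenteredMaximal.betaBound p n =
      2 ^ n * UncenteredMaximal.conj p *
        (UncenteredMaximal.sphereArea (n - 2) / UncenteredMaximal.sphereArea (n - 1)) *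
        ∫ s in (0 : ℝ)..1, s ^ ((n : ℝ) / UncenteredMaximal.conj p) *
          (1 - s ^ 2) ^ (((n : ℝ) - 3) / 2)) ∧
    -- its asymptotics as `n → ∞`
    (UncenteredMaximal.betaBound p ~[atTop] fun n : ℕ =>
      UncenteredMaximal.conj p * √((1 + 1 / UncenteredMaximal.conj p) / 2) *
        UncenteredMaximal.growthBase p ^ ((n : ℝ) / 2)) ∧
    1 < UncenteredMaximal.growthBase p ∧
    -- the unique positive solution `c` of `(p - 1) x^p - p x^{p-1} - 1 = 0`
    (∃ c : ℝ, (0 < c ∧ (p - 1) * c ^ p - p * c ^ (p - 1) - 1 = 0) ∧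
      (∀ x : ℝ, 0 < x → (p - 1) * x ^ p - p * x ^ (p - 1) - 1 = 0 → x = c) ∧
      p / (p - 1) < c ∧ c < 2 * p / (p - 1)) ∧
    -- exponential growth for the strong maximal function
    (∀ n : ℕ, 1 ≤ n →
      ENNReal.ofReal ((p / (p - 1)) ^ n) <
        UncenteredMaximal.opNorm p (UncenteredMaximal.strongMaximal n) ∧
      UncenteredMaximal.opNorm p (UncenteredMaximal.strongMaximal n) <
        ENNReal.ofReal ((2 * p / (p - 1)) ^ n)) ∧
    UncenteredMaximal.GrowsExponentially
      (fun n => UncenteredMaximal.opNorm p (UncenteredMaximal.strongMaximal n)) := by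
  refine ⟨UncenteredMaximal.growsExponentially_opNorm_ballMaximal hp, fun n hn => ?_,
    fun n hn => UncenteredMaximal.betaBound_le_opNorm hp hn,
    fun n hn => UncenteredMaximal.betaBound_eq_integral hp hn,
    UncenteredMaximal.betaBound_isEquivalent hp, UncenteredMaximal.one_lt_growthBase hp, ?_,
    fun n hn => ⟨UncenteredMaximal.lt_opNorm_strongMaximal hp hn,
      UncenteredMaximal.opNorm_strongMaximal_lt hp hn⟩,
    UncenteredMaximal.growsExponentially_opNorm_strongMaximal hp⟩
  · obtain ⟨m, rfl⟩ : ∃ m, n = m + 1 := ⟨n - 1, by omega⟩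
    exact ⟨fun ε N hε hN => UncenteredMaximal.memLp_testFun (by linarith) hε hN, _,
      UncenteredMaximal.tendsto_ratio_testFun hp,
      UncenteredMaximal.betaBound_le_ballMaximal_normPow hp (by omega)⟩
  · obtain ⟨c, hc, huniq, hlow, hupp, -⟩ := UncenteredMaximal.exists_sharpConstant hp
    exact ⟨c, hc, huniq, hlow, hupp⟩
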